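/- Let $X$ be a connected 2-complex, i.e. a connected compact Hausdorff space in which every point $x$ has a closed neighbourhood homeomorphic to the cone over a finite graph $\Gamma_x$, with $x$ corresponding to the cone point. The point $x$ is generic, boundary or ridge if $\Gamma_x$ is respectively a circle, a segment, or the graph with two vertices joined by $n\geq 3$ edges; otherwise it is singular. An oriented knot $K$ in $X$ is an oriented closed curve in the union of the generic and ridge points, which crosses itself in finitely many double transversal crossings at generic points, which at each of its ridge points passes transversally from one branch of $X$ to a different branch, and which at every crossing is provided with two dots in opposite areas among the four areas adjacent to the crossing. The mirror image $K^{\mathrm{mir}}$ is obtained by replacing, at every crossing, the pair of dots with the opposite pair; $-K$ is $K$ with opposite orientation. Two oriented knots are isotopic if they are related by a finite sequence of ambient isotopies of $X$, the following orientation-preserving moves, and their inverses: the (dotted) Reidemeister moves in discs of generic points; pushing an arc across the ridge from one branch into another; pushing a (dotted) crossing of two arcs across the ridge from one branch into another; replacing an arc that passes the ridge from a branch $i$ directly to a branch $j$ by an arc that passes from $i$ to a third branch $k$ and then from $k$ to $j$; and, for a singular point $x$ and a circle $S$ embedded in $\Gamma_x$ such that the knot meets the disc $D=$ cone over $S$ along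 an embedded arc with endpoints in $\partial D=S$, replacing this arc with another embedded arc in $D\setminus\{x\}$ with the same endpoints and transversal to the ridge. A local knot is a knot obtained by transporting a dotted knot diagram in $\mathbb R^2$ along an embedding of $\mathbb R^2$ in the set of generic points of $X$. Let $\Pi$ be the set of free homotopy classes of loops in $X$, let $1\in\Pi$ be the class of contractible loops, and let $\mathbb Z\Pi$ be the free abelian group with basis $\Pi$. For an oriented knot $K$ let $k\in\Pi$ be the class of its underlying loop. For a crossing $c$ of $K$ let $k_1^c,k_2^c\in\Pi$ be the classes of the two loops obtained by the orientation-preserving smoothing of $K$ at $c$, and let $\operatorname{sign}(c)=+1$ if the dots at $c$ lie in the area between the two outgoing branches and in the opposite area, and $\operatorname{sign}(c)=-1$ otherwise. Set $$\operatorname{co}(K)=\sum_c \operatorname{sign}(c)\,\bigl(k_1^c\otimes k_2^c+k_2^c\otimes k_1^c-k\otimes 1-1\otimes k\bigr)\in\mathbb Z\Pi\otimes_{\mathbb Z}\mathbb Z\Pi,$$ where $c$ runs over all crossings of $K$. Then: (i) if $K$ and $K'$ are isotopic oriented knots in $X$, then $\operatorname{co}(K)=\operatorname{co}(K')$; (ii)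 $\operatorname{co}(K^{\mathrm{mir}})=-\operatorname{co}(K)$ for every oriented knot $K$ in $X$; (iii) $\operatorname{co}(-K)=\overline{\operatorname{co}(K)}$ for every oriented knot $K$ in $X$, where the overline is the tensor square of the involution of $\mathbb Z\Pi$ induced by reversing the direction of loops; (iv) $\operatorname{co}(K)=0$ for every local knot $K$ in $X$. -/

import Mathlib

open Set Filter Topology
open scoped TensorProduct

noncomputable section

namespace TwoComplex

/-! ### Graphs, cones and 2-complexes -/

/-- The cone over the finite graph `G`, realised in `ℝⁿ`.  The points of the graph itself are the
convex combinations of at most two adjacent vertices, i.e. the points of the cone with coordinate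
sum `1`; a point of the cone is `r • y` with `r ∈ [0, 1]` and `y` in the graph.  (Every finite
graph, with loops and multiple edges allowed, becomes simple after subdividing its edges, so up to
homeomorphism this gives the cones over all finite graphs.) -/
def Cone {n : ℕ} (G : SimpleGraph (Fin n)) : Type :=
  {y : Fin n → ℝ // (∀ v, 0 ≤ y v) ∧ ∑ v, y v ≤ 1 ∧
    ((∀ v, y v = 0) ∨ ∃ v w, (v = w ∨ G.Adj v w) ∧ ∀ u, y u ≠ 0 → u = v ∨ u = w)}

instance {n : ℕ} (G : SimpleGraph (Fin n)) : TopologicalSpace (Cone G) :=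
  instTopologicalSpaceSubtype

/-- The cone point. -/
def Cone.apex {n : ℕ} (G : SimpleGraph (Fin n)) : Cone G :=
  ⟨fun _ => 0, by simp, by simp, Or.inl (by simp)⟩

/-- The graph `G` as a subspace of its cone. -/
def Cone.base {n : ℕ} (G : SimpleGraph (Fin n)) : Set (Cone G) := {y | ∑ v, y.1 v = 1}

/-- `e` is a homeomorphism of the cone over `G` onto a closed neighbourhood of `x`, carrying the
cone point to `x` (closedness is automatic: cones are compact and `X` will be Hausdorff). -/
def IsConeNbhd {X : Type*} [TopologicalSpace X] (x : X) {n : ℕ} (G : SimpleGraph (Fin n))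
    (e : Cone G → X) : Prop :=
  IsEmbedding e ∧ e (Cone.apex G) = x ∧ range e ∈ 𝓝 x

/-- A 2-complex: a compact Hausdorff space in which each point has a closed neighbourhood
homeomorphic to the cone over a finite graph. -/
structure IsTwoComplex (X : Type*) [TopologicalSpace X] : Prop where
  compactSpace : CompactSpace X
  t2Space : T2Space X
  exists_cone : ∀ x : X, ∃ (n : ℕ) (G : SimpleGraph (Fin n)) (e : Cone G → X), IsConeNbhd x G e

/-- The open book with `n` pages: `n` closed half-planes glued along their common boundary line.
A point is a pair `(v, t)`: `t` is the position along the spine, and at most one of the numbers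
`v i` is non-zero; if it is `v i`, the point lies on page `i` at distance `v i` from the spine.
It is the open cone over the graph with two vertices and `n` edges joining them. -/
def Book (n : ℕ) : Type :=
  {p : (Fin n → ℝ) × ℝ // (∀ i, 0 ≤ p.1 i) ∧ ∀ i j, i ≠ j → p.1 i = 0 ∨ p.1 j = 0}

instance (n : ℕ) : TopologicalSpace (Book n) :=
  instTopologicalSpaceSubtype

/-- The point of page `i` at distance `max r 0` from the spine and at position `t`. -/
def Book.pt {n : ℕ} (i : Fin n) (r t : ℝ) : Book n :=
  ⟨(Pi.single i (max r 0), t), by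
    constructor
    · intro k
      by_cases h : k = i
      · subst h; simp
      · simp [h]
    · intro k l hkl
      by_cases h : k = i
      · right
        have : l ≠ i := fun h' => hkl (h.trans h'.symm)
        simp [this]
      · left
        simp [h]⟩

/-- The origin of the spine. -/
def Book.origin (n : ℕ) : Book n := ⟨(fun _ => 0, 0), by simp, by simp⟩

/-- The plane formed by two pages: the upper half-plane is page `i`, the lower half-plane is
page `j`, the horizontal axis is the spine. -/
def Book.plane {n : ℕ} (i j : Fin n) (q : ℝ × ℝ) : Book n :=
  if 0 ≤ q.2 then Book.pt i q.2 q.1 else Book.pt j (-q.2) q.1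

section Complex

variable {X : Type*} [TopologicalSpace X]

/-- `φ` is a chart identifying the book with `n` pages with an open neighbourhood of `x`. -/
def IsBookChart (x : X) (n : ℕ) (φ : Book n → X) : Prop :=
  IsOpenEmbedding φ ∧ φ (Book.origin n) = x

/-- Generic points: near `x` the space is the cone over a circle, i.e. a plane. -/
def IsGenericPoint (x : X) : Prop := ∃ φ : ℝ × ℝ → X, IsOpenEmbedding φ ∧ φ (0, 0) = x

/-- Boundary points: near `x` the space is the cone over a segment, i.e. a half-plane. -/
def IsBoundaryPoint (x : X) : Prop := ∃ φ : Book 1 → X, IsBookChart x 1 φ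

/-- Ridge points: near `x` the space is the cone over the graph with two vertices joined by
`n ≥ 3` edges, i.e. `n ≥ 3` half-planes glued along their boundary line. -/
def IsRidgePoint (x : X) : Prop := ∃ n : ℕ, 3 ≤ n ∧ ∃ φ : Book n → X, IsBookChart x n φ

/-- All remaining points are singular. -/
def IsSingularPoint (x : X) : Prop :=
  ¬ IsGenericPoint x ∧ ¬ IsBoundaryPoint x ∧ ¬ IsRidgePoint x

/-! ### Generic closed curves and knots -/

/-- A chart `φ` at a crossing `γ s = γ t` in which the branch of `γ` at `s` runs along the
horizontal axis in the positive direction, and the branch at `t` runs along the vertical axis in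
the positive direction. -/
def IsCrossingChart (γ : C(UnitAddCircle, X)) (s t : UnitAddCircle) (φ : ℝ × ℝ → X) : Prop :=
  IsOpenEmbedding φ ∧ φ (0, 0) = γ s ∧ φ (0, 0) = γ t ∧
  (∀ᶠ h : ℝ in 𝓝[>] (0 : ℝ), γ (s + (h : UnitAddCircle)) ∈ φ '' {q | 0 < q.1 ∧ q.2 = 0}) ∧
  (∀ᶠ h : ℝ in 𝓝[<] (0 : ℝ), γ (s + (h : UnitAddCircle)) ∈ φ '' {q | q.1 < 0 ∧ q.2 = 0}) ∧
  (∀ᶠ h : ℝ in 𝓝[>] (0 : ℝ), γ (t + (h : UnitAddCircle)) ∈ φ '' {q | q.1 = 0 ∧ 0 < q.2}) ∧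
  (∀ᶠ h : ℝ in 𝓝[<] (0 : ℝ), γ (t + (h : UnitAddCircle)) ∈ φ '' {q | q.1 = 0 ∧ q.2 < 0})

/-- Generic closed curves: they lie in the union of the interior and the ridge; the self-crossings
are finite in number, double and transversal, and lie in the interior; at a ridge point the curve
passes transversally from one branch of `X` to a different one. -/
structure IsGenericCurve (γ : C(UnitAddCircle, X)) : Prop where
  mem : ∀ s, IsGenericPoint (γ s) ∨ IsRidgePoint (γ s)
  finite : {p : UnitAddCircle × UnitAddCircle | p.1 ≠ p.2 ∧ γ p.1 = γ p.2}.Finite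
  double : ∀ s t u, γ s = γ t → γ t = γ u → s = t ∨ t = u ∨ s = u
  transversal : ∀ s t, s ≠ t → γ s = γ t → ∃ φ, IsCrossingChart γ s t φ
  ridge : ∀ s, IsRidgePoint (γ s) → ∃ n : ℕ, 3 ≤ n ∧ ∃ φ : Book n → X, IsBookChart (γ s) n φ ∧
    ∃ i j : Fin n, i ≠ j ∧
      (∀ᶠ h : ℝ in 𝓝[<] (0 : ℝ), γ (s + (h : UnitAddCircle)) ∈ φ '' {p | 0 < p.1.1 i}) ∧
      (∀ᶠ h : ℝ in 𝓝[>] (0 : ℝ), γ (s + (h : UnitAddCircle)) ∈ φ '' {p | 0 < p.1.1 j})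

/-- The first and the third open quadrants. -/
def evenQuadrants : Set (ℝ × ℝ) := {q | 0 < q.1 * q.2}

/-- The second and the fourth open quadrants. -/
def oddQuadrants : Set (ℝ × ℝ) := {q | q.1 * q.2 < 0}

end Complex

/-- An oriented knot: a parametrised generic closed curve, dotted at its crossings.  The dots are
recorded by a set `dots`, of which only the germs at the crossings matter: near each crossing, it
is the union of the two dotted areas, which is one of the two pairs of opposite areas among the
four areas adjacent to the crossing. -/
structure Knot (X : Type*) [TopologicalSpace X] where
  curve : C(UnitAddCircle, X)
  generic : IsGenericCurve curve
  dots : Set X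
  dots_spec : ∀ s t, s ≠ t → curve s = curve t → ∃ φ, IsCrossingChart curve s t φ ∧
    (dots =ᶠ[𝓝 (curve s)] φ '' evenQuadrants ∨ dots =ᶠ[𝓝 (curve s)] φ '' oddQuadrants)

section Quadrants

theorem isOpen_evenQuadrants : IsOpen evenQuadrants :=
  isOpen_lt continuous_const (continuous_fst.mul continuous_snd)

theorem isOpen_oddQuadrants : IsOpen oddQuadrants :=
  isOpen_lt (continuous_fst.mul continuous_snd) continuous_const

theorem interior_compl_evenQuadrants : interior evenQuadrantsᶜ = oddQuadrants := by
  apply Subset.antisymm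
  · rintro ⟨x, y⟩ hq
    by_contra hne
    have hle : x * y ≤ 0 := by
      have := interior_subset hq
      simpa [evenQuadrants] using this
    have h0 : x * y = 0 := le_antisymm hle (by simpa [oddQuadrants] using hne)
    obtain ⟨a, b, ha, hb, hab⟩ : ∃ a b : ℝ, 0 ≤ x * b + a * y ∧ 0 < a * b ∧ True := by
      rcases mul_eq_zero.1 h0 with h | h
      · rcases le_total 0 y with hy | hy
        · exact ⟨1, 1, by simp [h, hy], by norm_num, trivial⟩
        · exact ⟨-1, -1, by simp [h, hy], by norm_num, trivial⟩
      · rcases le_total 0 x with hx | hx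
        · exact ⟨1, 1, by simp [h, hx], by norm_num, trivial⟩
        · exact ⟨-1, -1, by simp [h, hx], by norm_num, trivial⟩
    have hcont : Tendsto (fun r : ℝ => (x + r * a, y + r * b)) (𝓝[>] 0) (𝓝 (x, y)) := by
      have hc : Continuous (fun r : ℝ => (x + r * a, y + r * b)) := by fun_prop
      have := (hc.tendsto 0).mono_left (nhdsWithin_le_nhds (s := Ioi (0 : ℝ)))
      simpa using this
    have hev := hcont.eventually (isOpen_interior.mem_nhds hq)
    obtain ⟨r, hr, hr0⟩ := (hev.and self_mem_nhdsWithin).exists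
    have hr0' : (0 : ℝ) < r := hr0
    have hcon := interior_subset hr
    apply hcon
    show 0 < (x + r * a) * (y + r * b)
    have e : (x + r * a) * (y + r * b) = x * y + r * (x * b + a * y) + r * r * (a * b) := by ring
    rw [e, h0]
    have h1 := mul_nonneg hr0'.le ha
    have h2 := mul_pos (mul_pos hr0' hr0') hb
    linarith
  · apply interior_maximal _ isOpen_oddQuadrants
    intro q hq hq'
    exact lt_asymm (show q.1 * q.2 < 0 from hq) hq'

theorem interior_compl_oddQuadrants : interior oddQuadrantsᶜ = evenQuadrants := by
  let f : ℝ × ℝ ≃ₜ ℝ × ℝ := (Homeomorph.neg ℝ).prodCongr (Homeomorph.refl ℝ)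
  have h1 : oddQuadrants = f ⁻¹' evenQuadrants := by
    ext q; simp [f, oddQuadrants, evenQuadrants]
  have h2 : evenQuadrants = f ⁻¹' oddQuadrants := by
    ext q; simp [f, oddQuadrants, evenQuadrants]
  rw [h1, ← preimage_compl, ← f.preimage_interior, interior_compl_evenQuadrants, ← h2]

end Quadrants

section Germs

variable {X : Type*} [TopologicalSpace X]

theorem interior_compl_germ {D : Set X} {φ : ℝ × ℝ → X} (hφ : IsOpenEmbedding φ) {c : X}
    (hc : c ∈ range φ) {A B : Set (ℝ × ℝ)} (hAB : interior Aᶜ = B)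
    (hD : D =ᶠ[𝓝 c] φ '' A) : interior Dᶜ =ᶠ[𝓝 c] φ '' B := by
  have h1 : ∀ᶠ y in 𝓝 c, Dᶜ =ᶠ[𝓝 y] (φ '' A)ᶜ := by
    filter_upwards [eventually_eventuallyEq_nhds.2 hD] with y hy using hy.compl
  have h2 : ∀ᶠ y in 𝓝 c, y ∈ range φ := hφ.isOpen_range.mem_nhds hc
  rw [eventuallyEq_set]
  filter_upwards [h1, h2] with y hy1 hy2
  have hy3 : y ∈ interior Dᶜ ↔ y ∈ interior (φ '' A)ᶜ :=
    Filter.EventuallyEq.mem_interior_iff hy1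
  rw [hy3]
  obtain ⟨q, rfl⟩ := hy2
  rw [hφ.injective.mem_set_image, ← hAB, ← mem_preimage,
    hφ.isOpenMap.preimage_interior_eq_interior_preimage hφ.continuous, preimage_compl,
    preimage_image_eq _ hφ.injective]

end Germs

namespace Knot

variable {X : Type*} [TopologicalSpace X]

/-- The mirror image: at every crossing the pair of dots is replaced with the opposite pair.  (At
a crossing, the interior of the complement of two opposite areas is the union of the other two.) -/
def mirror (K : Knot X) : Knot X where
  curve := K.curve
  generic := K.generic
  dots := interior K.dotsᶜ
  dots_spec := by
    intro s t hst h
    obtain ⟨φ, hφ, hd⟩ := K.dots_spec s t hst h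
    refine ⟨φ, hφ, ?_⟩
    have hc : K.curve s ∈ range φ := ⟨(0, 0), hφ.2.1⟩
    rcases hd with hd | hd
    · exact Or.inr (interior_compl_germ hφ.1 hc interior_compl_evenQuadrants hd)
    · exact Or.inl (interior_compl_germ hφ.1 hc interior_compl_oddQuadrants hd)

/-- The loop `γ` run in the opposite direction. -/
def revLoop (γ : C(UnitAddCircle, X)) : C(UnitAddCircle, X) := γ.comp ⟨Neg.neg, continuous_neg⟩

theorem eventually_neg_gt {P : ℝ → Prop} (h : ∀ᶠ x in 𝓝[<] (0 : ℝ), P x) :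
    ∀ᶠ x in 𝓝[>] (0 : ℝ), P (-x) := by
  have ht : Tendsto (fun x : ℝ => -x) (𝓝[>] 0) (𝓝[<] 0) := by
    simpa using tendsto_neg_nhdsGT (a := (0 : ℝ))
  exact ht.eventually h

theorem eventually_neg_lt {P : ℝ → Prop} (h : ∀ᶠ x in 𝓝[>] (0 : ℝ), P x) :
    ∀ᶠ x in 𝓝[<] (0 : ℝ), P (-x) := by
  have ht : Tendsto (fun x : ℝ => -x) (𝓝[<] 0) (𝓝[>] 0) := by
    simpa using tendsto_neg_nhdsLT (a := (0 : ℝ))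
  exact ht.eventually h

theorem revLoop_add (γ : C(UnitAddCircle, X)) (s : UnitAddCircle) (x : ℝ) :
    revLoop γ (s + (x : UnitAddCircle)) = γ (-s + ((-x : ℝ) : UnitAddCircle)) := by
  show γ (-(s + (x : UnitAddCircle))) = _
  congr 1
  rw [AddCircle.coe_neg]
  abel

theorem isCrossingChart_revLoop {γ : C(UnitAddCircle, X)} {s t : UnitAddCircle}
    {φ : ℝ × ℝ → X} (h : IsCrossingChart γ (-s) (-t) φ) :
    IsCrossingChart (revLoop γ) s t (φ ∘ fun q => -q) := by
  obtain ⟨h0, hs, ht, h1, h2, h3, h4⟩ := h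
  refine ⟨h0.comp (Homeomorph.neg (ℝ × ℝ)).isOpenEmbedding, ?_, ?_, ?_, ?_, ?_, ?_⟩
  · simpa [revLoop] using hs
  · simpa [revLoop] using ht
  · filter_upwards [eventually_neg_gt h2] with x hx
    rw [revLoop_add]
    obtain ⟨q, ⟨ha, hb⟩, hq⟩ := hx
    exact ⟨-q, ⟨by simpa using ha, by simpa using hb⟩, by simpa using hq⟩
  · filter_upwards [eventually_neg_lt h1] with x hx
    rw [revLoop_add]
    obtain ⟨q, ⟨ha, hb⟩, hq⟩ := hx
    exact ⟨-q, ⟨by simpa using ha, by simpa using hb⟩, by simpa using hq⟩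
  · filter_upwards [eventually_neg_gt h4] with x hx
    rw [revLoop_add]
    obtain ⟨q, ⟨ha, hb⟩, hq⟩ := hx
    exact ⟨-q, ⟨by simpa using ha, by simpa using hb⟩, by simpa using hq⟩
  · filter_upwards [eventually_neg_lt h3] with x hx
    rw [revLoop_add]
    obtain ⟨q, ⟨ha, hb⟩, hq⟩ := hx
    exact ⟨-q, ⟨by simpa using ha, by simpa using hb⟩, by simpa using hq⟩

theorem isGenericCurve_revLoop {γ : C(UnitAddCircle, X)} (h : IsGenericCurve γ) :
    IsGenericCurve (revLoop γ) where
  mem s := h.mem (-s)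
  finite := by
    have hinj : Function.Injective
        (fun p : UnitAddCircle × UnitAddCircle => ((-p.1, -p.2) : UnitAddCircle × UnitAddCircle)) := by
      rintro ⟨a, b⟩ ⟨c, d⟩ hh
      simpa using hh
    refine (h.finite.preimage hinj.injOn).subset ?_
    rintro ⟨a, b⟩ ⟨hab, hγ⟩
    exact ⟨fun hh => hab (neg_injective hh), hγ⟩
  double s t u h1 h2 := by simpa using h.double (-s) (-t) (-u) h1 h2
  transversal s t hst hγ := by
    obtain ⟨φ, hφ⟩ := h.transversal (-s) (-t) (fun hh => hst (neg_injective hh)) hγ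
    exact ⟨_, isCrossingChart_revLoop hφ⟩
  ridge s hs := by
    obtain ⟨n, hn, φ, hφ, i, j, hij, h1, h2⟩ := h.ridge (-s) hs
    refine ⟨n, hn, φ, hφ, j, i, hij.symm, ?_, ?_⟩
    · filter_upwards [eventually_neg_lt h2] with x hx
      rw [revLoop_add]; exact hx
    · filter_upwards [eventually_neg_gt h1] with x hx
      rw [revLoop_add]; exact hx

/-- The oriented knot `-K`: the same dotted curve with the opposite orientation. -/
def reverse (K : Knot X) : Knot X where
  curve := revLoop K.curve
  generic := isGenericCurve_revLoop K.generic
  dots := K.dots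
  dots_spec := by
    intro s t hst h
    obtain ⟨φ, hφ, hd⟩ := K.dots_spec (-s) (-t) (fun hh => hst (neg_injective hh)) h
    refine ⟨_, isCrossingChart_revLoop hφ, ?_⟩
    have key : ∀ A : Set (ℝ × ℝ), (∀ q, q ∈ A → -q ∈ A) → (φ ∘ fun q => -q) '' A = φ '' A := by
      intro A hA
      rw [image_comp]
      congr 1
      ext q
      constructor
      · rintro ⟨q', hq', rfl⟩
        exact hA _ hq'
      · intro hq
        exact ⟨-q, hA _ hq, neg_neg q⟩
    rw [key evenQuadrants (by intro q hq; simpa [evenQuadrants] using hq),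
      key oddQuadrants (by intro q hq; simpa [oddQuadrants] using hq)]
    exact hd

/-- Two knots `K`, `K'` have the same dots at the crossing point `c`. -/
def SameDotsAt (K K' : Knot X) (c : X) : Prop := K.dots =ᶠ[𝓝 c] K'.dots

/-! ### Ambient isotopies and basic moves -/

/-- `K'` is the image of `K` under an ambient isotopy of `X`, up to an orientation preserving
change of parametrisation (`r` is the lift to `ℝ` of a homeomorphism of the circle). -/
def AmbientIsotopic (K K' : Knot X) : Prop :=
  ∃ H : unitInterval → X ≃ₜ X, Continuous (fun p : unitInterval × X => H p.1 p.2) ∧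
    H 0 = Homeomorph.refl X ∧
    ∃ r : ℝ ≃o ℝ, (∀ x, r (x + 1) = r x + 1) ∧
      (∀ x : ℝ, K'.curve (x : UnitAddCircle) = H 1 (K.curve (r x : UnitAddCircle))) ∧
      ∀ s t, s ≠ t → K'.curve s = K'.curve t → K'.dots =ᶠ[𝓝 (K'.curve s)] H 1 '' K.dots

/-- `K'` is obtained from `K` by replacing, in the box `β '' B`, the strands `β ∘ σ i` with the
strands `β ∘ σ' i`.  Each strand is parametrised by `[-1, 1]`; it is run, in one of the two
directions, on the arc of parameters `a i + b i * x`, `x ∈ [-1, 1]`.  The set `β '' d i j` (and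
`β '' d' i j` for `K'`), with `i ≤ j`, gives the dotted areas near the crossings of the strands `i`
and `j`.  Outside the box the two knots coincide. -/
def ReplaceStrands {M : Type*} (β : M → X) (B : Set M) {m : ℕ} (σ σ' : Fin m → ℝ → M)
    (d d' : Fin m → Fin m → Set M) (K K' : Knot X) : Prop :=
  ∃ a b : Fin m → ℝ,
    (∀ i j, ∀ x ∈ Icc (-1 : ℝ) 1, ∀ y ∈ Icc (-1 : ℝ) 1,
      ((a i + b i * x : ℝ) : UnitAddCircle) = ((a j + b j * y : ℝ) : UnitAddCircle) →
        i = j ∧ x = y) ∧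
    (∀ i, ∀ x ∈ Icc (-1 : ℝ) 1,
      K.curve ((a i + b i * x : ℝ) : UnitAddCircle) = β (σ i x) ∧
      K'.curve ((a i + b i * x : ℝ) : UnitAddCircle) = β (σ' i x)) ∧
    (∀ u : UnitAddCircle,
      (∀ i, ∀ x ∈ Icc (-1 : ℝ) 1, u ≠ ((a i + b i * x : ℝ) : UnitAddCircle)) →
        K.curve u = K'.curve u ∧ K.curve u ∉ β '' B) ∧
    (∀ s t, s ≠ t → K.curve s = K.curve t → K.curve s ∉ β '' B →
      SameDotsAt K K' (K.curve s)) ∧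
    (∀ i j, i ≤ j → ∀ x ∈ Icc (-1 : ℝ) 1, ∀ y ∈ Icc (-1 : ℝ) 1, (i, x) ≠ (j, y) →
      (σ i x = σ j y → K.dots =ᶠ[𝓝 (β (σ i x))] β '' d i j) ∧
      (σ' i x = σ' j y → K'.dots =ᶠ[𝓝 (β (σ' i x))] β '' d' i j))

/-- The box used for the moves in a disc. -/
def box : Set (ℝ × ℝ) := Icc (-1) 1 ×ˢ Icc (-2) 2

/-- The box used for pushing a crossing across the ridge. -/
def wideBox : Set (ℝ × ℝ) := Icc (-2) 2 ×ˢ Icc (-1) 1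

/-- A kink: the arc of the nodal cubic `(y + 1) (4 (y + 1) - 1)² = 9 x²` between `(-1, 0)` and
`(1, 0)`; its only crossing is `(0, -3/4)`. -/
def kink (x : ℝ) : ℝ × ℝ := ((4 * x ^ 3 - x) / 3, x ^ 2 - 1)

/-- The dotted areas at the crossing of the kink: to the left and to the right of the crossing if
`ε = 1` (positive kink), above and below it if `ε = -1` (negative kink). -/
def kinkDots (ε : ℤ) : Set (ℝ × ℝ) :=
  {q | ε * ((q.2 + 1) * (4 * (q.2 + 1) - 1) ^ 2 - 9 * q.1 ^ 2) < 0}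

/-- The moves adding a kink to an arc: the positive one for `ε = 1`, the negative one for
`ε = -1`. -/
def MoveOne (ε : ℤ) (K K' : Knot X) : Prop :=
  ∃ ψ : ℝ × ℝ → X, IsOpenEmbedding ψ ∧
    ReplaceStrands (m := 1) ψ box (fun _ x => (x, 0)) (fun _ x => kink x)
      (fun _ _ => ∅) (fun _ _ => kinkDots ε) K K'

/-- The dotted areas near a crossing of the graphs `y = f x` and `y = g x`, where the slope of the
graph of `f` exceeds the slope of the graph of `g`.  If the graph of `f` is the overpassing line,
then rotating it counterclockwise it sweeps the points above both lines and the points below both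
lines; if the graph of `g` is overpassing, it sweeps the points between the two lines. -/
def graphDots (f g : ℝ → ℝ) (fOver : Prop) : Set (ℝ × ℝ) :=
  {q | (fOver ∧ 0 < (q.2 - f q.1) * (q.2 - g q.1)) ∨
    (¬ fOver ∧ (q.2 - f q.1) * (q.2 - g q.1) < 0)}

/-- The move pulling one of two disjoint arcs over or under the other one.  After the move the
strands are `y = 0` and `y = 2 x² - 1`, the slope of the latter exceeds the slope of the former at
the right crossing and is smaller at the left crossing. -/
def MoveTwo (K K' : Knot X) : Prop :=
  ∃ ψ : ℝ × ℝ → X, IsOpenEmbedding ψ ∧ ∃ parabolaOver : Prop,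
    ReplaceStrands (m := 2) ψ box
      ![fun x => (x, 0), fun x => (x, 1)]
      ![fun x => (x, 0), fun x => (x, 2 * x ^ 2 - 1)]
      (fun _ _ => ∅)
      (fun _ _ =>
        ({q | 0 < q.1} ∩ graphDots (fun x => 2 * x ^ 2 - 1) (fun _ => 0) parabolaOver) ∪
        ({q | q.1 < 0} ∩ graphDots (fun _ => 0) (fun x => 2 * x ^ 2 - 1) (¬ parabolaOver)))
      K K'

/-- Three strands `y = x`, `y = ε (1 - x²) / 2`, `y = -x` (in order of decreasing slope); for
`ε = 1` the middle one passes above the crossing of the two others, for `ε = -1` below. -/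
def triangle (ε : ℝ) : Fin 3 → ℝ → ℝ :=
  ![fun x => x, fun x => ε * ((1 - x ^ 2) / 2), fun x => -x]

/-- The third Reidemeister move, for three strands lying at three different heights. -/
def MoveThree (K K' : Knot X) : Prop :=
  ∃ ψ : ℝ × ℝ → X, IsOpenEmbedding ψ ∧ ∃ height : Equiv.Perm (Fin 3),
    ReplaceStrands (m := 3) ψ box
      (fun i x => (x, triangle 1 i x)) (fun i x => (x, triangle (-1) i x))
      (fun i j => graphDots (triangle 1 i) (triangle 1 j) (height j < height i))
      (fun i j => graphDots (triangle (-1) i) (triangle (-1) j) (height j < height i)) K K'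

/-- The move pushing an arc lying in the branch `i` across the ridge into the branch `j`. -/
def MoveFour (K K' : Knot X) : Prop :=
  ∃ n : ℕ, 3 ≤ n ∧ ∃ φ : Book n → X, IsOpenEmbedding φ ∧ ∃ i j : Fin n, i ≠ j ∧
    ReplaceStrands (m := 1) (φ ∘ Book.plane i j) box
      (fun _ x => (x, 1)) (fun _ x => (x, 2 * x ^ 2 - 1)) (fun _ _ => ∅) (fun _ _ => ∅) K K'

/-- Two strands which cross once, on the upper side of the line `y = 0` for `ε = 1` and on its
lower side for `ε = -1`, and each of which crosses this line once. -/
def cross (ε : ℝ) : Fin 2 → ℝ → ℝ × ℝ :=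
  ![fun y => (y - ε * ((1 - y ^ 2) / 2), y), fun y => (-(y - ε * ((1 - y ^ 2) / 2)), y)]

/-- Dotted areas at the crossing of the two strands `cross ε`: to the left and to the right of the
crossing if `δ = 1`, above and below it if `δ = -1`. -/
def crossDots (ε : ℝ) (δ : ℤ) : Set (ℝ × ℝ) :=
  {q | 0 < δ * (q.1 ^ 2 - (q.2 - ε * ((1 - q.2 ^ 2) / 2)) ^ 2)}

/-- The moves pushing a crossing lying in the branch `i` across the ridge into the branch `j`;
the two values `δ = 1` and `δ = -1` are the two ways to dot the crossing. -/
def MoveFive (δ : ℤ) (K K' : Knot X) : Prop :=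
  ∃ n : ℕ, 3 ≤ n ∧ ∃ φ : Book n → X, IsOpenEmbedding φ ∧ ∃ i j : Fin n, i ≠ j ∧
    ReplaceStrands (m := 2) (φ ∘ Book.plane i j) wideBox (cross 1) (cross (-1))
      (fun _ _ => crossDots 1 δ) (fun _ _ => crossDots (-1) δ) K K'

/-- The move in three adjacent branches `i`, `j`, `k`: an arc passing from `i` directly to `j` is
replaced with an arc passing from `i` to `k` and then from `k` to `j`. -/
def MoveSix (K K' : Knot X) : Prop :=
  ∃ n : ℕ, 3 ≤ n ∧ ∃ φ : Book n → X, IsOpenEmbedding φ ∧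
    ∃ i j k : Fin n, i ≠ j ∧ i ≠ k ∧ j ≠ k ∧
    ReplaceStrands (m := 1) φ
      {p | p.1.2 ∈ Icc (-1 : ℝ) 1 ∧
        ∀ l, p.1.1 l ≤ 2 ∧ (l ≠ i → l ≠ j → l ≠ k → p.1.1 l = 0)}
      (fun _ x => if x ≤ 0 then Book.pt i (-x) x else Book.pt j x x)
      (fun _ x => if x ≤ -(1 / 2) then Book.pt i (-2 * x - 1) x else
        if x < 1 / 2 then Book.pt k (1 - 2 * |x|) x else Book.pt j (2 * x - 1) x)
      (fun _ _ => ∅) (fun _ _ => ∅) K K'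

/-- The move across a singular point `x`.  `S` is a circle embedded in the graph `G`, and `D` is
the cone over it, a disc centred at `x` with boundary circle `D'`.  The knot `K` meets `D` along an
embedded arc (with parameters in `[a, b]`) with endpoints in `D'`; this arc is replaced with
another embedded arc in `D` with the same endpoints.  That the new arc avoids `x` and is
transversal to the ridge is part of the genericity of `K'`. -/
def MoveSeven (K K' : Knot X) : Prop :=
  ∃ x : X, IsSingularPoint x ∧ ∃ (n : ℕ) (G : SimpleGraph (Fin n)) (e : Cone G → X),
    IsConeNbhd x G e ∧ ∃ S : UnitAddCircle → Cone G, IsEmbedding S ∧ (∀ θ, S θ ∈ Cone.base G) ∧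
    ∃ D D' : Set X, D = e '' {y | ∃ r ∈ Icc (0 : ℝ) 1, ∃ θ, y.1 = r • (S θ).1} ∧
      D' = range (e ∘ S) ∧
    ∃ a b : ℝ, a < b ∧ b < a + 1 ∧
      K.curve (a : UnitAddCircle) ∈ D' ∧ K.curve (b : UnitAddCircle) ∈ D' ∧
      K.curve (a : UnitAddCircle) = K'.curve (a : UnitAddCircle) ∧
      K.curve (b : UnitAddCircle) = K'.curve (b : UnitAddCircle) ∧
      (∀ u ∈ Icc a b, K.curve (u : UnitAddCircle) ∈ D ∧ K'.curve (u : UnitAddCircle) ∈ D) ∧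
      InjOn (fun u : ℝ => K.curve (u : UnitAddCircle)) (Icc a b) ∧
      InjOn (fun u : ℝ => K'.curve (u : UnitAddCircle)) (Icc a b) ∧
      (∀ u ∈ Ioo b (a + 1), K.curve (u : UnitAddCircle) = K'.curve (u : UnitAddCircle) ∧
        K.curve (u : UnitAddCircle) ∉ D) ∧
      ∀ s t, s ≠ t → K.curve s = K.curve t → SameDotsAt K K' (K.curve s)

/-- Ambient isotopies and basic moves. -/
inductive BasicMove : Knot X → Knot X → Prop
  | ambient {K K' : Knot X} : AmbientIsotopic K K' → BasicMove K K'
  | onePos {K K' : Knot X} : MoveOne 1 K K' → BasicMove K K'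
  | oneNeg {K K' : Knot X} : MoveOne (-1) K K' → BasicMove K K'
  | two {K K' : Knot X} : MoveTwo K K' → BasicMove K K'
  | three {K K' : Knot X} : MoveThree K K' → BasicMove K K'
  | four {K K' : Knot X} : MoveFour K K' → BasicMove K K'
  | fivePos {K K' : Knot X} : MoveFive 1 K K' → BasicMove K K'
  | fiveNeg {K K' : Knot X} : MoveFive (-1) K K' → BasicMove K K'
  | six {K K' : Knot X} : MoveSix K K' → BasicMove K K'
  | seven {K K' : Knot X} : MoveSeven K K' → BasicMove K K'

/-- Isotopy of oriented knots: the equivalence relation generated by ambient isotopies and basic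
moves. -/
def Isotopic (K K' : Knot X) : Prop := Relation.EqvGen BasicMove K K'

/-- Local knots: a dotted knot diagram in the plane is transported to `X` by an embedding of the
plane in the interior of `X`. -/
def IsLocal (K : Knot X) : Prop :=
  ∃ f : ℝ × ℝ → X, IsEmbedding f ∧ (∀ q, IsGenericPoint (f q)) ∧ ∃ D : Knot (ℝ × ℝ),
    (∀ s, K.curve s = f (D.curve s)) ∧
    ∀ s t, s ≠ t → K.curve s = K.curve t → K.dots =ᶠ[𝓝 (K.curve s)] f '' D.dots

end Knot

/-! ### Free homotopy classes and the colinking class -/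

/-- Free homotopy of loops. -/
def loopSetoid (X : Type*) [TopologicalSpace X] : Setoid C(UnitAddCircle, X) where
  r := ContinuousMap.Homotopic
  iseqv := ContinuousMap.Homotopic.equivalence

/-- The set of free homotopy classes of loops. -/
def FreeClass (X : Type*) [TopologicalSpace X] : Type _ := Quotient (loopSetoid X)

/-- The abelian group `ℤΠ`. -/
abbrev FreeClassGroup (X : Type*) [TopologicalSpace X] : Type _ := FreeClass X →₀ ℤ

section Colinking

variable {X : Type*} [TopologicalSpace X]

/-- The free homotopy class of a loop. -/
def FreeClass.mk (γ : C(UnitAddCircle, X)) : FreeClass X := Quotient.mk (loopSetoid X) γ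

/-- The free homotopy class of the constant loops (`X` will be path connected). -/
def FreeClass.trivial (X : Type*) [TopologicalSpace X] [Nonempty X] : FreeClass X :=
  FreeClass.mk (ContinuousMap.const _ (Classical.arbitrary X))

/-- The involution on free homotopy classes given by reversing the direction of loops; it is
induced by the inversion in the fundamental group. -/
def FreeClass.inv : FreeClass X → FreeClass X :=
  Quotient.map Knot.revLoop fun _ _ h => h.comp (ContinuousMap.Homotopic.refl _)

/-- The involution of `ℤΠ` induced by reversing the direction of loops. -/
def bar : FreeClassGroup X →ₗ[ℤ] FreeClassGroup X := Finsupp.lmapDomain ℤ ℤ FreeClass.inv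

/-- The tensor square of the involution of `ℤΠ`. -/
def barTensor : FreeClassGroup X ⊗[ℤ] FreeClassGroup X →ₗ[ℤ]
    FreeClassGroup X ⊗[ℤ] FreeClassGroup X := TensorProduct.map bar bar

/-- The basis vector of `ℤΠ` given by the class of a loop. -/
def loopVec (γ : C(UnitAddCircle, X)) : FreeClassGroup X := Finsupp.single (FreeClass.mk γ) 1

/-- The loop obtained by running `γ` from the parameter `a` to the parameter `b`. -/
def subloop (γ : C(UnitAddCircle, X)) (a b : ℝ)
    (h : γ (a : UnitAddCircle) = γ (b : UnitAddCircle)) : C(UnitAddCircle, X) where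
  toFun := AddCircle.liftIco 1 0 fun x : ℝ => γ ((a + x * (b - a) : ℝ) : UnitAddCircle)
  continuous_toFun := by
    apply AddCircle.liftIco_zero_continuous
    · simpa using h
    · apply Continuous.continuousOn
      exact γ.continuous.comp ((AddCircle.continuous_mk' 1).comp (by fun_prop))

namespace Knot

open Classical in
/-- The sign of the crossing `K s = K t`: it is `+1` if the dots lie in the area between the two
outgoing branches and in the opposite area (between the two incoming branches), and `-1` if they
lie in the two other areas. -/
def sign (K : Knot X) (s t : UnitAddCircle) : ℤ :=
  if ∃ φ, IsCrossingChart K.curve s t φ ∧ K.dots =ᶠ[𝓝 (K.curve s)] φ '' evenQuadrants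
    then 1 else -1

/-- The crossings of `K`, each given by its two preimages `p.1 < p.2` in `[0, 1)`. -/
def Crossing (K : Knot X) : Type :=
  {p : ℝ × ℝ // 0 ≤ p.1 ∧ p.1 < p.2 ∧ p.2 < 1 ∧
    K.curve (p.1 : UnitAddCircle) = K.curve (p.2 : UnitAddCircle)}

instance (K : Knot X) : Finite K.Crossing := by
  have := K.generic.finite.to_subtype
  have key : ∀ x y : ℝ, 0 ≤ x → x < 1 → 0 ≤ y → y < 1 →
      (x : UnitAddCircle) = (y : UnitAddCircle) → x = y := by
    intro x y hx hx' hy hy' h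
    exact (AddCircle.coe_eq_coe_iff_of_mem_Ico (p := 1) (a := 0) ⟨hx, by simpa using hx'⟩
      ⟨hy, by simpa using hy'⟩).1 h
  refine Finite.of_injective (fun p : K.Crossing =>
    (⟨((p.1.1 : UnitAddCircle), (p.1.2 : UnitAddCircle)), fun h => ?_, p.2.2.2.2⟩ :
      {p : UnitAddCircle × UnitAddCircle | p.1 ≠ p.2 ∧ K.curve p.1 = K.curve p.2})) ?_
  · obtain ⟨⟨a, b⟩, h0, h1, h2, h3⟩ := p
    exact h1.ne (key a b h0 (h1.trans h2) (h0.trans h1.le) h2 h)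
  · rintro ⟨⟨a, b⟩, h0, h1, h2, h3⟩ ⟨⟨a', b'⟩, h0', h1', h2', h3'⟩ h
    simp only [Subtype.mk.injEq, Prod.mk.injEq] at h
    have ha := key a a' h0 (h1.trans h2) h0' (h1'.trans h2') h.1
    have hb := key b b' (h0.trans h1.le) h2 (h0'.trans h1'.le) h2' h.2
    subst ha hb
    rfl

instance (K : Knot X) : Fintype K.Crossing := Fintype.ofFinite _

namespace Crossing

variable {K : Knot X}

/-- The sign of a crossing. -/
def sign (c : K.Crossing) : ℤ := K.sign (c.1.1 : UnitAddCircle) (c.1.2 : UnitAddCircle)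

/-- The first component of the smoothing of `K` at `c`: it leaves `c` along one branch of `K` and
follows `K` until the first return to `c`.  (Rounding the corner at `c` does not affect the free
homotopy class.) -/
def loopOne (c : K.Crossing) : C(UnitAddCircle, X) := subloop K.curve c.1.1 c.1.2 c.2.2.2.2

/-- The second component of the smoothing of `K` at `c`, following the rest of `K`. -/
def loopTwo (c : K.Crossing) : C(UnitAddCircle, X) :=
  subloop K.curve c.1.2 (c.1.1 + 1) (by rw [AddCircle.coe_add_period]; exact c.2.2.2.2.symm)

end Crossing

/-- The colinking class. -/
def co [Nonempty X] (K : Knot X) : FreeClassGroup X ⊗[ℤ] FreeClassGroup X :=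
  let one : FreeClassGroup X := Finsupp.single (FreeClass.trivial X) 1
  let k : FreeClassGroup X := loopVec K.curve
  ∑ c : K.Crossing, c.sign •
    (loopVec c.loopOne ⊗ₜ[ℤ] loopVec c.loopTwo + loopVec c.loopTwo ⊗ₜ[ℤ] loopVec c.loopOne
      - k ⊗ₜ[ℤ] one - one ⊗ₜ[ℤ] k)

end Knot

end Colinking

end TwoComplex

end

namespace TwoComplex

variable {X : Type*} [TopologicalSpace X]

/-! ### Homotopy classes of subloops -/

/-! The class `co` is built from local data (signs) and homotopy data (free classes of the knot and
of its two lobes at a crossing). Every move that replaces strands extends to a homotopy of the whole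
loop which is constant off those strands. A crossing away from the strands keeps its sign, and its
lobes are carried along by the homotopy, so its contribution is unchanged; only crossings inside the
box matter (`co_eq_of_doublePairsIn`). The intermediate loops need not be generic: it suffices to
follow one double point continuously (`smoothVec_eq_of_family`).

Inside the box there are three situations. An embedded single strand has no crossing, and a homotopy
exists because the disc or book is simply connected (`StrandReplacement.co_eq_of_single`). In the
third Reidemeister move and in pushing a crossing over the ridge, each pair of strands keeps one
crossing, which moves continuously and keeps its sign (`StrandReplacement.co_eq`). In the first two
Reidemeister moves new crossings appear with total contribution zero
(`StrandReplacement.co_eq_of_sum_eq_zero`): a kink has lobes of classes `1` and `k`, cancelled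
exactly by the correction terms; a bigon has two crossings with the same lobes and opposite signs.

Two devices make this precise. The sum over crossings depends on the base point of the circle
through the order of the two preimages, so twice `co` is written as a sum over ordered pairs of
circle points (`two_nsmul_co`); nothing is lost, the tensor square being torsion free. The sign is
defined through the existence of a chart, so it is computed from the chart-free condition
`DottedBetween` (`sign_eq_of_dottedBetween`), and for crossings of two graphs by `sign_graph`.

Mirroring exchanges even and odd quadrants. Reversal turns a crossing chart by a half-turn, keeping
the signs, and reverses the lobes. For a local knot all classes are trivial and each crossing
contributes zero. -/

theorem exists_Ico_coe (u : UnitAddCircle) : ∃ x ∈ Ico (0 : ℝ) 1, (x : UnitAddCircle) = u :=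
  AddCircle.eq_coe_Ico u

theorem coe_add_intCast (x : ℝ) (n : ℤ) : ((x + n : ℝ) : UnitAddCircle) = x := by
  rw [AddCircle.coe_add]
  have : ((n : ℝ) : UnitAddCircle) = 0 := by
    rw [AddCircle.coe_eq_zero_iff]
    exact ⟨n, by simp⟩
  rw [this, add_zero]

theorem coe_eq_coe_iff_exists {x y : ℝ} :
    (x : UnitAddCircle) = (y : UnitAddCircle) ↔ ∃ n : ℤ, y = x + n := by
  constructor
  · intro h
    have h' : ((y - x : ℝ) : UnitAddCircle) = 0 := by
      rw [AddCircle.coe_sub, h, sub_self]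
    obtain ⟨n, hn⟩ := (AddCircle.coe_eq_zero_iff (p := (1 : ℝ))).1 h'
    exact ⟨n, by simp at hn; linarith⟩
  · rintro ⟨n, rfl⟩
    exact (coe_add_intCast x n).symm

theorem coe_ne_coe_of_lt {x y : ℝ} (h : x < y) (h' : y < x + 1) :
    (x : UnitAddCircle) ≠ (y : UnitAddCircle) := by
  intro e
  obtain ⟨n, rfl⟩ := coe_eq_coe_iff_exists.1 e
  have h1 : (0 : ℝ) < n := by linarith
  have h2 : (n : ℝ) < 1 := by linarith
  norm_cast at h1 h2
  omega

/-- A jointly continuous family of closed paths gives a free homotopy of loops. -/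
theorem mk_eq_of_family {G : unitInterval × ℝ → X} (hG : Continuous G)
    (h01 : ∀ τ, G (τ, 0) = G (τ, 1)) {γ γ' : C(UnitAddCircle, X)}
    (h0 : ∀ x ∈ Ico (0 : ℝ) 1, γ (x : UnitAddCircle) = G (0, x))
    (h1 : ∀ x ∈ Ico (0 : ℝ) 1, γ' (x : UnitAddCircle) = G (1, x)) :
    FreeClass.mk γ = FreeClass.mk γ' := by
  -- Currying puts the homotopy parameter into the target, so that descending to the circle only
  -- requires `g 0 = g 1`.
  let g : C(ℝ, C(unitInterval, X)) :=
    ContinuousMap.curry ⟨fun p : ℝ × unitInterval => G (p.2, p.1), by fun_prop⟩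
  have hg : g 0 = g 1 := by
    ext τ
    exact h01 τ
  let l : C(UnitAddCircle, C(unitInterval, X)) :=
    ⟨AddCircle.liftIco 1 0 g, AddCircle.liftIco_zero_continuous hg g.continuous.continuousOn⟩
  have hl : ∀ x ∈ Ico (0 : ℝ) 1, ∀ τ, l (x : UnitAddCircle) τ = G (τ, x) := by
    intro x hx τ
    have : l (x : UnitAddCircle) = g x :=
      AddCircle.liftIco_zero_coe_apply (f := fun x => g x) hx
    rw [this]
    rfl
  have hc := ContinuousMap.continuous_uncurry_of_continuous l
  refine Quotient.sound ⟨⟨⟨fun p => l p.2 p.1, ?_⟩, ?_, ?_⟩⟩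
  · exact hc.comp (continuous_snd.prodMk continuous_fst)
  · intro u
    obtain ⟨x, hx, rfl⟩ := exists_Ico_coe u
    exact (hl x hx 0).trans (h0 x hx).symm
  · intro u
    obtain ⟨x, hx, rfl⟩ := exists_Ico_coe u
    exact (hl x hx 1).trans (h1 x hx).symm

theorem subloop_coe (γ : C(UnitAddCircle, X)) {a b : ℝ}
    (h : γ (a : UnitAddCircle) = γ (b : UnitAddCircle)) {x : ℝ} (hx : x ∈ Ico (0 : ℝ) 1) :
    subloop γ a b h (x : UnitAddCircle) = γ ((a + x * (b - a) : ℝ) : UnitAddCircle) :=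
  AddCircle.liftIco_zero_coe_apply (f := fun x : ℝ => γ ((a + x * (b - a) : ℝ) : UnitAddCircle)) hx

theorem loop_ext {γ γ' : C(UnitAddCircle, X)}
    (h : ∀ x ∈ Ico (0 : ℝ) 1, γ (x : UnitAddCircle) = γ' (x : UnitAddCircle)) : γ = γ' := by
  ext u
  obtain ⟨x, hx, rfl⟩ := exists_Ico_coe u
  exact h x hx

theorem subloop_add_intCast (γ : C(UnitAddCircle, X)) (a b : ℝ) (n : ℤ)
    (h : γ (a : UnitAddCircle) = γ (b : UnitAddCircle))
    (h' : γ ((a + n : ℝ) : UnitAddCircle) = γ ((b + n : ℝ) : UnitAddCircle)) :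
    subloop γ (a + n) (b + n) h' = subloop γ a b h := by
  apply loop_ext
  intro x hx
  rw [subloop_coe _ _ hx, subloop_coe _ _ hx, ← coe_add_intCast (a + x * (b - a)) n]
  congr 2
  ring

/-- Free homotopy class of a subloop in a continuous family of curves with moving endpoints. -/
theorem mk_subloop_eq {F : unitInterval × ℝ → X} (hF : Continuous F) {s t : unitInterval → ℝ}
    (hs : Continuous s) (ht : Continuous t) (hst : ∀ τ, F (τ, s τ) = F (τ, t τ))
    {γ γ' : C(UnitAddCircle, X)} (h0 : ∀ x : ℝ, γ (x : UnitAddCircle) = F (0, x))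
    (h1 : ∀ x : ℝ, γ' (x : UnitAddCircle) = F (1, x)) {a b a' b' : ℝ}
    (ha : s 0 = a) (hb : t 0 = b) (ha' : s 1 = a') (hb' : t 1 = b')
    (h : γ (a : UnitAddCircle) = γ (b : UnitAddCircle))
    (h' : γ' (a' : UnitAddCircle) = γ' (b' : UnitAddCircle)) :
    FreeClass.mk (subloop γ a b h) = FreeClass.mk (subloop γ' a' b' h') := by
  subst ha hb ha' hb'
  refine mk_eq_of_family (G := fun p => F (p.1, s p.1 + p.2 * (t p.1 - s p.1))) (by fun_prop)
    (fun τ => ?_) (fun x hx => ?_) (fun x hx => ?_)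
  · simpa using hst τ
  · rw [subloop_coe _ _ hx, h0]
  · rw [subloop_coe _ _ hx, h1]

/-- Moving the starting point is a rotation of the circle, undone by shrinking the angle `a` to `0`.
-/
theorem mk_subloop_full (γ : C(UnitAddCircle, X)) (a : ℝ)
    (h : γ (a : UnitAddCircle) = γ ((a + 1 : ℝ) : UnitAddCircle)) :
    FreeClass.mk (subloop γ a (a + 1) h) = FreeClass.mk γ := by
  refine mk_eq_of_family
    (G := fun p : unitInterval × ℝ => γ (((1 - (p.1 : ℝ)) * a + p.2 : ℝ) : UnitAddCircle))
    (γ.continuous.comp ((AddCircle.continuous_mk' 1).comp (by fun_prop)))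
    (fun τ => ?_) (fun x hx => ?_) (fun x hx => ?_)
  · simp
  · rw [subloop_coe _ _ hx]
    simp
  · simp

theorem mk_const_eq [PathConnectedSpace X] (x y : X) :
    FreeClass.mk (ContinuousMap.const UnitAddCircle x) = FreeClass.mk (ContinuousMap.const _ y) := by
  let p := PathConnectedSpace.somePath x y
  refine mk_eq_of_family (G := fun q => p q.1) (by fun_prop) (fun _ => rfl) ?_ ?_ <;>
  · intro _ _
    simp

theorem mk_const [PathConnectedSpace X] [Nonempty X] (x : X) :
    FreeClass.mk (ContinuousMap.const UnitAddCircle x) = FreeClass.trivial X :=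
  mk_const_eq _ _

theorem mk_eq_trivial_of_const [PathConnectedSpace X] [Nonempty X] {γ : C(UnitAddCircle, X)} {x : X}
    (h : ∀ u, γ u = x) : FreeClass.mk γ = FreeClass.trivial X := by
  rw [← mk_const x]
  congr 1
  ext u
  exact h u

/-! ### Classes of arcs between two points of the circle -/

open Classical in
/-- The class in `ℤΠ` of the part of the loop `γ` from the parameter `s` to the parameter `t`;
it is `0` if this part is not closed. -/
noncomputable def arcVec (γ : C(UnitAddCircle, X)) (s t : UnitAddCircle) : FreeClassGroup X :=
  -- The lift of `t` is taken in the period that starts at the lift of `s`, so the arc runs forward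
  -- from `s` to `t` in less than one turn.
  if h : γ ((AddCircle.equivIco 1 0 s : ℝ) : UnitAddCircle) =
      γ ((AddCircle.equivIco 1 (AddCircle.equivIco 1 0 s : ℝ) t : ℝ) : UnitAddCircle)
  then loopVec (subloop γ _ _ h) else 0

/-- Lifts with `a < b < a + 1` differ from the canonical ones by one common integer, which does not
change the subloop. -/
theorem arcVec_coe (γ : C(UnitAddCircle, X)) {a b : ℝ} (hab : a < b) (hba : b < a + 1)
    (h : γ (a : UnitAddCircle) = γ (b : UnitAddCircle)) :
    arcVec γ a b = loopVec (subloop γ a b h) := by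
  set a' : ℝ := (AddCircle.equivIco 1 0 (a : UnitAddCircle) : ℝ) with ha'
  set b' : ℝ := (AddCircle.equivIco 1 a' (b : UnitAddCircle) : ℝ) with hb'
  have ea : (a' : UnitAddCircle) = a := AddCircle.coe_equivIco
  have eb : (b' : UnitAddCircle) = b := AddCircle.coe_equivIco
  have hb1 : b' ∈ Ico a' (a' + 1) := (AddCircle.equivIco 1 a' (b : UnitAddCircle)).2
  obtain ⟨n, hn⟩ := coe_eq_coe_iff_exists.1 ea.symm
  have hbn : b' = b + n := by
    refine (AddCircle.coe_eq_coe_iff_of_mem_Ico (p := (1 : ℝ)) hb1 ⟨?_, ?_⟩).1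
      (eb.trans (coe_add_intCast b n).symm) <;> rw [hn] <;> linarith
  have h' : γ (a' : UnitAddCircle) = γ (b' : UnitAddCircle) := by rw [ea, eb, h]
  unfold arcVec
  rw [dif_pos h']
  congr 1
  have key : ∀ (c d : ℝ) (hc : c = a + n) (hd : d = b + n)
      (hcd : γ (c : UnitAddCircle) = γ (d : UnitAddCircle)),
      subloop γ c d hcd = subloop γ a b h := by
    rintro _ _ rfl rfl hcd
    exact subloop_add_intCast γ a b n h hcd
  exact key _ _ hn hbn h'

/-- Lifts of two distinct points of the circle with increasing parameters at distance less than
one. -/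
theorem exists_lift_lt {s t : UnitAddCircle} (h : s ≠ t) :
    ∃ a b : ℝ, (a : UnitAddCircle) = s ∧ (b : UnitAddCircle) = t ∧ a < b ∧ b < a + 1 := by
  obtain ⟨a, -, rfl⟩ := exists_Ico_coe s
  have hb := (AddCircle.equivIco 1 a t).2
  have e : (((AddCircle.equivIco 1 a t) : ℝ) : UnitAddCircle) = t := AddCircle.coe_equivIco
  refine ⟨a, _, rfl, e, lt_of_le_of_ne hb.1 fun h' => h ?_, hb.2⟩
  rw [← e, ← h']

/-- The gap `t - s` never is an integer, since the two circle points stay distinct. By the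
intermediate value theorem it stays between the same two integers, so one integer shift of each lift
makes it lie in `(0, 1)` at both ends, and `mk_subloop_eq` applies. -/
theorem arcVec_eq_of_family {F : unitInterval × UnitAddCircle → X} (hF : Continuous F)
    {s t : unitInterval → ℝ} (hs : Continuous s) (ht : Continuous t)
    (hne : ∀ τ, (s τ : UnitAddCircle) ≠ (t τ : UnitAddCircle))
    (hst : ∀ τ, F (τ, (s τ : UnitAddCircle)) = F (τ, (t τ : UnitAddCircle)))
    {γ γ' : C(UnitAddCircle, X)} (h0 : ∀ u, γ u = F (0, u)) (h1 : ∀ u, γ' u = F (1, u)) :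
    arcVec γ (s 0) (t 0) = arcVec γ' (s 1) (t 1) := by
  obtain ⟨a, b, ea, eb, hab, hba⟩ := exists_lift_lt (hne 0)
  obtain ⟨m, hm⟩ := coe_eq_coe_iff_exists.1 ea
  obtain ⟨n, hn⟩ := coe_eq_coe_iff_exists.1 eb
  set d : unitInterval → ℝ := fun τ => (t τ - n) - (s τ - m) with hd
  have hdc : Continuous d := by fun_prop
  have hdn : ∀ τ, ∀ k : ℤ, d τ ≠ k := by
    intro τ k hk
    apply hne τ
    rw [coe_eq_coe_iff_exists]
    refine ⟨k + n - m, ?_⟩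
    push_cast
    simp only [hd] at hk
    linarith
  have hd0 : d 0 ∈ Ioo (0 : ℝ) 1 := by
    simp only [hd]
    constructor <;> linarith
  have hd1 : d 1 ∈ Ioo (0 : ℝ) 1 := by
    have hr := isPreconnected_range hdc
    constructor
    · by_contra hcon
      obtain ⟨τ, hτ⟩ := hr.Icc_subset ⟨1, rfl⟩ ⟨0, rfl⟩ ⟨not_lt.1 hcon, hd0.1.le⟩
      exact hdn τ 0 (by simpa using hτ)
    · by_contra hcon
      obtain ⟨τ, hτ⟩ := hr.Icc_subset ⟨0, rfl⟩ ⟨1, rfl⟩ ⟨hd0.2.le, not_lt.1 hcon⟩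
      exact hdn τ 1 (by simpa using hτ)
  have es : ∀ τ, ((s τ - m : ℝ) : UnitAddCircle) = s τ := fun τ => by
    rw [← coe_add_intCast (s τ - m) m]; simp
  have et : ∀ τ, ((t τ - n : ℝ) : UnitAddCircle) = t τ := fun τ => by
    rw [← coe_add_intCast (t τ - n) n]; simp
  have hst' : ∀ τ, F (τ, ((s τ - m : ℝ) : UnitAddCircle)) =
      F (τ, ((t τ - n : ℝ) : UnitAddCircle)) := fun τ => by rw [es, et, hst]
  simp only [hd, mem_Ioo] at hd0 hd1
  rw [← es 0, ← et 0, ← es 1, ← et 1,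
    arcVec_coe γ (by linarith) (by linarith) (by rw [h0, h0]; exact hst' 0),
    arcVec_coe γ' (by linarith) (by linarith) (by rw [h1, h1]; exact hst' 1)]
  unfold loopVec
  congr 1
  refine mk_subloop_eq (F := fun p => F (p.1, (p.2 : UnitAddCircle)))
    (hF.comp (continuous_fst.prodMk ((AddCircle.continuous_mk' 1).comp continuous_snd)))
    (s := fun τ => s τ - m) (t := fun τ => t τ - n) (by fun_prop) (by fun_prop) hst'
    (fun x => h0 x) (fun x => h1 x) rfl rfl rfl rfl _ _

theorem mk_eq_of_circle_family {F : unitInterval × UnitAddCircle → X} (hF : Continuous F)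
    {γ γ' : C(UnitAddCircle, X)} (h0 : ∀ u, γ u = F (0, u)) (h1 : ∀ u, γ' u = F (1, u)) :
    FreeClass.mk γ = FreeClass.mk γ' :=
  Quotient.sound ⟨⟨⟨F, hF⟩, fun u => (h0 u).symm, fun u => (h1 u).symm⟩⟩

/-! ### Path connectedness -/

theorem Cone.smul_spec {n : ℕ} {G : SimpleGraph (Fin n)} (y : Cone G) {r : ℝ}
    (hr : r ∈ Icc (0 : ℝ) 1) : (∀ v, 0 ≤ (r • y.1) v) ∧ ∑ v, (r • y.1) v ≤ 1 ∧
      ((∀ v, (r • y.1) v = 0) ∨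
        ∃ v w, (v = w ∨ G.Adj v w) ∧ ∀ u, (r • y.1) u ≠ 0 → u = v ∨ u = w) := by
  obtain ⟨p, hp⟩ := y
  refine ⟨fun v => mul_nonneg hr.1 (hp.1 v), ?_, ?_⟩
  · show ∑ v, r * p v ≤ 1
    rw [← Finset.mul_sum]
    exact mul_le_one₀ hr.2 (Finset.sum_nonneg fun v _ => hp.1 v) hp.2.1
  · rcases hp.2.2 with h | ⟨v, w, hvw, h⟩
    · exact Or.inl fun v => by simp [h v]
    · exact Or.inr ⟨v, w, hvw, fun u hu => h u (right_ne_zero_of_mul hu)⟩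

/-- The radial segments of a cone join all points near `x` to `x`; hence path components are open
and closed. This is what makes the class of constant loops independent of the constant. -/
theorem IsTwoComplex.pathConnectedSpace [ConnectedSpace X] (hX : IsTwoComplex X) :
    PathConnectedSpace X := by
  have hcone : ∀ x : X, ∀ᶠ y in 𝓝 x, Joined x y := by
    intro x
    obtain ⟨n, G, e, he, hx, hr⟩ := hX.exists_cone x
    filter_upwards [hr] with y hy
    obtain ⟨⟨p, hp⟩, rfl⟩ := hy
    let c : unitInterval → Cone G := fun τ => ⟨_, Cone.smul_spec ⟨p, hp⟩ τ.2⟩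
    have hc : Continuous c := by
      refine Continuous.subtype_mk ?_ _
      show Continuous fun τ : unitInterval => (τ : ℝ) • p
      fun_prop
    refine ⟨⟨⟨fun τ => e (c τ), he.continuous.comp hc⟩, ?_, ?_⟩⟩
    · rw [← hx]
      show e (c 0) = _
      congr 1
      apply Subtype.ext
      funext v
      simp [c, Cone.apex]
    · show e (c 1) = _
      congr 1
      apply Subtype.ext
      funext v
      simp [c]
  have hopen : ∀ x : X, IsOpen (pathComponent x) := fun x => isOpen_iff_mem_nhds.2 fun y hy => by
    filter_upwards [hcone y] with z hz using Joined.trans hy hz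
  have hclosed : ∀ x : X, IsClosed (pathComponent x) := fun x => ⟨isOpen_iff_mem_nhds.2 fun y hy => by
    filter_upwards [hcone y] with z hz hz' using hy (Joined.trans hz' hz.symm)⟩
  refine ⟨inferInstance, fun x y => ?_⟩
  have := IsClopen.eq_univ ⟨hclosed x, hopen x⟩ ⟨x, mem_pathComponent_self x⟩
  have hy : y ∈ pathComponent x := by rw [this]; trivial
  exact hy

/-! ### Signs of crossings -/

theorem tendsto_const_mul_nhdsGT_zero {e : ℝ} (he : 0 < e) :
    Tendsto (fun x : ℝ => e * x) (𝓝[>] 0) (𝓝[>] 0) := by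
  refine tendsto_nhdsWithin_iff.2 ⟨?_, ?_⟩
  · have : Tendsto (fun x : ℝ => e * x) (𝓝 0) (𝓝 (e * 0)) := (continuous_const_mul e).tendsto 0
    rw [mul_zero] at this
    exact this.mono_left nhdsWithin_le_nhds
  · filter_upwards [self_mem_nhdsWithin] with x hx using mul_pos he hx

theorem tendsto_const_mul_nhdsLT_zero {e : ℝ} (he : e < 0) :
    Tendsto (fun x : ℝ => e * x) (𝓝[>] 0) (𝓝[<] 0) := by
  refine tendsto_nhdsWithin_iff.2 ⟨?_, ?_⟩
  · have : Tendsto (fun x : ℝ => e * x) (𝓝 0) (𝓝 (e * 0)) := (continuous_const_mul e).tendsto 0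
    rw [mul_zero] at this
    exact this.mono_left nhdsWithin_le_nhds
  · filter_upwards [self_mem_nhdsWithin] with x hx using mul_neg_of_neg_of_pos he hx

namespace IsCrossingChart

variable {γ : C(UnitAddCircle, X)} {s t : UnitAddCircle} {φ : ℝ × ℝ → X}

/-- A positive `e` selects the outgoing half-branch and a negative one the incoming half-branch,
which avoids treating the four half-branches separately. -/
theorem eventually_fst (h : IsCrossingChart γ s t φ) {e : ℝ} (he : e ≠ 0) :
    ∀ᶠ x in 𝓝[>] (0 : ℝ), γ (s + ((e * x : ℝ) : UnitAddCircle)) ∈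
      φ '' {q | 0 < e * q.1 ∧ q.2 = 0} := by
  obtain ⟨-, -, -, h1, h2, -, -⟩ := h
  rcases lt_or_gt_of_ne he with he | he
  · filter_upwards [(tendsto_const_mul_nhdsLT_zero he).eventually h2] with x hx
    obtain ⟨q, hq, e'⟩ := hx
    exact ⟨q, ⟨mul_pos_of_neg_of_neg he hq.1, hq.2⟩, e'⟩
  · filter_upwards [(tendsto_const_mul_nhdsGT_zero he).eventually h1] with x hx
    obtain ⟨q, hq, e'⟩ := hx
    exact ⟨q, ⟨mul_pos he hq.1, hq.2⟩, e'⟩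

theorem eventually_snd (h : IsCrossingChart γ s t φ) {e : ℝ} (he : e ≠ 0) :
    ∀ᶠ x in 𝓝[>] (0 : ℝ), γ (t + ((e * x : ℝ) : UnitAddCircle)) ∈
      φ '' {q | q.1 = 0 ∧ 0 < e * q.2} := by
  obtain ⟨-, -, -, -, -, h1, h2⟩ := h
  rcases lt_or_gt_of_ne he with he | he
  · filter_upwards [(tendsto_const_mul_nhdsLT_zero he).eventually h2] with x hx
    obtain ⟨q, hq, e'⟩ := hx
    exact ⟨q, ⟨hq.1, mul_pos_of_neg_of_neg he hq.2⟩, e'⟩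
  · filter_upwards [(tendsto_const_mul_nhdsGT_zero he).eventually h1] with x hx
    obtain ⟨q, hq, e'⟩ := hx
    exact ⟨q, ⟨hq.1, mul_pos he hq.2⟩, e'⟩

theorem swap (h : IsCrossingChart γ s t φ) : IsCrossingChart γ t s (φ ∘ Prod.swap) := by
  obtain ⟨h0, hs, ht, h1, h2, h3, h4⟩ := h
  refine ⟨h0.comp (Homeomorph.prodComm ℝ ℝ).isOpenEmbedding, ht, hs, ?_, ?_, ?_, ?_⟩
  · filter_upwards [h3] with x hx
    obtain ⟨q, hq, e⟩ := hx
    exact ⟨q.swap, ⟨hq.2, hq.1⟩, by simpa using e⟩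
  · filter_upwards [h4] with x hx
    obtain ⟨q, hq, e⟩ := hx
    exact ⟨q.swap, ⟨hq.2, hq.1⟩, by simpa using e⟩
  · filter_upwards [h1] with x hx
    obtain ⟨q, hq, e⟩ := hx
    exact ⟨q.swap, ⟨hq.2, hq.1⟩, by simpa using e⟩
  · filter_upwards [h2] with x hx
    obtain ⟨q, hq, e⟩ := hx
    exact ⟨q.swap, ⟨hq.2, hq.1⟩, by simpa using e⟩

theorem comp_homeomorph (h : IsCrossingChart γ s t φ) {Y : Type*} [TopologicalSpace Y]
    (H : X ≃ₜ Y) {γ' : C(UnitAddCircle, Y)} (hγ : ∀ u, γ' u = H (γ u)) :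
    IsCrossingChart γ' s t (H ∘ φ) := by
  obtain ⟨h0, hs, ht, h1, h2, h3, h4⟩ := h
  refine ⟨H.isOpenEmbedding.comp h0, by simp [hγ, hs], by simp [hγ, ht], ?_, ?_, ?_, ?_⟩
  · filter_upwards [h1] with x hx
    rw [hγ, image_comp]; exact mem_image_of_mem H hx
  · filter_upwards [h2] with x hx
    rw [hγ, image_comp]; exact mem_image_of_mem H hx
  · filter_upwards [h3] with x hx
    rw [hγ, image_comp]; exact mem_image_of_mem H hx
  · filter_upwards [h4] with x hx
    rw [hγ, image_comp]; exact mem_image_of_mem H hx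

theorem congr (h : IsCrossingChart γ s t φ) {γ' : C(UnitAddCircle, X)}
    (hs : ∀ᶠ u in 𝓝 s, γ u = γ' u) (ht : ∀ᶠ u in 𝓝 t, γ u = γ' u) :
    IsCrossingChart γ' s t φ := by
  have key : ∀ r : UnitAddCircle,
      Tendsto (fun x : ℝ => r + (x : UnitAddCircle)) (𝓝 0) (𝓝 r) := by
    intro r
    have hc : Continuous (fun x : ℝ => r + (x : UnitAddCircle)) :=
      continuous_const.add (AddCircle.continuous_mk' 1)
    simpa using hc.tendsto 0
  obtain ⟨h0, hs0, ht0, h1, h2, h3, h4⟩ := h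
  refine ⟨h0, hs0.trans hs.self_of_nhds, ht0.trans ht.self_of_nhds, ?_, ?_, ?_, ?_⟩
  · filter_upwards [h1, nhdsWithin_le_nhds ((key s).eventually hs)] with x hx e
    rwa [← e]
  · filter_upwards [h2, nhdsWithin_le_nhds ((key s).eventually hs)] with x hx e
    rwa [← e]
  · filter_upwards [h3, nhdsWithin_le_nhds ((key t).eventually ht)] with x hx e
    rwa [← e]
  · filter_upwards [h4, nhdsWithin_le_nhds ((key t).eventually ht)] with x hx e
    rwa [← e]

/-- Precomposition with an orientation preserving change of parametrisation of the circle. -/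
theorem reparam {a b : ℝ} (h : IsCrossingChart γ (a : UnitAddCircle) (b : UnitAddCircle) φ)
    (r : ℝ ≃o ℝ) {γ' : C(UnitAddCircle, X)}
    (hγ : ∀ x : ℝ, γ' (x : UnitAddCircle) = γ (r x : UnitAddCircle)) {a' b' : ℝ}
    (ha : r a' = a) (hb : r b' = b) :
    IsCrossingChart γ' (a' : UnitAddCircle) (b' : UnitAddCircle) φ := by
  subst ha hb
  have hγ' : ∀ c x : ℝ, γ' ((c : UnitAddCircle) + (x : UnitAddCircle)) =
      γ ((r c : UnitAddCircle) + ((r (c + x) - r c : ℝ) : UnitAddCircle)) := by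
    intro c x
    rw [← AddCircle.coe_add, ← AddCircle.coe_add, hγ]
    congr 2
    ring
  have h0 : ∀ c : ℝ, Tendsto (fun x => r (c + x) - r c) (𝓝 0) (𝓝 0) := by
    intro c
    have hc : Continuous (fun x => r (c + x) - r c) := by
      have := r.continuous
      fun_prop
    simpa using hc.tendsto 0
  have hgt : ∀ c : ℝ, Tendsto (fun x => r (c + x) - r c) (𝓝[>] 0) (𝓝[>] 0) := by
    intro c
    refine tendsto_nhdsWithin_iff.2 ⟨(h0 c).mono_left nhdsWithin_le_nhds, ?_⟩
    filter_upwards [self_mem_nhdsWithin] with x hx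
    exact sub_pos.2 (r.strictMono (lt_add_of_pos_right c hx))
  have hlt : ∀ c : ℝ, Tendsto (fun x => r (c + x) - r c) (𝓝[<] 0) (𝓝[<] 0) := by
    intro c
    refine tendsto_nhdsWithin_iff.2 ⟨(h0 c).mono_left nhdsWithin_le_nhds, ?_⟩
    filter_upwards [self_mem_nhdsWithin] with x hx
    exact sub_neg.2 (r.strictMono (add_lt_of_neg_right c hx))
  obtain ⟨hφ, hs0, ht0, h1, h2, h3, h4⟩ := h
  refine ⟨hφ, by rw [hγ]; exact hs0, by rw [hγ]; exact ht0, ?_, ?_, ?_, ?_⟩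
  · filter_upwards [(hgt a').eventually h1] with x hx
    rwa [hγ']
  · filter_upwards [(hlt a').eventually h2] with x hx
    rwa [hγ']
  · filter_upwards [(hgt b').eventually h3] with x hx
    rwa [hγ']
  · filter_upwards [(hlt b').eventually h4] with x hx
    rwa [hγ']

end IsCrossingChart

/-- On the connected set `W` the first coordinate has no zero, hence constant sign, and then `δ`
fixes the sign of the second. So `W` lies in a single quadrant, and its closure can only touch the
half-axes bounding that quadrant. -/
theorem zero_lt_mul_of_isPreconnected {W : Set (ℝ × ℝ)} (hW : IsPreconnected W) {δ : ℝ}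
    (hδ : ∀ q ∈ W, 0 < δ * (q.1 * q.2)) {e₁ e₂ : ℝ} {q q' : ℝ × ℝ} (hq : q ∈ closure W)
    (hq' : q' ∈ closure W) (h1 : 0 < e₁ * q.1) (h2 : 0 < e₂ * q'.2) : 0 < δ * (e₁ * e₂) := by
  have hcl : ∀ {f : ℝ × ℝ → ℝ}, Continuous f → (∀ p ∈ W, 0 ≤ f p) → ∀ p ∈ closure W, 0 ≤ f p :=
    fun hf h p hp => closure_minimal h (isClosed_le continuous_const hf) hp
  have hne : ∀ p ∈ W, p.1 ≠ 0 := by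
    intro p hp h
    have := hδ p hp
    simp [h] at this
  have hord := (hW.image Prod.fst continuous_fst.continuousOn).ordConnected
  have hcase : (∀ p ∈ W, 0 < p.1) ∨ (∀ p ∈ W, p.1 < 0) := by
    by_contra! hcon
    obtain ⟨⟨p, hp, hp1⟩, p', hp', hp1'⟩ := hcon
    obtain ⟨w, hw, hw0⟩ := hord.out (mem_image_of_mem _ hp) (mem_image_of_mem _ hp') ⟨hp1, hp1'⟩
    exact hne w hw hw0
  rcases hcase with hpos | hneg
  · have a1 := hcl continuous_fst (fun p hp => (hpos p hp).le) q hq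
    have a2 := hcl (f := fun p => δ * p.2) (by fun_prop) (fun p hp => by
      have h3 := hδ p hp
      have h4 := hpos p hp
      have h5 : 0 < p.1 * (δ * p.2) := by linarith
      exact ((pos_iff_pos_of_mul_pos h5).1 h4).le) q' hq'
    have b1 : 0 < e₁ := pos_of_mul_pos_left h1 a1
    have b2 : 0 < δ * e₂ := by
      have : 0 < (δ * e₂) * (q'.2 * q'.2) := by
        have hq0 : q'.2 ≠ 0 := right_ne_zero_of_mul h2.ne'
        have hδ0 : δ ≠ 0 := by
          rcases (closure_nonempty_iff.1 ⟨q, hq⟩) with ⟨p, hp⟩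
          exact left_ne_zero_of_mul (hδ p hp).ne'
        have : 0 < δ * q'.2 := lt_of_le_of_ne a2 (mul_ne_zero hδ0 hq0).symm
        nlinarith [mul_pos this h2]
      exact pos_of_mul_pos_left this (mul_self_nonneg _)
    nlinarith [mul_pos b1 b2]
  · have a1 := hcl (f := fun p => -p.1) (by fun_prop) (fun p hp => by linarith [hneg p hp]) q hq
    have a2 := hcl (f := fun p => -(δ * p.2)) (by fun_prop) (fun p hp => by
      have h3 := hδ p hp
      have h4 := hneg p hp
      have h5 : 0 < (-p.1) * (-(δ * p.2)) := by linarith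
      exact ((pos_iff_pos_of_mul_pos h5).1 (by linarith)).le) q' hq'
    have b1 : 0 < -e₁ := pos_of_mul_pos_left (by linarith : 0 < -e₁ * -q.1) a1
    have b2 : 0 < -(δ * e₂) := by
      have : 0 < -(δ * e₂) * (q'.2 * q'.2) := by
        have hq0 : q'.2 ≠ 0 := right_ne_zero_of_mul h2.ne'
        have hδ0 : δ ≠ 0 := by
          rcases (closure_nonempty_iff.1 ⟨q, hq⟩) with ⟨p, hp⟩
          exact left_ne_zero_of_mul (hδ p hp).ne'
        have : 0 < -(δ * q'.2) := lt_of_le_of_ne a2 (neg_ne_zero.2 (mul_ne_zero hδ0 hq0)).symm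
        nlinarith [mul_pos this h2]
      exact pos_of_mul_pos_left this (mul_self_nonneg _)
    nlinarith [mul_pos b1 b2]

/-! ### Determining the sign from a connected dotted area -/

namespace Knot

/-- Arbitrarily small connected dotted areas at the crossing `K s = K t` are adjacent to the two
half-branches of `K` at `s` and `t` given by the signs of `e₁` and `e₂`. -/
def DottedBetween (K : Knot X) (s t : UnitAddCircle) (e₁ e₂ : ℝ) : Prop :=
  ∀ N ∈ 𝓝 (K.curve s), ∃ U ⊆ N ∩ K.dots, IsPreconnected U ∧
    (∀ᶠ x in 𝓝[>] (0 : ℝ), K.curve (s + ((e₁ * x : ℝ) : UnitAddCircle)) ∈ closure U) ∧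
    (∀ᶠ x in 𝓝[>] (0 : ℝ), K.curve (t + ((e₂ * x : ℝ) : UnitAddCircle)) ∈ closure U)

theorem DottedBetween.zero_lt_mul {K : Knot X} {s t : UnitAddCircle} {e₁ e₂ : ℝ}
    (h : K.DottedBetween s t e₁ e₂) (h1 : e₁ ≠ 0) (h2 : e₂ ≠ 0) {φ : ℝ × ℝ → X}
    (hφ : IsCrossingChart K.curve s t φ) {δ : ℝ}
    (hd : K.dots =ᶠ[𝓝 (K.curve s)] φ '' {q | 0 < δ * (q.1 * q.2)}) : 0 < δ * (e₁ * e₂) := by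
  -- The neighbourhood chosen is the set of points where `dots` agrees with its model in the chart;
  -- thus `U` lies in the dotted quadrants.
  obtain ⟨U, hU, hUc, hU1, hU2⟩ := h _ (eventuallyEq_set.1 hd)
  have hUφ : U ⊆ φ '' {q | 0 < δ * (q.1 * q.2)} := fun y hy => (hU hy).1.1 (hU hy).2
  have hUW : φ '' (φ ⁻¹' U) = U :=
    image_preimage_eq_of_subset (hUφ.trans (image_subset_range _ _))
  have hW : IsPreconnected (φ ⁻¹' U) := by
    rwa [← hφ.1.isInducing.isPreconnected_image, hUW]
  have hcl : ∀ q, φ q ∈ closure U → q ∈ closure (φ ⁻¹' U) := by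
    intro q hq
    rw [hφ.1.isInducing.closure_eq_preimage_closure_image, hUW]
    exact hq
  obtain ⟨x, ⟨q, hq, e⟩, hx⟩ := ((hφ.eventually_fst h1).and hU1).exists
  obtain ⟨x', ⟨q', hq', e'⟩, hx'⟩ := ((hφ.eventually_snd h2).and hU2).exists
  refine zero_lt_mul_of_isPreconnected hW (fun p hp => ?_) (hcl q (e ▸ hx)) (hcl q' (e' ▸ hx'))
    hq.1 hq'.2
  obtain ⟨p', hp', e''⟩ := hUφ hp
  rwa [← hφ.1.injective e'']

theorem evenQuadrants_eq : evenQuadrants = {q : ℝ × ℝ | 0 < (1 : ℝ) * (q.1 * q.2)} := by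
  simp [evenQuadrants]

theorem oddQuadrants_eq : oddQuadrants = {q : ℝ × ℝ | 0 < (-1 : ℝ) * (q.1 * q.2)} := by
  simp [oddQuadrants]

/-- The value `-1` of `sign` means that no chart shows even quadrants, so one odd chart is not
enough. `DottedBetween` does not mention charts and therefore excludes an even chart next to an odd
one. -/
theorem sign_eq_of_dottedBetween {K : Knot X} {s t : UnitAddCircle} (hst : s ≠ t)
    (hK : K.curve s = K.curve t) {e₁ e₂ : ℝ} (h1 : e₁ ≠ 0) (h2 : e₂ ≠ 0)
    (h : K.DottedBetween s t e₁ e₂) : K.sign s t = if 0 < e₁ * e₂ then 1 else -1 := by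
  obtain ⟨φ, hφ, hd | hd⟩ := K.dots_spec s t hst hK
  · have := h.zero_lt_mul h1 h2 hφ (δ := 1) (by rwa [← evenQuadrants_eq])
    rw [one_mul] at this
    rw [if_pos this]
    exact if_pos ⟨φ, hφ, hd⟩
  · have := h.zero_lt_mul h1 h2 hφ (δ := -1) (by rwa [← oddQuadrants_eq])
    rw [if_neg (by linarith)]
    refine if_neg ?_
    rintro ⟨φ', hφ', hd'⟩
    have := h.zero_lt_mul h1 h2 hφ' (δ := 1) (by rwa [← evenQuadrants_eq])
    linarith

theorem sign_eq_one {K : Knot X} {s t : UnitAddCircle} {φ : ℝ × ℝ → X}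
    (hφ : IsCrossingChart K.curve s t φ)
    (hd : K.dots =ᶠ[𝓝 (K.curve s)] φ '' evenQuadrants) : K.sign s t = 1 :=
  if_pos ⟨φ, hφ, hd⟩

theorem dottedBetween_of_odd {K : Knot X} {s t : UnitAddCircle} {φ : ℝ × ℝ → X}
    (hφ : IsCrossingChart K.curve s t φ)
    (hd : K.dots =ᶠ[𝓝 (K.curve s)] φ '' oddQuadrants) : K.DottedBetween s t 1 (-1) := by
  intro N hN
  have hN' : φ ⁻¹' (N ∩ {y | y ∈ K.dots ↔ y ∈ φ '' oddQuadrants}) ∈ 𝓝 ((0, 0) : ℝ × ℝ) := by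
    apply hφ.1.continuous.continuousAt.preimage_mem_nhds
    rw [hφ.2.1]
    exact inter_mem hN (eventuallyEq_set.1 hd)
  obtain ⟨ε, hε, hb⟩ := Metric.mem_nhds_iff.1 hN'
  -- A corner of the fourth quadrant: its closure contains the beginnings of the outgoing horizontal
  -- and of the incoming vertical half-branch, whence the signs `1` and `-1`.
  set Q : Set (ℝ × ℝ) := Ioo 0 ε ×ˢ Ioo (-ε) 0 with hQ
  have hQc : closure Q = Icc 0 ε ×ˢ Icc (-ε) 0 := by
    rw [hQ, closure_prod_eq, closure_Ioo hε.ne, closure_Ioo (by linarith)]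
  have hlim : ∀ (u : UnitAddCircle) (e : ℝ), φ (0, 0) = K.curve u →
      ∀ᶠ x in 𝓝[>] (0 : ℝ), K.curve (u + ((e * x : ℝ) : UnitAddCircle)) ∈
        φ '' Metric.ball (0, 0) ε := by
    intro u e hu
    have hc : Continuous (fun x : ℝ => K.curve (u + ((e * x : ℝ) : UnitAddCircle))) :=
      K.curve.continuous.comp (continuous_const.add
        ((AddCircle.continuous_mk' 1).comp (by fun_prop)))
    have := hc.tendsto 0
    simp only [mul_zero, AddCircle.coe_zero, add_zero] at this
    rw [← hu] at this
    exact nhdsWithin_le_nhds (this.eventually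
      (hφ.1.isOpenMap.image_mem_nhds (Metric.ball_mem_nhds _ hε)))
  refine ⟨φ '' Q, ?_, ?_, ?_, ?_⟩
  · rintro _ ⟨q, ⟨hq1, hq2⟩, rfl⟩
    have hqb : q ∈ Metric.ball ((0, 0) : ℝ × ℝ) ε := by
      rw [Metric.mem_ball, Prod.dist_eq, max_lt_iff, Real.dist_0_eq_abs, Real.dist_0_eq_abs,
        abs_lt, abs_lt]
      exact ⟨⟨by linarith [hq1.1], hq1.2⟩, hq2.1, by linarith [hq2.2]⟩
    have := hb hqb
    exact ⟨this.1, this.2.2 ⟨q, mul_neg_of_pos_of_neg hq1.1 hq2.2, rfl⟩⟩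
  · exact ((isPreconnected_Ioo).prod isPreconnected_Ioo).image _ hφ.1.continuous.continuousOn
  · filter_upwards [hφ.eventually_fst one_ne_zero, hlim s 1 hφ.2.1] with x ⟨q, hq, e⟩ ⟨p, hp, e'⟩
    rw [← e'] at e ⊢
    obtain rfl := hφ.1.injective e
    apply image_closure_subset_closure_image hφ.1.continuous
    refine mem_image_of_mem _ ?_
    rw [hQc]
    rw [Metric.mem_ball, Prod.dist_eq, max_lt_iff, Real.dist_0_eq_abs, Real.dist_0_eq_abs,
      abs_lt, abs_lt] at hp
    exact ⟨⟨by linarith [hq.1], hp.1.2.le⟩, hp.2.1.le, hq.2.le⟩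
  · filter_upwards [hφ.eventually_snd (e := -1) (by norm_num), hlim t (-1) hφ.2.2.1]
      with x ⟨q, hq, e⟩ ⟨p, hp, e'⟩
    rw [← e'] at e ⊢
    obtain rfl := hφ.1.injective e
    apply image_closure_subset_closure_image hφ.1.continuous
    refine mem_image_of_mem _ ?_
    rw [hQc]
    rw [Metric.mem_ball, Prod.dist_eq, max_lt_iff, Real.dist_0_eq_abs, Real.dist_0_eq_abs,
      abs_lt, abs_lt] at hp
    exact ⟨⟨hq.1.ge, hp.1.2.le⟩, hp.2.1.le, by linarith [hq.2]⟩

theorem sign_eq_neg_one {K : Knot X} {s t : UnitAddCircle} (hst : s ≠ t)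
    (hK : K.curve s = K.curve t) {φ : ℝ × ℝ → X} (hφ : IsCrossingChart K.curve s t φ)
    (hd : K.dots =ᶠ[𝓝 (K.curve s)] φ '' oddQuadrants) : K.sign s t = -1 := by
  rw [sign_eq_of_dottedBetween hst hK one_ne_zero (by norm_num) (dottedBetween_of_odd hφ hd)]
  norm_num

theorem sign_mirror {K : Knot X} {s t : UnitAddCircle} (hst : s ≠ t)
    (hK : K.curve s = K.curve t) : K.mirror.sign s t = -K.sign s t := by
  obtain ⟨φ, hφ, hd⟩ := K.dots_spec s t hst hK
  have hc : K.curve s ∈ range φ := ⟨(0, 0), hφ.2.1⟩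
  rcases hd with hd | hd
  · rw [sign_eq_one hφ hd, sign_eq_neg_one (K := K.mirror) hst hK hφ
      (interior_compl_germ hφ.1 hc interior_compl_evenQuadrants hd)]
  · rw [sign_eq_neg_one hst hK hφ hd, sign_eq_one (K := K.mirror) hφ
      (interior_compl_germ hφ.1 hc interior_compl_oddQuadrants hd)]
    norm_num

/-- A transformation of crossing charts which preserves the dotted areas preserves the signs. -/
theorem sign_eq_of_chart {Y : Type*} [TopologicalSpace Y] {K : Knot X} {K' : Knot Y}
    {s t s' t' : UnitAddCircle} (hst : s ≠ t) (hK : K.curve s = K.curve t) (hst' : s' ≠ t')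
    (hK' : K'.curve s' = K'.curve t')
    (h : ∀ φ, IsCrossingChart K.curve s t φ → ∃ φ', IsCrossingChart K'.curve s' t' φ' ∧
      (K.dots =ᶠ[𝓝 (K.curve s)] φ '' evenQuadrants →
        K'.dots =ᶠ[𝓝 (K'.curve s')] φ' '' evenQuadrants) ∧
      (K.dots =ᶠ[𝓝 (K.curve s)] φ '' oddQuadrants →
        K'.dots =ᶠ[𝓝 (K'.curve s')] φ' '' oddQuadrants)) :
    K.sign s t = K'.sign s' t' := by
  obtain ⟨φ, hφ, hd⟩ := K.dots_spec s t hst hK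
  obtain ⟨φ', hφ', he, ho⟩ := h φ hφ
  rcases hd with hd | hd
  · rw [sign_eq_one hφ hd, sign_eq_one hφ' (he hd)]
  · rw [sign_eq_neg_one hst hK hφ hd, sign_eq_neg_one hst' hK' hφ' (ho hd)]

theorem sign_swap {K : Knot X} {s t : UnitAddCircle} (hst : s ≠ t)
    (hK : K.curve s = K.curve t) : K.sign s t = K.sign t s := by
  refine sign_eq_of_chart hst hK hst.symm hK.symm fun φ hφ => ⟨_, hφ.swap, ?_, ?_⟩ <;>
  · intro hd
    rw [image_comp, ← hK]
    refine (hd.trans (Eq.eventuallyEq (congrArg _ ?_)))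
    ext q
    rw [image_swap_eq_preimage_swap]
    simp [evenQuadrants, oddQuadrants, mul_comm]

/-- Reversing both branches is a half-turn of the chart, under which each pair of opposite quadrants
is invariant. -/
theorem sign_reverse {K : Knot X} {s t : UnitAddCircle} (hst : s ≠ t)
    (hK : K.curve s = K.curve t) : K.sign s t = K.reverse.sign (-s) (-t) := by
  have h1 : K.reverse.curve (-s) = K.curve s := by simp [reverse, revLoop]
  have h2 : K.reverse.curve (-t) = K.curve t := by simp [reverse, revLoop]
  refine sign_eq_of_chart hst hK (fun h => hst (neg_injective h)) (by rw [h1, h2, hK])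
    fun φ hφ => ⟨_, isCrossingChart_revLoop (s := -s) (t := -t) (by simpa using hφ), ?_, ?_⟩ <;>
  · intro hd
    rw [image_comp, h1]
    refine (hd.trans (Eq.eventuallyEq (congrArg _ ?_)))
    ext q
    simp [evenQuadrants, oddQuadrants]

end Knot

/-! ### The colinking class as a sum over ordered pairs of parameters -/

/-- The tensor product of two free abelian groups is free, hence torsion free; this permits working
with twice the colinking class. -/
theorem finsuppTensor_eq_of_two_nsmul {A B : Type*} {x y : (A →₀ ℤ) ⊗[ℤ] (B →₀ ℤ)}
    (h : 2 • x = 2 • y) : x = y := by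
  apply (finsuppTensorFinsupp' ℤ A B).injective
  have := congrArg (finsuppTensorFinsupp' ℤ A B) h
  rw [map_nsmul, map_nsmul] at this
  ext p
  have hp := DFunLike.congr_fun this p
  simp only [Finsupp.smul_apply, nsmul_eq_mul] at hp
  exact mul_left_cancel₀ (by norm_num) hp

namespace Knot

/-- The ordered pairs of different parameters of a knot with the same image. -/
def doublePairs (K : Knot X) : Set (UnitAddCircle × UnitAddCircle) :=
  {p | p.1 ≠ p.2 ∧ K.curve p.1 = K.curve p.2}

theorem finite_doublePairs (K : Knot X) : K.doublePairs.Finite := K.generic.finite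

/-- The contribution of a crossing to the colinking class, without the sign. -/
noncomputable def smoothVec [Nonempty X] (γ : C(UnitAddCircle, X)) (s t : UnitAddCircle) :
    FreeClassGroup X ⊗[ℤ] FreeClassGroup X :=
  arcVec γ s t ⊗ₜ[ℤ] arcVec γ t s + arcVec γ t s ⊗ₜ[ℤ] arcVec γ s t
    - loopVec γ ⊗ₜ[ℤ] (Finsupp.single (FreeClass.trivial X) 1)
    - (Finsupp.single (FreeClass.trivial X) 1) ⊗ₜ[ℤ] loopVec γ

/-- The contribution of a crossing to the colinking class. -/
noncomputable def crossTerm [Nonempty X] (K : Knot X) (p : UnitAddCircle × UnitAddCircle) :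
    FreeClassGroup X ⊗[ℤ] FreeClassGroup X :=
  K.sign p.1 p.2 • smoothVec K.curve p.1 p.2

theorem smoothVec_swap [Nonempty X] (γ : C(UnitAddCircle, X)) (s t : UnitAddCircle) :
    smoothVec γ s t = smoothVec γ t s := by
  unfold smoothVec
  rw [add_comm (arcVec γ s t ⊗ₜ[ℤ] arcVec γ t s)]

theorem crossTerm_swap [Nonempty X] {K : Knot X} {p : UnitAddCircle × UnitAddCircle}
    (hp : p ∈ K.doublePairs) : K.crossTerm p.swap = K.crossTerm p := by
  unfold crossTerm
  rw [Prod.fst_swap, Prod.snd_swap, sign_swap hp.1 hp.2, smoothVec_swap]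

theorem Crossing.coe_ne {K : Knot X} (c : K.Crossing) :
    (c.1.1 : UnitAddCircle) ≠ (c.1.2 : UnitAddCircle) :=
  coe_ne_coe_of_lt c.2.2.1 (by linarith [c.2.1, c.2.2.2.1])

theorem Crossing.mem_Ico_fst {K : Knot X} (c : K.Crossing) : c.1.1 ∈ Ico (0 : ℝ) (0 + 1) :=
  ⟨c.2.1, by linarith [c.2.2.1, c.2.2.2.1]⟩

theorem Crossing.mem_Ico_snd {K : Knot X} (c : K.Crossing) : c.1.2 ∈ Ico (0 : ℝ) (0 + 1) :=
  ⟨by linarith [c.2.1, c.2.2.1], by linarith [c.2.2.2.1]⟩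

theorem Crossing.smoothVec_eq [Nonempty X] {K : Knot X} (c : K.Crossing) :
    loopVec c.loopOne ⊗ₜ[ℤ] loopVec c.loopTwo + loopVec c.loopTwo ⊗ₜ[ℤ] loopVec c.loopOne
      - loopVec K.curve ⊗ₜ[ℤ] (Finsupp.single (FreeClass.trivial X) 1)
      - (Finsupp.single (FreeClass.trivial X) 1) ⊗ₜ[ℤ] loopVec K.curve =
    smoothVec K.curve (c.1.1 : UnitAddCircle) (c.1.2 : UnitAddCircle) := by
  have h1 : arcVec K.curve (c.1.1 : UnitAddCircle) (c.1.2 : UnitAddCircle) = loopVec c.loopOne :=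
    arcVec_coe _ c.2.2.1 (by linarith [c.2.1, c.2.2.2.1]) _
  have h2 : arcVec K.curve (c.1.2 : UnitAddCircle) (c.1.1 : UnitAddCircle) =
      loopVec c.loopTwo := by
    rw [← AddCircle.coe_add_period (1 : ℝ) c.1.1]
    exact arcVec_coe _ (by linarith [c.2.1, c.2.2.2.1]) (by linarith [c.2.2.1]) _
  unfold smoothVec
  rw [h1, h2]

theorem co_eq_sum [Nonempty X] (K : Knot X) :
    K.co = ∑ c : K.Crossing, K.crossTerm ((c.1.1 : UnitAddCircle), (c.1.2 : UnitAddCircle)) := by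
  unfold co
  exact Finset.sum_congr rfl fun c _ => by rw [c.smoothVec_eq]; rfl

/-- Each crossing corresponds to two ordered pairs with equal contributions. The right-hand side no
longer refers to the representatives in `[0, 1)`, so reparametrisations and orientation reversal act
on it by bijections. -/
theorem two_nsmul_co [Nonempty X] (K : Knot X) :
    2 • K.co = ∑ᶠ p ∈ K.doublePairs, K.crossTerm p := by
  let i : K.Crossing → UnitAddCircle × UnitAddCircle := fun c => (c.1.1, c.1.2)
  have hi : Function.Injective i := by
    intro c c' h
    have h1 := (AddCircle.coe_eq_coe_iff_of_mem_Ico (p := (1 : ℝ)) c.mem_Ico_fst c'.mem_Ico_fst).1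
      (Prod.ext_iff.1 h).1
    have h2 := (AddCircle.coe_eq_coe_iff_of_mem_Ico (p := (1 : ℝ)) c.mem_Ico_snd c'.mem_Ico_snd).1
      (Prod.ext_iff.1 h).2
    exact Subtype.ext (Prod.ext h1 h2)
  have hi' : Function.Injective (Prod.swap ∘ i) := Prod.swap_injective.comp hi
  have hmem : ∀ c, i c ∈ K.doublePairs := fun c => ⟨c.coe_ne, c.2.2.2.2⟩
  have hunion : K.doublePairs = range i ∪ range (Prod.swap ∘ i) := by
    apply Subset.antisymm
    · rintro ⟨s, t⟩ ⟨hst, hK⟩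
      obtain ⟨a, ha, rfl⟩ := exists_Ico_coe s
      obtain ⟨b, hb, rfl⟩ := exists_Ico_coe t
      rcases lt_trichotomy a b with h | rfl | h
      · exact Or.inl ⟨⟨(a, b), ha.1, h, hb.2, hK⟩, rfl⟩
      · exact absurd rfl hst
      · exact Or.inr ⟨⟨(b, a), hb.1, h, ha.2, hK.symm⟩, rfl⟩
    · rintro _ (⟨c, rfl⟩ | ⟨c, rfl⟩)
      · exact hmem c
      · exact ⟨(hmem c).1.symm, (hmem c).2.symm⟩
  have hdisj : Disjoint (range i) (range (Prod.swap ∘ i)) := by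
    rw [disjoint_left]
    rintro _ ⟨c, rfl⟩ ⟨c', h⟩
    have h1 := (AddCircle.coe_eq_coe_iff_of_mem_Ico (p := (1 : ℝ)) c'.mem_Ico_snd c.mem_Ico_fst).1
      (Prod.ext_iff.1 h).1
    have h2 := (AddCircle.coe_eq_coe_iff_of_mem_Ico (p := (1 : ℝ)) c'.mem_Ico_fst c.mem_Ico_snd).1
      (Prod.ext_iff.1 h).2
    linarith [c.2.2.1, c'.2.2.1]
  rw [hunion, finsum_mem_union hdisj (finite_range i) (finite_range _), finsum_mem_range hi,
    finsum_mem_range hi', finsum_eq_sum_of_fintype, finsum_eq_sum_of_fintype, co_eq_sum, two_nsmul]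
  congr 1
  exact Finset.sum_congr rfl fun c _ => (crossTerm_swap (hmem c)).symm

theorem co_eq_of_finsum_eq [Nonempty X] {K K' : Knot X}
    (h : ∑ᶠ p ∈ K.doublePairs, K.crossTerm p = ∑ᶠ p ∈ K'.doublePairs, K'.crossTerm p) :
    K.co = K'.co :=
  finsuppTensor_eq_of_two_nsmul (by rw [two_nsmul_co, two_nsmul_co, h])

theorem co_eq_of_bijOn [Nonempty X] {K K' : Knot X}
    (e : UnitAddCircle × UnitAddCircle → UnitAddCircle × UnitAddCircle)
    (he : BijOn e K.doublePairs K'.doublePairs)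
    (h : ∀ p ∈ K.doublePairs, K.crossTerm p = K'.crossTerm (e p)) : K.co = K'.co :=
  co_eq_of_finsum_eq (finsum_mem_eq_of_bijOn e he h)

/-! ### Mirror images, reversed knots and local knots -/

theorem co_mirror [Nonempty X] (K : Knot X) : K.mirror.co = -K.co := by
  rw [co_eq_sum, co_eq_sum, ← Finset.sum_neg_distrib]
  refine Finset.sum_congr rfl fun (c : K.Crossing) _ => ?_
  unfold crossTerm
  rw [sign_mirror c.coe_ne c.2.2.2.2, neg_smul]
  rfl

theorem arcVec_revLoop {γ : C(UnitAddCircle, X)} {s t : UnitAddCircle} (hst : s ≠ t)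
    (h : γ s = γ t) : arcVec (revLoop γ) (-t) (-s) = bar (arcVec γ s t) := by
  obtain ⟨a, b, rfl, rfl, hab, hba⟩ := exists_lift_lt hst
  have h' : revLoop γ ((-b : ℝ) : UnitAddCircle) = revLoop γ ((-a : ℝ) : UnitAddCircle) := by
    simpa [revLoop] using h.symm
  rw [← AddCircle.coe_neg, ← AddCircle.coe_neg, arcVec_coe γ hab hba h,
    arcVec_coe (revLoop γ) (by linarith) (by linarith) h']
  unfold bar loopVec
  rw [Finsupp.lmapDomain_apply, Finsupp.mapDomain_single]
  congr 1
  show _ = FreeClass.mk (revLoop (subloop γ a b h))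
  congr 1
  apply loop_ext
  intro x hx
  rw [subloop_coe _ _ hx]
  show γ (-((-b + x * (-a - -b) : ℝ) : UnitAddCircle)) = subloop γ a b h (-(x : UnitAddCircle))
  -- For `x > 0` the representative of `-x` in `[0, 1)` is `1 - x`; for `x = 0` it is `0`, at the
  -- other end of the arc, and the two ends are identified by `h`.
  rcases hx.1.eq_or_lt with rfl | hx0
  · have := subloop_coe γ h (x := 0) (by simp)
    simp only [zero_mul, add_zero] at this
    simp only [zero_mul, add_zero, AddCircle.coe_neg, neg_neg, AddCircle.coe_zero, neg_zero]
    rw [← AddCircle.coe_zero, this, h]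
  · have e : -(x : UnitAddCircle) = ((1 - x : ℝ) : UnitAddCircle) := by
      rw [AddCircle.coe_sub, AddCircle.coe_period, zero_sub]
    rw [e, subloop_coe γ h ⟨by linarith [hx.2], by linarith⟩, ← AddCircle.coe_neg]
    congr 2
    ring

theorem bar_trivial [Nonempty X] :
    bar (Finsupp.single (FreeClass.trivial X) 1) = Finsupp.single (FreeClass.trivial X) 1 := by
  unfold bar
  rw [Finsupp.lmapDomain_apply, Finsupp.mapDomain_single]
  rfl

theorem bar_loopVec (γ : C(UnitAddCircle, X)) : bar (loopVec γ) = loopVec (revLoop γ) := by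
  unfold bar loopVec
  rw [Finsupp.lmapDomain_apply, Finsupp.mapDomain_single]
  rfl

theorem barTensor_tmul (x y : FreeClassGroup X) :
    barTensor (x ⊗ₜ[ℤ] y) = bar x ⊗ₜ[ℤ] bar y := rfl

theorem crossTerm_reverse [Nonempty X] {K : Knot X} {p : UnitAddCircle × UnitAddCircle}
    (hp : p ∈ K.doublePairs) : K.reverse.crossTerm (-p) = barTensor (K.crossTerm p) := by
  unfold crossTerm smoothVec
  rw [Prod.fst_neg, Prod.snd_neg, ← sign_reverse hp.1 hp.2]
  show K.sign p.1 p.2 • (arcVec (revLoop K.curve) _ _ ⊗ₜ[ℤ] arcVec (revLoop K.curve) _ _ +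
    arcVec (revLoop K.curve) _ _ ⊗ₜ[ℤ] arcVec (revLoop K.curve) _ _ -
    loopVec (revLoop K.curve) ⊗ₜ[ℤ] _ - _ ⊗ₜ[ℤ] loopVec (revLoop K.curve)) = _
  rw [arcVec_revLoop hp.1 hp.2, arcVec_revLoop hp.1.symm hp.2.symm, ← bar_loopVec]
  rw [map_zsmul]
  simp only [map_sub, map_add, barTensor_tmul, bar_trivial]
  -- Reversal also exchanges which lobe comes first; the symmetrised tensor does not see this.
  rw [add_comm (bar (arcVec K.curve p.1 p.2) ⊗ₜ[ℤ] _)]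

theorem co_reverse [Nonempty X] (K : Knot X) : K.reverse.co = barTensor K.co := by
  apply finsuppTensor_eq_of_two_nsmul
  rw [← map_nsmul, two_nsmul_co, two_nsmul_co]
  have := (barTensor (X := X)).toAddMonoidHom.map_finsum_mem K.crossTerm K.finite_doublePairs
  refine Eq.trans ?_ this.symm
  refine (finsum_mem_eq_of_bijOn (fun p => -p) ⟨?_, neg_injective.injOn, ?_⟩ ?_).symm
  · intro p hp
    refine ⟨fun h => hp.1 (neg_injective h), ?_⟩
    simpa [reverse, revLoop] using hp.2
  · intro p hp
    refine ⟨-p, ⟨fun h => hp.1 (neg_injective h), ?_⟩, neg_neg p⟩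
    simpa [reverse, revLoop] using hp.2
  · intro p hp
    exact (crossTerm_reverse hp).symm

theorem mk_eq_trivial_of_plane [PathConnectedSpace X] [Nonempty X] {f : ℝ × ℝ → X}
    (hf : Continuous f) {γ : C(UnitAddCircle, X)} {δ : C(UnitAddCircle, ℝ × ℝ)}
    (h : ∀ u, γ u = f (δ u)) : FreeClass.mk γ = FreeClass.trivial X := by
  rw [← mk_const (f 0)]
  refine mk_eq_of_circle_family (F := fun p => f ((1 - (p.1 : ℝ)) • δ p.2)) (by fun_prop) ?_ ?_
  · intro u
    simp [h]
  · intro u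
    simp

/-- The knot and its lobes factor through the contractible plane (injectivity of `f` closes up the
lobes there). With all classes trivial the four terms of each crossing cancel, whatever its sign. -/
theorem co_eq_zero_of_isLocal [PathConnectedSpace X] [Nonempty X] {K : Knot X} (hK : K.IsLocal) :
    K.co = 0 := by
  obtain ⟨f, hf, -, D, hD, -⟩ := hK
  have hD' : K.curve = ContinuousMap.comp ⟨f, hf.continuous⟩ D.curve := ContinuousMap.ext hD
  have hsub : ∀ (a b : ℝ) (h : K.curve (a : UnitAddCircle) = K.curve (b : UnitAddCircle)),
      FreeClass.mk (subloop K.curve a b h) = FreeClass.trivial X := by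
    intro a b h
    have h' : D.curve (a : UnitAddCircle) = D.curve (b : UnitAddCircle) := by
      rw [hD, hD] at h
      exact hf.injective h
    refine mk_eq_trivial_of_plane hf.continuous (δ := subloop D.curve a b h') fun u => ?_
    obtain ⟨x, hx, rfl⟩ := exists_Ico_coe u
    rw [subloop_coe _ _ hx, subloop_coe _ _ hx, hD]
  unfold co
  refine Finset.sum_eq_zero fun c _ => ?_
  have h1 : loopVec c.loopOne = Finsupp.single (FreeClass.trivial X) 1 := by
    unfold loopVec Crossing.loopOne
    rw [hsub]
  have h2 : loopVec c.loopTwo = Finsupp.single (FreeClass.trivial X) 1 := by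
    unfold loopVec Crossing.loopTwo
    rw [hsub]
  have h3 : loopVec K.curve = Finsupp.single (FreeClass.trivial X) 1 := by
    unfold loopVec
    rw [mk_eq_trivial_of_plane hf.continuous hD]
  simp only [h1, h2, h3]
  rw [add_sub_cancel_right, sub_self, smul_zero]

/-! ### Ambient isotopies -/

theorem image_eventuallyEq_nhds {Y : Type*} [TopologicalSpace Y] (H : X ≃ₜ Y) {A B : Set X} {c : X}
    (h : A =ᶠ[𝓝 c] B) : (H '' A : Set Y) =ᶠ[𝓝 (H c)] H '' B := by
  have ht : Tendsto H.symm (𝓝 (H c)) (𝓝 c) := by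
    have := H.symm.continuous.tendsto (H c)
    rwa [H.symm_apply_apply] at this
  rw [eventuallyEq_set] at h ⊢
  filter_upwards [ht.eventually h] with y hy
  rw [H.image_eq_preimage_symm, H.image_eq_preimage_symm]
  exact hy

theorem map_add_intCast {r : ℝ ≃o ℝ} (hr : ∀ x, r (x + 1) = r x + 1) (x : ℝ) (n : ℤ) :
    r (x + n) = r x + n := by
  have hnat : ∀ (x : ℝ) (k : ℕ), r (x + k) = r x + k := by
    intro x k
    induction k with
    | zero => simp
    | succ k ih => push_cast; rw [← add_assoc, hr, ih, add_assoc]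
  obtain ⟨k, rfl | rfl⟩ := n.eq_nat_or_neg
  · exact_mod_cast hnat x k
  · have := hnat (x + ((-(k : ℤ) : ℤ) : ℝ)) k
    push_cast at this ⊢
    rw [neg_add_cancel_right] at this
    linarith

/-- The map of the circle with lift `r`. -/
noncomputable def circleMap (r : ℝ ≃o ℝ) (u : UnitAddCircle) : UnitAddCircle :=
  (r (AddCircle.equivIco 1 0 u : ℝ) : UnitAddCircle)

theorem circleMap_coe {r : ℝ ≃o ℝ} (hr : ∀ x, r (x + 1) = r x + 1) (x : ℝ) :
    circleMap r (x : UnitAddCircle) = (r x : UnitAddCircle) := by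
  have e : (((AddCircle.equivIco 1 0 (x : UnitAddCircle)) : ℝ) : UnitAddCircle) = x :=
    AddCircle.coe_equivIco
  obtain ⟨n, hn⟩ := coe_eq_coe_iff_exists.1 e.symm
  unfold circleMap
  rw [hn, map_add_intCast hr, coe_add_intCast]

theorem circleMap_injective {r : ℝ ≃o ℝ} (hr : ∀ x, r (x + 1) = r x + 1) :
    Function.Injective (circleMap r) := by
  intro u v h
  obtain ⟨x, -, rfl⟩ := exists_Ico_coe u
  obtain ⟨y, -, rfl⟩ := exists_Ico_coe v
  rw [circleMap_coe hr, circleMap_coe hr] at h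
  obtain ⟨n, hn⟩ := coe_eq_coe_iff_exists.1 h
  rw [← map_add_intCast hr] at hn
  rw [r.injective hn, coe_add_intCast]

theorem circleMap_surjective {r : ℝ ≃o ℝ} (hr : ∀ x, r (x + 1) = r x + 1) :
    Function.Surjective (circleMap r) := by
  intro u
  obtain ⟨x, -, rfl⟩ := exists_Ico_coe u
  exact ⟨(r.symm x : UnitAddCircle), by rw [circleMap_coe hr, r.apply_symm_apply]⟩

/-- The isotopy and the straight-line deformation of the identity of `ℝ` to the lift `r` are run
simultaneously. The homeomorphism `H 1` carries crossing charts to crossing charts, and an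
increasing reparametrisation keeps the half-branches, so signs agree. -/
theorem co_eq_of_ambientIsotopic [Nonempty X] {K K' : Knot X} (h : AmbientIsotopic K K') :
    K.co = K'.co := by
  obtain ⟨H, hH, hH0, r, hr, hcurve, hdots⟩ := h
  have hcoe : Continuous (fun x : ℝ => (x : UnitAddCircle)) := AddCircle.continuous_mk' 1
  have hrc := r.continuous
  have hcurve' : ∀ u, K'.curve u = H 1 (K.curve (circleMap r u)) := by
    intro u
    obtain ⟨x, -, rfl⟩ := exists_Ico_coe u
    rw [circleMap_coe hr, hcurve]
  have hloop : loopVec K.curve = loopVec K'.curve := by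
    unfold loopVec
    congr 1
    refine mk_eq_of_family (G := fun p : unitInterval × ℝ =>
      H p.1 (K.curve (((1 - (p.1 : ℝ)) * p.2 + p.1 * r p.2 : ℝ) : UnitAddCircle)))
      (hH.comp (continuous_fst.prodMk (K.curve.continuous.comp (hcoe.comp (by fun_prop)))))
      (fun τ => ?_) (fun x _ => ?_) (fun x _ => ?_)
    · have h1 : r 1 = r 0 + 1 := by simpa using hr 0
      rw [h1]
      congr 2
      rw [coe_eq_coe_iff_exists]
      exact ⟨1, by push_cast; ring⟩
    · simp [hH0]
    · simp [hcurve]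
  have harc : ∀ s t, s ≠ t → K'.curve s = K'.curve t →
      arcVec K'.curve s t = arcVec K.curve (circleMap r s) (circleMap r t) := by
    intro s t hst hK
    obtain ⟨a, b, rfl, rfl, hab, hba⟩ := exists_lift_lt hst
    have hab' : r a < r b := r.strictMono hab
    have hba' : r b < r a + 1 := by
      rw [← hr]
      exact r.strictMono hba
    have hK' : K.curve (r a : UnitAddCircle) = K.curve (r b : UnitAddCircle) := by
      rw [hcurve, hcurve] at hK
      exact (H 1).injective hK
    rw [circleMap_coe hr, circleMap_coe hr, arcVec_coe _ hab hba hK, arcVec_coe _ hab' hba' hK']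
    unfold loopVec
    congr 1
    -- Interpolation between the affine parametrisation of `[r a, r b]` and the one through `r`;
    -- both ends stay fixed, so the path is closed at every time.
    refine Eq.symm (mk_eq_of_family (G := fun p : unitInterval × ℝ =>
      H p.1 (K.curve (((1 - (p.1 : ℝ)) * (r a + p.2 * (r b - r a)) +
        p.1 * r (a + p.2 * (b - a)) : ℝ) : UnitAddCircle)))
      (hH.comp (continuous_fst.prodMk (K.curve.continuous.comp (hcoe.comp (by fun_prop)))))
      (fun τ => ?_) (fun x hx => ?_) (fun x hx => ?_))
    · have e1 : (1 - (τ : ℝ)) * (r a + 0 * (r b - r a)) + τ * r (a + 0 * (b - a)) = r a := by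
        rw [zero_mul, zero_mul, add_zero, add_zero]; ring
      have e2 : (1 - (τ : ℝ)) * (r a + 1 * (r b - r a)) + τ * r (a + 1 * (b - a)) = r b := by
        rw [one_mul, one_mul, add_sub_cancel, add_sub_cancel]; ring
      simp only [e1, e2, hK']
    · rw [subloop_coe _ _ hx]
      simp [hH0]
    · rw [subloop_coe _ _ hx, hcurve]
      simp
  have hsign : ∀ s t, s ≠ t → K'.curve s = K'.curve t →
      K'.sign s t = K.sign (circleMap r s) (circleMap r t) := by
    intro s t hst hK
    have hK' : K.curve (circleMap r s) = K.curve (circleMap r t) := by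
      rw [hcurve', hcurve'] at hK
      exact (H 1).injective hK
    refine Eq.symm (sign_eq_of_chart (fun h => hst (circleMap_injective hr h)) hK' hst hK
      fun φ hφ => ⟨H 1 ∘ φ, ?_, fun hd => ?_, fun hd => ?_⟩)
    · obtain ⟨a, -, rfl⟩ := exists_Ico_coe s
      obtain ⟨b, -, rfl⟩ := exists_Ico_coe t
      rw [circleMap_coe hr, circleMap_coe hr] at hφ
      exact (hφ.comp_homeomorph (H 1)
        (γ' := ContinuousMap.comp ⟨H 1, (H 1).continuous⟩ K.curve) fun _ => rfl).reparam r hcurve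
        rfl rfl
    · refine (hdots s t hst hK).trans ?_
      rw [hcurve' s, image_comp]
      exact image_eventuallyEq_nhds (H 1) hd
    · refine (hdots s t hst hK).trans ?_
      rw [hcurve' s, image_comp]
      exact image_eventuallyEq_nhds (H 1) hd
  refine Eq.symm (co_eq_of_bijOn (fun p => (circleMap r p.1, circleMap r p.2))
    ⟨?_, ?_, ?_⟩ ?_)
  · rintro ⟨s, t⟩ ⟨hst, hK⟩
    refine ⟨fun h => hst (circleMap_injective hr h), (H 1).injective ?_⟩
    simpa only [hcurve'] using hK
  · rintro ⟨s, t⟩ - ⟨s', t'⟩ - h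
    obtain ⟨h1, h2⟩ := Prod.ext_iff.1 h
    exact Prod.ext (circleMap_injective hr h1) (circleMap_injective hr h2)
  · rintro ⟨s, t⟩ ⟨hst, hK⟩
    obtain ⟨s, rfl⟩ := circleMap_surjective hr s
    obtain ⟨t, rfl⟩ := circleMap_surjective hr t
    refine ⟨(s, t), ⟨fun h => hst (congrArg (circleMap r) h), ?_⟩, rfl⟩
    show K'.curve s = K'.curve t
    rw [hcurve', hcurve', hK]
  · rintro ⟨s, t⟩ ⟨hst, hK⟩
    unfold crossTerm smoothVec
    rw [hsign s t hst hK, harc s t hst hK, harc t s (Ne.symm hst) hK.symm, hloop]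

/-! ### Homotopies of strands -/

/-- The arcs of parameters `a i + b i * x`, `x ∈ [-1, 1]`, are embedded and pairwise disjoint. -/
def DisjointArcs {m : ℕ} (a b : Fin m → ℝ) : Prop :=
  ∀ i j, ∀ x ∈ Icc (-1 : ℝ) 1, ∀ y ∈ Icc (-1 : ℝ) 1,
    ((a i + b i * x : ℝ) : UnitAddCircle) = ((a j + b j * y : ℝ) : UnitAddCircle) → i = j ∧ x = y

/-- The union of the arcs of parameters `a i + b i * x`, `x ∈ [-1, 1]`. -/
def arcSet {m : ℕ} (a b : Fin m → ℝ) : Set UnitAddCircle :=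
  {u | ∃ i, ∃ x ∈ Icc (-1 : ℝ) 1, ((a i + b i * x : ℝ) : UnitAddCircle) = u}

theorem continuous_arc (a b : ℝ) :
    Continuous (fun x : ℝ => ((a + b * x : ℝ) : UnitAddCircle)) :=
  (AddCircle.continuous_mk' 1).comp (by fun_prop)

section Arcs

variable {m : ℕ} {a b : Fin m → ℝ}

theorem mem_arcSet {i : Fin m} {x : ℝ} (hx : x ∈ Icc (-1 : ℝ) 1) :
    ((a i + b i * x : ℝ) : UnitAddCircle) ∈ arcSet a b :=
  ⟨i, x, hx, rfl⟩

theorem isClosed_arcSet : IsClosed (arcSet a b) := by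
  have : arcSet a b =
      ⋃ i, (fun x : ℝ => ((a i + b i * x : ℝ) : UnitAddCircle)) '' Icc (-1 : ℝ) 1 := by
    ext u
    simp only [arcSet, mem_ofPred_eq, mem_iUnion, mem_image]
  rw [this]
  exact isClosed_iUnion_of_finite fun i =>
    (isCompact_Icc.image (continuous_arc _ _)).isClosed

theorem DisjointArcs.ne_zero (hab : DisjointArcs a b) (i : Fin m) : b i ≠ 0 := by
  intro h
  have := (hab i i (-1) (by norm_num) 1 (by norm_num) (by simp [h])).2
  norm_num at this

theorem isOpen_arc {a b : ℝ} (hb : b ≠ 0) :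
    IsOpen ((fun x : ℝ => ((a + b * x : ℝ) : UnitAddCircle)) '' Ioo (-1) 1) := by
  have h1 : IsOpenMap (fun x : ℝ => a + b * x) :=
    ((Homeomorph.mulLeft₀ b hb).trans (Homeomorph.addLeft a)).isOpenMap
  have h2 : IsOpenMap (fun x : ℝ => (x : UnitAddCircle)) := QuotientAddGroup.isOpenMap_coe
  exact (h2.comp h1) _ isOpen_Ioo

/-- Homotopies of the strands of a loop with fixed endpoints extend to a homotopy of the loop. -/
theorem exists_glue (hab : DisjointArcs a b) (γ : C(UnitAddCircle, X))
    {ρ : Fin m → unitInterval × ℝ → X} (hρ : ∀ i, Continuous (ρ i))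
    (hend : ∀ i τ, ∀ x, x = -1 ∨ x = 1 → ρ i (τ, x) = γ ((a i + b i * x : ℝ) : UnitAddCircle)) :
    ∃ F : unitInterval × UnitAddCircle → X, Continuous F ∧
      (∀ τ, ∀ u ∉ arcSet a b, F (τ, u) = γ u) ∧
      ∀ i τ, ∀ x ∈ Icc (-1 : ℝ) 1, F (τ, ((a i + b i * x : ℝ) : UnitAddCircle)) = ρ i (τ, x) := by
  classical
  -- By disjointness of the arcs the chosen index and parameter are the only possible ones.
  let F : unitInterval × UnitAddCircle → X := fun p =>
    if h : p.2 ∈ arcSet a b then ρ h.choose (p.1, h.choose_spec.choose) else γ p.2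
  have hoff : ∀ τ, ∀ u ∉ arcSet a b, F (τ, u) = γ u := fun τ u hu => dif_neg hu
  have hon : ∀ i τ, ∀ x ∈ Icc (-1 : ℝ) 1,
      F (τ, ((a i + b i * x : ℝ) : UnitAddCircle)) = ρ i (τ, x) := by
    intro i τ x hx
    have h : ((a i + b i * x : ℝ) : UnitAddCircle) ∈ arcSet a b := mem_arcSet hx
    have hF : F (τ, ((a i + b i * x : ℝ) : UnitAddCircle)) =
        ρ h.choose (τ, h.choose_spec.choose) := dif_pos h
    obtain ⟨h1, h2⟩ := hab _ _ _ h.choose_spec.choose_spec.1 _ hx h.choose_spec.choose_spec.2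
    rw [hF, h2, h1]
  refine ⟨F, ?_, hoff, hon⟩
  -- A finite closed cover by the closed arcs and the complement of the open arcs. These overlap
  -- only over endpoints of arcs, where `hend` makes the definitions agree.
  let f : Option (Fin m) → Set (unitInterval × UnitAddCircle) := fun o => o.elim
    (univ ×ˢ (⋃ i, (fun x : ℝ => ((a i + b i * x : ℝ) : UnitAddCircle)) '' Ioo (-1) 1)ᶜ)
    (fun i => univ ×ˢ ((fun x : ℝ => ((a i + b i * x : ℝ) : UnitAddCircle)) '' Icc (-1) 1))
  refine LocallyFinite.continuous (f := f) (locallyFinite_of_finite f) ?_ ?_ ?_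
  · refine eq_univ_of_forall fun p => ?_
    rw [mem_iUnion]
    by_cases hp : p.2 ∈ ⋃ i, (fun x : ℝ => ((a i + b i * x : ℝ) : UnitAddCircle)) '' Ioo (-1) 1
    · obtain ⟨i, hi⟩ := mem_iUnion.1 hp
      exact ⟨some i, mem_univ _, image_mono Ioo_subset_Icc_self hi⟩
    · exact ⟨none, mem_univ _, hp⟩
  · rintro (_ | i)
    · exact isClosed_univ.prod
        (isOpen_iUnion fun i => isOpen_arc (hab.ne_zero i)).isClosed_compl
    · exact isClosed_univ.prod (isCompact_Icc.image (continuous_arc _ _)).isClosed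
  · rintro (_ | i)
    · refine (γ.continuous.comp continuous_snd).continuousOn.congr ?_
      rintro ⟨τ, u⟩ ⟨-, hu⟩
      by_cases h : u ∈ arcSet a b
      · obtain ⟨i, x, hx, rfl⟩ := h
        have hx' : x = -1 ∨ x = 1 := by
          by_contra! hcon
          exact hu (mem_iUnion.2 ⟨i, x, ⟨lt_of_le_of_ne hx.1 hcon.1.symm,
            lt_of_le_of_ne hx.2 hcon.2⟩, rfl⟩)
        rw [hon i τ x hx, hend i τ x hx']
        rfl
      · exact hoff τ u h
    · rw [continuousOn_iff_isClosed]
      intro t ht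
      -- The source is compact, so images of closed sets under `q` are closed; continuity on the arc
      -- follows without inverting its parametrisation.
      let q : unitInterval × Icc (-1 : ℝ) 1 → unitInterval × UnitAddCircle :=
        fun p => (p.1, ((a i + b i * p.2 : ℝ) : UnitAddCircle))
      have hq : Continuous q :=
        continuous_fst.prodMk ((continuous_arc _ _).comp (continuous_subtype_val.comp continuous_snd))
      let g : unitInterval × Icc (-1 : ℝ) 1 → X := fun p => ρ i (p.1, p.2)
      have hg : Continuous g := (hρ i).comp (by fun_prop)
      refine ⟨q '' (g ⁻¹' t), ((ht.preimage hg).isCompact.image hq).isClosed, ?_⟩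
      ext ⟨τ, u⟩
      constructor
      · rintro ⟨h1, h2⟩
        refine ⟨?_, h2⟩
        obtain ⟨-, x, hx, rfl⟩ := h2
        refine ⟨(τ, ⟨x, hx⟩), ?_, rfl⟩
        show ρ i (τ, x) ∈ t
        rw [← hon i τ x hx]
        exact h1
      · rintro ⟨⟨⟨τ', x⟩, hx, e⟩, h2⟩
        refine ⟨?_, h2⟩
        rw [← e]
        show F (τ', ((a i + b i * x : ℝ) : UnitAddCircle)) ∈ t
        rw [hon i τ' x x.2]
        exact hx

theorem curve_ext_of_arcs {γ : C(UnitAddCircle, X)} {G : UnitAddCircle → X}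
    (hoff : ∀ u ∉ arcSet a b, γ u = G u)
    (hon : ∀ i, ∀ x ∈ Icc (-1 : ℝ) 1, γ ((a i + b i * x : ℝ) : UnitAddCircle) =
      G ((a i + b i * x : ℝ) : UnitAddCircle)) (u : UnitAddCircle) : γ u = G u := by
  by_cases h : u ∈ arcSet a b
  · obtain ⟨i, x, hx, rfl⟩ := h
    exact hon i x hx
  · exact hoff u h

end Arcs

/-! ### Invariance under replacement of strands -/

/-- A double point that persists during a homotopy of loops carries both of its lobes along. Neither
genericity of the intermediate loops nor control of their other double points is needed. -/
theorem smoothVec_eq_of_family [Nonempty X] {F : unitInterval × UnitAddCircle → X}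
    (hF : Continuous F) {s t : unitInterval → ℝ} (hs : Continuous s) (ht : Continuous t)
    (hne : ∀ τ, (s τ : UnitAddCircle) ≠ (t τ : UnitAddCircle))
    (hst : ∀ τ, F (τ, (s τ : UnitAddCircle)) = F (τ, (t τ : UnitAddCircle)))
    {γ γ' : C(UnitAddCircle, X)} (h0 : ∀ u, γ u = F (0, u)) (h1 : ∀ u, γ' u = F (1, u)) :
    smoothVec γ (s 0) (t 0) = smoothVec γ' (s 1) (t 1) := by
  unfold smoothVec
  rw [arcVec_eq_of_family hF hs ht hne hst h0 h1,
    arcVec_eq_of_family hF ht hs (fun τ => (hne τ).symm) (fun τ => (hst τ).symm) h0 h1]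
  unfold loopVec
  rw [mk_eq_of_circle_family hF h0 h1]

/-- Since `S` is closed, the two curves agree near both parameters, so they have the same crossing
charts there. The homotopy fixes the crossing, which is followed with constant parameters, while its
lobes may well traverse `S`. -/
theorem crossTerm_eq_of_notMem [Nonempty X] {K K' : Knot X} {S : Set UnitAddCircle}
    (hS : IsClosed S) {F : unitInterval × UnitAddCircle → X} (hF : Continuous F)
    (hFS : ∀ τ, ∀ u ∉ S, F (τ, u) = K.curve u) (h0 : ∀ u, K.curve u = F (0, u))
    (h1 : ∀ u, K'.curve u = F (1, u)) {p : UnitAddCircle × UnitAddCircle}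
    (hp : p ∈ K.doublePairs) (hp1 : p.1 ∉ S) (hp2 : p.2 ∉ S)
    (hd : SameDotsAt K K' (K.curve p.1)) : K.crossTerm p = K'.crossTerm p := by
  have hKK : ∀ u ∉ S, K.curve u = K'.curve u := fun u hu => by rw [h1, hFS 1 u hu]
  have hev : ∀ u ∉ S, ∀ᶠ v in 𝓝 u, K.curve v = K'.curve v := fun u hu => by
    filter_upwards [hS.isOpen_compl.mem_nhds hu] with v hv using hKK v hv
  have hsign : K.sign p.1 p.2 = K'.sign p.1 p.2 := by
    refine sign_eq_of_chart hp.1 hp.2 hp.1 (by rw [← hKK _ hp1, ← hKK _ hp2, hp.2])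
      fun φ hφ => ⟨φ, hφ.congr (hev _ hp1) (hev _ hp2), ?_, ?_⟩ <;>
    · intro h
      rw [← hKK _ hp1]
      exact hd.symm.trans h
  obtain ⟨s, t⟩ := p
  obtain ⟨x, -, rfl⟩ := exists_Ico_coe s
  obtain ⟨y, -, rfl⟩ := exists_Ico_coe t
  unfold crossTerm
  rw [hsign]
  congr 1
  exact smoothVec_eq_of_family hF (s := fun _ => x) (t := fun _ => y) continuous_const
    continuous_const (fun _ => hp.1) (fun τ => by rw [hFS τ _ hp1, hFS τ _ hp2]; exact hp.2) h0 h1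

/-- The double pairs of `K` with both entries in `S`. -/
def doublePairsIn (K : Knot X) (S : Set UnitAddCircle) : Set (UnitAddCircle × UnitAddCircle) :=
  {p | p ∈ K.doublePairs ∧ p.1 ∈ S ∧ p.2 ∈ S}

/-- The localisation principle. By `hmix` no crossing has one preimage in `S` and the other outside,
so the sum splits; the outer parts agree by `crossTerm_eq_of_notMem`, leaving only a comparison
inside `S`. -/
theorem co_eq_of_doublePairsIn [Nonempty X] {K K' : Knot X} {S : Set UnitAddCircle}
    (hS : IsClosed S) {F : unitInterval × UnitAddCircle → X} (hF : Continuous F)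
    (hFS : ∀ τ, ∀ u ∉ S, F (τ, u) = K.curve u) (h0 : ∀ u, K.curve u = F (0, u))
    (h1 : ∀ u, K'.curve u = F (1, u))
    (hmix : ∀ u ∈ S, ∀ v ∉ S, K.curve u ≠ K.curve v ∧ K'.curve u ≠ K'.curve v)
    (hd : ∀ p ∈ K.doublePairs, p.1 ∉ S → p.2 ∉ S → SameDotsAt K K' (K.curve p.1))
    (hin : ∑ᶠ p ∈ K.doublePairsIn S, K.crossTerm p = ∑ᶠ p ∈ K'.doublePairsIn S, K'.crossTerm p) :
    K.co = K'.co := by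
  have hKK : ∀ u ∉ S, K.curve u = K'.curve u := fun u hu => by rw [h1, hFS 1 u hu]
  have split : ∀ L : Knot X, (∀ u ∈ S, ∀ v ∉ S, L.curve u ≠ L.curve v) →
      ∑ᶠ p ∈ L.doublePairs, L.crossTerm p =
        ∑ᶠ p ∈ L.doublePairsIn Sᶜ, L.crossTerm p + ∑ᶠ p ∈ L.doublePairsIn S, L.crossTerm p := by
    intro L hL
    have hset : L.doublePairs = L.doublePairsIn Sᶜ ∪ L.doublePairsIn S := by
      ext p
      constructor
      · intro hp
        by_cases h1 : p.1 ∈ S <;> by_cases h2 : p.2 ∈ S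
        · exact Or.inr ⟨hp, h1, h2⟩
        · exact absurd hp.2 (hL _ h1 _ h2)
        · exact absurd hp.2.symm (hL _ h2 _ h1)
        · exact Or.inl ⟨hp, h1, h2⟩
      · rintro (hp | hp) <;> exact hp.1
    rw [← finsum_mem_union, ← hset]
    · rw [disjoint_left]
      exact fun p hp hp' => hp.2.1 hp'.2.1
    · exact L.finite_doublePairs.subset fun p hp => hp.1
    · exact L.finite_doublePairs.subset fun p hp => hp.1
  apply co_eq_of_finsum_eq
  rw [split K fun u hu v hv => (hmix u hu v hv).1, split K' fun u hu v hv => (hmix u hu v hv).2,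
    hin]
  congr 1
  refine finsum_mem_eq_of_bijOn id ?_ fun p hp =>
    crossTerm_eq_of_notMem hS hF hFS h0 h1 hp.1 hp.2.1 hp.2.2 (hd p hp.1 hp.2.1 hp.2.2)
  have : K.doublePairsIn Sᶜ = K'.doublePairsIn Sᶜ := by
    ext p
    constructor
    · rintro ⟨⟨hp, hp'⟩, h2, h3⟩
      exact ⟨⟨hp, by rw [← hKK _ h2, ← hKK _ h3, hp']⟩, h2, h3⟩
    · rintro ⟨⟨hp, hp'⟩, h2, h3⟩
      exact ⟨⟨hp, by rw [hKK _ h2, hKK _ h3, hp']⟩, h2, h3⟩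
  rw [← this]
  exact bijOn_id _

/-- The conditions of `ReplaceStrands` for given arcs of parameters. -/
structure StrandReplacement {M : Type*} (β : M → X) (B : Set M) {m : ℕ} (σ σ' : Fin m → ℝ → M)
    (d d' : Fin m → Fin m → Set M) (K K' : Knot X) (a b : Fin m → ℝ) : Prop where
  disjoint : DisjointArcs a b
  on_arc : ∀ i, ∀ x ∈ Icc (-1 : ℝ) 1,
    K.curve ((a i + b i * x : ℝ) : UnitAddCircle) = β (σ i x) ∧
    K'.curve ((a i + b i * x : ℝ) : UnitAddCircle) = β (σ' i x)
  off_arc : ∀ u ∉ arcSet a b, K.curve u = K'.curve u ∧ K.curve u ∉ β '' B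
  dots_off : ∀ s t, s ≠ t → K.curve s = K.curve t → K.curve s ∉ β '' B →
    SameDotsAt K K' (K.curve s)
  dots_on : ∀ i j, i ≤ j → ∀ x ∈ Icc (-1 : ℝ) 1, ∀ y ∈ Icc (-1 : ℝ) 1, (i, x) ≠ (j, y) →
    (σ i x = σ j y → K.dots =ᶠ[𝓝 (β (σ i x))] β '' d i j) ∧
    (σ' i x = σ' j y → K'.dots =ᶠ[𝓝 (β (σ' i x))] β '' d' i j)

theorem ReplaceStrands.exists_strandReplacement {M : Type*} {β : M → X} {B : Set M} {m : ℕ}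
    {σ σ' : Fin m → ℝ → M} {d d' : Fin m → Fin m → Set M} {K K' : Knot X}
    (h : ReplaceStrands β B σ σ' d d' K K') :
    ∃ a b, StrandReplacement β B σ σ' d d' K K' a b := by
  obtain ⟨a, b, h1, h2, h3, h4, h5⟩ := h
  exact ⟨a, b, h1, h2, fun u hu => h3 u fun i x hx e => hu ⟨i, x, hx, e.symm⟩, h4, h5⟩

namespace StrandReplacement

variable {M : Type*} {β : M → X} {B : Set M} {m : ℕ}
  {σ σ' : Fin m → ℝ → M} {d d' : Fin m → Fin m → Set M} {K K' : Knot X} {a b : Fin m → ℝ}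

theorem mixed (h : StrandReplacement β B σ σ' d d' K K' a b)
    (hB : ∀ i, ∀ x ∈ Icc (-1 : ℝ) 1, σ i x ∈ B ∧ σ' i x ∈ B) :
    ∀ u ∈ arcSet a b, ∀ v ∉ arcSet a b,
      K.curve u ≠ K.curve v ∧ K'.curve u ≠ K'.curve v := by
  rintro _ ⟨i, x, hx, rfl⟩ v hv
  obtain ⟨h1, h2⟩ := h.off_arc v hv
  obtain ⟨h3, h4⟩ := h.on_arc i x hx
  refine ⟨fun e => h2 ?_, fun e => h2 ?_⟩
  · rw [← e, h3]
    exact mem_image_of_mem _ (hB i x hx).1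
  · rw [h1, ← e, h4]
    exact mem_image_of_mem _ (hB i x hx).2

theorem exists_homotopy [TopologicalSpace M] (h : StrandReplacement β B σ σ' d d' K K' a b)
    (hβ : Continuous β) {ρ : Fin m → unitInterval × ℝ → M} (hρ : ∀ i, Continuous (ρ i))
    (hρ0 : ∀ i, ∀ x ∈ Icc (-1 : ℝ) 1, ρ i (0, x) = σ i x)
    (hρ1 : ∀ i, ∀ x ∈ Icc (-1 : ℝ) 1, ρ i (1, x) = σ' i x)
    (hend : ∀ i τ, ∀ x, x = -1 ∨ x = 1 → ρ i (τ, x) = σ i x) :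
    ∃ F : unitInterval × UnitAddCircle → X, Continuous F ∧
      (∀ τ, ∀ u ∉ arcSet a b, F (τ, u) = K.curve u) ∧ (∀ u, K.curve u = F (0, u)) ∧
      (∀ u, K'.curve u = F (1, u)) ∧
      ∀ i τ, ∀ x ∈ Icc (-1 : ℝ) 1,
        F (τ, ((a i + b i * x : ℝ) : UnitAddCircle)) = β (ρ i (τ, x)) := by
  obtain ⟨F, hF, hoff, hon⟩ := exists_glue h.disjoint K.curve (ρ := fun i p => β (ρ i p))
    (fun i => hβ.comp (hρ i)) (fun i τ x hx => by
      have hx' : x ∈ Icc (-1 : ℝ) 1 := by rcases hx with rfl | rfl <;> norm_num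
      rw [hend i τ x hx, (h.on_arc i x hx').1])
  refine ⟨F, hF, hoff, ?_, ?_, hon⟩
  · refine curve_ext_of_arcs (a := a) (b := b) (fun u hu => (hoff 0 u hu).symm) fun i x hx => ?_
    rw [hon i 0 x hx, hρ0 i x hx, (h.on_arc i x hx).1]
  · refine curve_ext_of_arcs (a := a) (b := b) (fun u hu => ?_) fun i x hx => ?_
    · rw [hoff 1 u hu, (h.off_arc u hu).1]
    · rw [hon i 1 x hx, hρ1 i x hx, (h.on_arc i x hx).2]

/-- Invariance under replacement of strands which cross each other in at most one point, by a
homotopy which preserves the crossings. -/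
theorem co_eq [Nonempty X] [TopologicalSpace M] (h : StrandReplacement β B σ σ' d d' K K' a b)
    (hβ : Continuous β) (hinj : Function.Injective β)
    (hB : ∀ i, ∀ x ∈ Icc (-1 : ℝ) 1, σ i x ∈ B ∧ σ' i x ∈ B)
    {ρ : Fin m → unitInterval × ℝ → M} (hρ : ∀ i, Continuous (ρ i))
    (hρ0 : ∀ i, ∀ x ∈ Icc (-1 : ℝ) 1, ρ i (0, x) = σ i x)
    (hρ1 : ∀ i, ∀ x ∈ Icc (-1 : ℝ) 1, ρ i (1, x) = σ' i x)
    (hend : ∀ i τ, ∀ x, x = -1 ∨ x = 1 → ρ i (τ, x) = σ i x)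
    {c : Fin m → Fin m → unitInterval → ℝ} (hc : ∀ i j, Continuous (c i j))
    (hcs : ∀ i j, c i j = c j i) (hcI : ∀ i j τ, c i j τ ∈ Icc (-1 : ℝ) 1)
    (hcρ : ∀ i j, i < j → ∀ τ, ρ i (τ, c i j τ) = ρ j (τ, c i j τ))
    (hσ : ∀ i, InjOn (σ i) (Icc (-1) 1)) (hσ' : ∀ i, InjOn (σ' i) (Icc (-1) 1))
    (hcσ : ∀ i j, i < j → ∀ x ∈ Icc (-1 : ℝ) 1, ∀ y ∈ Icc (-1 : ℝ) 1, σ i x = σ j y →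
      x = c i j 0 ∧ y = c i j 0)
    (hcσ' : ∀ i j, i < j → ∀ x ∈ Icc (-1 : ℝ) 1, ∀ y ∈ Icc (-1 : ℝ) 1, σ' i x = σ' j y →
      x = c i j 1 ∧ y = c i j 1)
    (hsign : ∀ i j, i < j →
      K.sign ((a i + b i * c i j 0 : ℝ) : UnitAddCircle)
        ((a j + b j * c i j 0 : ℝ) : UnitAddCircle) =
      K'.sign ((a i + b i * c i j 1 : ℝ) : UnitAddCircle)
        ((a j + b j * c i j 1 : ℝ) : UnitAddCircle)) :
    K.co = K'.co := by
  obtain ⟨F, hF, hoff, h0, h1, hon⟩ := h.exists_homotopy hβ hρ hρ0 hρ1 hend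
  refine co_eq_of_doublePairsIn isClosed_arcSet hF hoff h0 h1 (h.mixed hB)
    (fun p hp hp1 _ => h.dots_off _ _ hp.1 hp.2 (h.off_arc _ hp1).2) ?_
  have hcρ' : ∀ i j, i ≠ j → ∀ τ, ρ i (τ, c i j τ) = ρ j (τ, c i j τ) := by
    intro i j hij τ
    rcases lt_or_gt_of_ne hij with hlt | hlt
    · exact hcρ i j hlt τ
    · rw [hcs]
      exact (hcρ j i hlt τ).symm
  have hFc : ∀ i j, i ≠ j → ∀ τ, F (τ, ((a i + b i * c i j τ : ℝ) : UnitAddCircle)) =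
      F (τ, ((a j + b j * c i j τ : ℝ) : UnitAddCircle)) := by
    intro i j hij τ
    rw [hon _ _ _ (hcI _ _ _), hon _ _ _ (hcI _ _ _), hcρ' i j hij τ]
  have hne : ∀ i j, i ≠ j → ∀ τ, ((a i + b i * c i j τ : ℝ) : UnitAddCircle) ≠
      ((a j + b j * c i j τ : ℝ) : UnitAddCircle) :=
    fun i j hij τ e => hij (h.disjoint _ _ _ (hcI _ _ _) _ (hcI _ _ _) e).1
  let pt : unitInterval → Fin m × Fin m → UnitAddCircle × UnitAddCircle := fun τ q =>
    (((a q.1 + b q.1 * c q.1 q.2 τ : ℝ) : UnitAddCircle),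
      ((a q.2 + b q.2 * c q.1 q.2 τ : ℝ) : UnitAddCircle))
  have hpt : ∀ τ, Function.Injective (pt τ) := by
    rintro τ ⟨i, j⟩ ⟨i', j'⟩ e
    obtain ⟨e1, e2⟩ := Prod.ext_iff.1 e
    exact Prod.ext (h.disjoint _ _ _ (hcI _ _ _) _ (hcI _ _ _) e1).1
      (h.disjoint _ _ _ (hcI _ _ _) _ (hcI _ _ _) e2).1
  -- Used at both ends of the homotopy: the double pairs inside correspond to ordered pairs of
  -- distinct strands. This common index set matches the crossings before and after.
  have key : ∀ (L : Knot X) (τ : unitInterval) (ξ : Fin m → ℝ → M),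
      (∀ u, L.curve u = F (τ, u)) →
      (∀ i, ∀ x ∈ Icc (-1 : ℝ) 1, L.curve ((a i + b i * x : ℝ) : UnitAddCircle) = β (ξ i x)) →
      (∀ i, InjOn (ξ i) (Icc (-1) 1)) →
      (∀ i j, i < j → ∀ x ∈ Icc (-1 : ℝ) 1, ∀ y ∈ Icc (-1 : ℝ) 1, ξ i x = ξ j y →
        x = c i j τ ∧ y = c i j τ) →
      L.doublePairsIn (arcSet a b) = pt τ '' {q | q.1 ≠ q.2} := by
    intro L τ ξ hL hξ hξi hcξ
    ext ⟨u, v⟩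
    constructor
    · rintro ⟨⟨hne', hL'⟩, ⟨i, x, hx, rfl⟩, j, y, hy, rfl⟩
      dsimp only at hL' hne'
      rw [hξ i x hx, hξ j y hy] at hL'
      have e := hinj hL'
      rcases lt_trichotomy i j with hij | rfl | hij
      · obtain ⟨rfl, hy'⟩ := hcξ i j hij x hx y hy e
        exact ⟨(i, j), hij.ne, by rw [hy']⟩
      · exact absurd (by rw [hξi i hx hy e]) hne'
      · obtain ⟨rfl, hx'⟩ := hcξ j i hij y hy x hx e.symm
        exact ⟨(i, j), hij.ne', by simp only [pt, hx', hcs i j]⟩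
    · rintro ⟨⟨i, j⟩, hij, e⟩
      obtain ⟨rfl, rfl⟩ := Prod.ext_iff.1 e
      refine ⟨⟨hne i j hij τ, ?_⟩, mem_arcSet (hcI _ _ _), mem_arcSet (hcI _ _ _)⟩
      simp only [hL]
      exact hFc i j hij τ
  have hsign' : ∀ i j, i ≠ j →
      K.sign ((a i + b i * c i j 0 : ℝ) : UnitAddCircle)
        ((a j + b j * c i j 0 : ℝ) : UnitAddCircle) =
      K'.sign ((a i + b i * c i j 1 : ℝ) : UnitAddCircle)
        ((a j + b j * c i j 1 : ℝ) : UnitAddCircle) := by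
    intro i j hij
    rcases lt_or_gt_of_ne hij with hlt | hlt
    · exact hsign i j hlt
    · rw [sign_swap (hne i j hij 0) (by simp only [h0]; exact hFc i j hij 0),
        sign_swap (hne i j hij 1) (by simp only [h1]; exact hFc i j hij 1), hcs]
      exact hsign j i hlt
  rw [key K 0 σ h0 (fun i x hx => (h.on_arc i x hx).1) hσ hcσ,
    key K' 1 σ' h1 (fun i x hx => (h.on_arc i x hx).2) hσ' hcσ',
    finsum_mem_image (hpt 0).injOn, finsum_mem_image (hpt 1).injOn]
  refine finsum_mem_congr rfl ?_
  rintro ⟨i, j⟩ hij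
  unfold crossTerm
  rw [show K.sign (pt 0 (i, j)).1 (pt 0 (i, j)).2 = _ from hsign' i j hij]
  congr 1
  exact smoothVec_eq_of_family hF (s := fun τ => a i + b i * c i j τ)
    (t := fun τ => a j + b j * c i j τ) (by have := hc i j; fun_prop) (by have := hc i j; fun_prop)
    (hne i j hij) (hFc i j hij) h0 h1

end StrandReplacement

/-! ### The sign of a crossing of two graphs -/

/-- Reduces adjacency of dotted areas to the model space. Only continuity of `β` is used, because
two pages of a book are not open in it; and `G` needs to lie in `d` only near `p`, so a dot set
described piecewise is allowed. -/
theorem dottedBetween_of_region {K : Knot X} {s t : UnitAddCircle} {e₁ e₂ : ℝ} {M : Type*}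
    [TopologicalSpace M] {β : M → X} (hβ : Continuous β) {p : M} (hp : K.curve s = β p)
    {G d : Set M} (hd : K.dots =ᶠ[𝓝 (β p)] β '' d) (hG : ∀ᶠ q in 𝓝 p, q ∈ G → q ∈ d)
    (h : ∀ V ∈ 𝓝 p, ∃ W ⊆ V ∩ G, IsPreconnected W ∧
      (∀ᶠ x in 𝓝[>] (0 : ℝ), ∃ q ∈ closure W,
        K.curve (s + ((e₁ * x : ℝ) : UnitAddCircle)) = β q) ∧
      (∀ᶠ x in 𝓝[>] (0 : ℝ), ∃ q ∈ closure W,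
        K.curve (t + ((e₂ * x : ℝ) : UnitAddCircle)) = β q)) :
    K.DottedBetween s t e₁ e₂ := by
  intro N hN
  rw [hp] at hN
  have hN' := hβ.continuousAt.preimage_mem_nhds (inter_mem hN (eventuallyEq_set.1 hd))
  obtain ⟨W, hW, hWc, h1, h2⟩ := h _ (inter_mem hN' hG)
  refine ⟨β '' W, ?_, hWc.image _ hβ.continuousOn, ?_, ?_⟩
  · rintro _ ⟨q, hq, rfl⟩
    obtain ⟨⟨⟨hq1, hq2⟩, hq3⟩, hq4⟩ := hW hq
    exact ⟨hq1, hq2.2 (mem_image_of_mem _ (hq3 hq4))⟩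
  · filter_upwards [h1] with x ⟨q, hq, e⟩
    rw [e]
    exact image_closure_subset_closure_image hβ (mem_image_of_mem _ hq)
  · filter_upwards [h2] with x ⟨q, hq, e⟩
    rw [e]
    exact image_closure_subset_closure_image hβ (mem_image_of_mem _ hq)

theorem mem_closure_image_prod {m : ℝ × ℝ → ℝ × ℝ} (hm : Continuous m) {J L : Set ℝ} {x r : ℝ}
    (hx : x ∈ closure J) (hr : r ∈ closure L) : m (x, r) ∈ closure (m '' (J ×ˢ L)) := by
  apply image_closure_subset_closure_image hm
  refine mem_image_of_mem _ ?_
  rw [closure_prod_eq]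
  exact ⟨hx, hr⟩

/-- If the steeper graph is over, the area above both graphs is dotted; it is bounded by the right
half of `f` and the left half of `g`. Otherwise the area between the graphs to the right of `c` is
dotted, bounded by the two right halves. The signs of `b₁` and `b₂` tell whether a right half is
outgoing or incoming. -/
theorem sign_graph {K : Knot X} {β : ℝ × ℝ → X} (hβ : Continuous β) {a₁ b₁ a₂ b₂ c : ℝ}
    (hb₁ : b₁ ≠ 0) (hb₂ : b₂ ≠ 0) (hc : c ∈ Ioo (-1 : ℝ) 1) {f g : ℝ → ℝ} (hf : Continuous f)
    (hg : Continuous g)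
    (h1 : ∀ x ∈ Icc (-1 : ℝ) 1, K.curve ((a₁ + b₁ * x : ℝ) : UnitAddCircle) = β (x, f x))
    (h2 : ∀ x ∈ Icc (-1 : ℝ) 1, K.curve ((a₂ + b₂ * x : ℝ) : UnitAddCircle) = β (x, g x))
    (hfg : f c = g c) {η : ℝ} (hη : 0 < η) (hgt : ∀ x, c < x → x < c + η → g x < f x)
    (hlt : ∀ x, c - η < x → x < c → f x < g x)
    (hne : ((a₁ + b₁ * c : ℝ) : UnitAddCircle) ≠ ((a₂ + b₂ * c : ℝ) : UnitAddCircle))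
    {fOver : Prop} {d : Set (ℝ × ℝ)} (hd : K.dots =ᶠ[𝓝 (β (c, f c))] β '' d)
    (hG : ∀ᶠ q in 𝓝 (c, f c), q ∈ graphDots f g fOver → q ∈ d) [Decidable fOver] :
    K.sign ((a₁ + b₁ * c : ℝ) : UnitAddCircle) ((a₂ + b₂ * c : ℝ) : UnitAddCircle) =
      (if fOver then -1 else 1) * (if 0 < b₁ * b₂ then 1 else -1) := by
  have hs : K.curve ((a₁ + b₁ * c : ℝ) : UnitAddCircle) = β (c, f c) := h1 c ⟨hc.1.le, hc.2.le⟩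
  have ht : K.curve ((a₂ + b₂ * c : ℝ) : UnitAddCircle) = β (c, g c) := h2 c ⟨hc.1.le, hc.2.le⟩
  have hK := hs.trans ((congrArg (fun y => β (c, y)) hfg).trans ht.symm)
  have e1 : ∀ x, ((a₁ + b₁ * c : ℝ) : UnitAddCircle) + ((b₁ * x : ℝ) : UnitAddCircle) =
      ((a₁ + b₁ * (c + x) : ℝ) : UnitAddCircle) := by
    intro x
    rw [← AddCircle.coe_add]
    congr 1
    ring
  have e2 : ∀ x, ((a₂ + b₂ * c : ℝ) : UnitAddCircle) + ((b₂ * x : ℝ) : UnitAddCircle) =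
      ((a₂ + b₂ * (c + x) : ℝ) : UnitAddCircle) := by
    intro x
    rw [← AddCircle.coe_add]
    congr 1
    ring
  by_cases hO : fOver
  · have hD : K.DottedBetween ((a₁ + b₁ * c : ℝ) : UnitAddCircle)
        ((a₂ + b₂ * c : ℝ) : UnitAddCircle) b₁ (-b₂) := by
      refine dottedBetween_of_region hβ hs hd hG fun V hV => ?_
      -- Straightens the area above both graphs: a rectangle is mapped onto a connected piece of it,
      -- and the bottom side onto the upper envelope.
      set m : ℝ × ℝ → ℝ × ℝ := fun z => (z.1, max (f z.1) (g z.1) + z.2) with hm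
      have hmc : Continuous m := by fun_prop
      have hm0 : m (c, 0) = (c, f c) := by simp [hm, hfg]
      have hev : m ⁻¹' V ∈ 𝓝 (c, (0 : ℝ)) :=
        hmc.continuousAt.preimage_mem_nhds (by rwa [hm0])
      obtain ⟨δ, hδ, hball⟩ := Metric.mem_nhds_iff.1 hev
      refine ⟨m '' (Ioo (c - δ) (c + δ) ×ˢ Ioo 0 δ), ?_, ?_, ?_, ?_⟩
      · rintro _ ⟨⟨x, r⟩, ⟨hx, hr⟩, rfl⟩
        simp only [mem_Ioo] at hx hr
        refine ⟨hball ?_, Or.inl ⟨hO, ?_⟩⟩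
        · rw [Metric.mem_ball, Prod.dist_eq, max_lt_iff, Real.dist_eq, Real.dist_eq, abs_lt,
            abs_lt]
          exact ⟨⟨by simp only; linarith, by simp only; linarith⟩, by simp only; linarith,
            by simp only; linarith⟩
        · have := le_max_left (f x) (g x)
          have := le_max_right (f x) (g x)
          exact mul_pos (by simp only [hm]; linarith) (by simp only [hm]; linarith)
      · exact (isPreconnected_Ioo.prod isPreconnected_Ioo).image _ hmc.continuousOn
      · have : Ioo (0 : ℝ) (min (min δ η) (1 - c)) ∈ 𝓝[>] (0 : ℝ) :=
          Ioo_mem_nhdsGT (lt_min (lt_min hδ hη) (by linarith [hc.2]))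
        filter_upwards [this] with x hx
        have hx1 := lt_min_iff.1 hx.2
        have hx2 := lt_min_iff.1 hx1.1
        have hxI : c + x ∈ Icc (-1 : ℝ) 1 := ⟨by linarith [hc.1, hx.1], by linarith⟩
        refine ⟨m (c + x, 0), mem_closure_image_prod hmc (subset_closure ?_) ?_, ?_⟩
        · exact ⟨by linarith [hx.1], by linarith⟩
        · rw [closure_Ioo hδ.ne]
          exact ⟨le_rfl, hδ.le⟩
        · rw [e1, h1 _ hxI]
          simp [hm, max_eq_left (hgt (c + x) (by linarith [hx.1]) (by linarith)).le]
      · have : Ioo (0 : ℝ) (min (min δ η) (c + 1)) ∈ 𝓝[>] (0 : ℝ) :=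
          Ioo_mem_nhdsGT (lt_min (lt_min hδ hη) (by linarith [hc.1]))
        filter_upwards [this] with x hx
        have hx1 := lt_min_iff.1 hx.2
        have hx2 := lt_min_iff.1 hx1.1
        have hxI : c + -x ∈ Icc (-1 : ℝ) 1 := ⟨by linarith, by linarith [hc.2, hx.1]⟩
        refine ⟨m (c + -x, 0), mem_closure_image_prod hmc (subset_closure ?_) ?_, ?_⟩
        · exact ⟨by linarith, by linarith [hx.1]⟩
        · rw [closure_Ioo hδ.ne]
          exact ⟨le_rfl, hδ.le⟩
        · rw [neg_mul, ← mul_neg, e2, h2 _ hxI]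
          simp [hm, max_eq_right (hlt (c + -x) (by linarith) (by linarith [hx.1])).le]
    rw [sign_eq_of_dottedBetween hne hK hb₁ (neg_ne_zero.2 hb₂) hD, if_pos hO]
    rcases lt_or_gt_of_ne (mul_ne_zero hb₁ hb₂) with h | h
    · rw [if_pos (by linarith), if_neg (by linarith)]; norm_num
    · rw [if_neg (by linarith), if_pos (by linarith)]; norm_num
  · have hD : K.DottedBetween ((a₁ + b₁ * c : ℝ) : UnitAddCircle)
        ((a₂ + b₂ * c : ℝ) : UnitAddCircle) b₁ b₂ := by
      refine dottedBetween_of_region hβ hs hd hG fun V hV => ?_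
      -- Fills the area between the graphs by vertical segments from `g` to `f`. The segment over
      -- `c` collapses to the crossing, so by compactness the nearby segments lie in `V`.
      set m : ℝ × ℝ → ℝ × ℝ := fun z => (z.1, g z.1 + z.2 * (f z.1 - g z.1)) with hm
      have hmc : Continuous m := by fun_prop
      have hev : ∀ᶠ x in 𝓝 c, ∀ r ∈ Icc (0 : ℝ) 1, m (x, r) ∈ V := by
        refine isCompact_Icc.eventually_forall_of_forall_eventually fun r _ => ?_
        refine hmc.continuousAt.preimage_mem_nhds ?_
        have : m (c, r) = (c, f c) := by simp [hm, hfg]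
        rwa [this]
      obtain ⟨δ, hδ, hball⟩ := Metric.mem_nhds_iff.1 hev
      set ε := min (min δ η) (1 - c) with hε
      have hε0 : 0 < ε := lt_min (lt_min hδ hη) (by linarith [hc.2])
      have hεδ : ε ≤ δ := (min_le_left _ _).trans (min_le_left _ _)
      have hεη : ε ≤ η := (min_le_left _ _).trans (min_le_right _ _)
      have hε1 : ε ≤ 1 - c := min_le_right _ _
      refine ⟨m '' (Ioo c (c + ε) ×ˢ Ioo 0 1), ?_, ?_, ?_, ?_⟩
      · rintro _ ⟨⟨x, r⟩, ⟨hx, hr⟩, rfl⟩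
        simp only [mem_Ioo] at hx hr
        refine ⟨hball (a := x) ?_ r ⟨hr.1.le, hr.2.le⟩, Or.inr ⟨hO, ?_⟩⟩
        · rw [Metric.mem_ball, Real.dist_eq, abs_lt]
          constructor <;> linarith
        · have := hgt x hx.1 (by linarith)
          have h3 : 0 < f x - g x := by linarith
          have h4 : 0 < 1 - r := by linarith
          have := mul_pos (mul_pos hr.1 h3) (mul_pos h4 h3)
          simp only [hm]
          nlinarith
      · exact (isPreconnected_Ioo.prod isPreconnected_Ioo).image _ hmc.continuousOn
      · filter_upwards [Ioo_mem_nhdsGT hε0] with x hx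
        have hxI : c + x ∈ Icc (-1 : ℝ) 1 := ⟨by linarith [hc.1, hx.1], by linarith [hx.2]⟩
        refine ⟨m (c + x, 1), mem_closure_image_prod hmc (subset_closure ?_) ?_, ?_⟩
        · exact ⟨by linarith [hx.1], by linarith [hx.2]⟩
        · rw [closure_Ioo zero_ne_one]
          exact ⟨zero_le_one, le_rfl⟩
        · rw [e1, h1 _ hxI]
          simp [hm]
      · filter_upwards [Ioo_mem_nhdsGT hε0] with x hx
        have hxI : c + x ∈ Icc (-1 : ℝ) 1 := ⟨by linarith [hc.1, hx.1], by linarith [hx.2]⟩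
        refine ⟨m (c + x, 0), mem_closure_image_prod hmc (subset_closure ?_) ?_, ?_⟩
        · exact ⟨by linarith [hx.1], by linarith [hx.2]⟩
        · rw [closure_Ioo zero_ne_one]
          exact ⟨le_rfl, zero_le_one⟩
        · rw [e2, h2 _ hxI]
          simp [hm]
    rw [sign_eq_of_dottedBetween hne hK hb₁ hb₂ hD, if_neg hO, one_mul]

end Knot

/-! ### Pages of a book -/

/-- Positive and negative parts replace the case distinction; continuity and injectivity are read
off from this form. -/
theorem Book.val_plane {n : ℕ} (i j : Fin n) (q : ℝ × ℝ) :
    (Book.plane i j q).1 = (Pi.single i (max q.2 0) + Pi.single j (max (-q.2) 0), q.1) := by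
  unfold Book.plane
  split_ifs with h
  · simp [Book.pt, h]
  · simp [Book.pt, (not_le.1 h).le]

theorem Book.continuous_of_val {n : ℕ} {Y : Type*} [TopologicalSpace Y] {f : Y → Book n}
    (h : Continuous fun y => (f y).1) : Continuous f :=
  continuous_induced_rng.2 h

theorem Book.continuous_plane {n : ℕ} (i j : Fin n) : Continuous (Book.plane i j) := by
  apply Book.continuous_of_val
  simp only [Book.val_plane]
  refine Continuous.prodMk (Continuous.add ?_ ?_) continuous_fst
  · exact (continuous_single i).comp (by fun_prop)
  · exact (continuous_single j).comp (by fun_prop)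

theorem Book.plane_injective {n : ℕ} {i j : Fin n} (hij : i ≠ j) :
    Function.Injective (Book.plane i j) := by
  intro q q' h
  have h' := congrArg Subtype.val h
  rw [Book.val_plane, Book.val_plane] at h'
  obtain ⟨h1, h2⟩ := Prod.ext_iff.1 h'
  have hi := congrFun h1 i
  have hj := congrFun h1 j
  simp [hij, hij.symm] at hi hj
  refine Prod.ext h2 ?_
  have e : ∀ x : ℝ, x = max x 0 - max (-x) 0 := fun x => by
    rcases le_total 0 x with hx | hx <;> simp [hx]
  rw [e q.2, e q'.2, hi, hj]

/-- A book is star-shaped about the origin of its spine. Contractibility supplies the homotopy of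
strands for the move in three pages. -/
instance Book.contractibleSpace (n : ℕ) : ContractibleSpace (Book n) := by
  let S : Set ((Fin n → ℝ) × ℝ) := {p | (∀ i, 0 ≤ p.1 i) ∧ ∀ i j, i ≠ j → p.1 i = 0 ∨ p.1 j = 0}
  have hS : StarConvex ℝ (0 : (Fin n → ℝ) × ℝ) S := by
    rw [starConvex_zero_iff]
    rintro p ⟨hp1, hp2⟩ τ h0 h1
    refine ⟨fun i => mul_nonneg h0 (hp1 i), fun i j hij => ?_⟩
    rcases hp2 i j hij with h | h
    · exact Or.inl (by simp [h])
    · exact Or.inr (by simp [h])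
  exact hS.contractibleSpace ⟨0, by simp [S]⟩

namespace Knot

/-! ### Replacing one embedded strand -/

/-- Paths with common ends in a simply connected space are homotopic relative to the ends; `projIcc`
extends the homotopy to all real parameters. -/
theorem exists_strand_homotopy {M : Type*} [TopologicalSpace M] [SimplyConnectedSpace M]
    {σ σ' : ℝ → M} (hσ : ContinuousOn σ (Icc (-1) 1)) (hσ' : ContinuousOn σ' (Icc (-1) 1))
    (h0 : σ' (-1) = σ (-1)) (h1 : σ' 1 = σ 1) :
    ∃ ρ : unitInterval × ℝ → M, Continuous ρ ∧ (∀ x ∈ Icc (-1 : ℝ) 1, ρ (0, x) = σ x) ∧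
      (∀ x ∈ Icc (-1 : ℝ) 1, ρ (1, x) = σ' x) ∧ ∀ τ x, x = -1 ∨ x = 1 → ρ (τ, x) = σ x := by
  have hmem : ∀ t : unitInterval, 2 * (t : ℝ) - 1 ∈ Icc (-1 : ℝ) 1 := fun t =>
    ⟨by linarith [t.2.1], by linarith [t.2.2]⟩
  have hc : ∀ ξ : ℝ → M, ContinuousOn ξ (Icc (-1) 1) →
      Continuous fun t : unitInterval => ξ (2 * (t : ℝ) - 1) := fun ξ hξ =>
    hξ.comp_continuous (by fun_prop) hmem
  let p : Path (σ (-1)) (σ 1) := ⟨⟨fun t => σ (2 * (t : ℝ) - 1), hc σ hσ⟩, by simp, by norm_num⟩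
  let p' : Path (σ (-1)) (σ 1) :=
    ⟨⟨fun t => σ' (2 * (t : ℝ) - 1), hc σ' hσ'⟩, by simp [h0], by norm_num [h1]⟩
  obtain ⟨H⟩ := SimplyConnectedSpace.paths_homotopic p p'
  have hproj : ∀ x ∈ Icc (-1 : ℝ) 1,
      2 * ((projIcc (0 : ℝ) 1 zero_le_one ((x + 1) / 2) : unitInterval) : ℝ) - 1 = x := by
    intro x hx
    rw [projIcc_of_mem zero_le_one (x := (x + 1) / 2) ⟨by linarith [hx.1], by linarith [hx.2]⟩]
    show 2 * ((x + 1) / 2) - 1 = x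
    ring
  refine ⟨fun q => H (q.1, projIcc 0 1 zero_le_one ((q.2 + 1) / 2)), ?_, ?_, ?_, ?_⟩
  · have : Continuous (projIcc (0 : ℝ) 1 zero_le_one) := continuous_projIcc
    fun_prop
  · intro x hx
    refine (H.apply_zero _).trans ?_
    show σ _ = σ x
    rw [hproj x hx]
  · intro x hx
    refine (H.apply_one _).trans ?_
    show σ' _ = σ' x
    rw [hproj x hx]
  · rintro τ x (rfl | rfl)
    · have : projIcc (0 : ℝ) 1 zero_le_one ((-1 + 1) / 2) = (0 : unitInterval) := by
        norm_num
      simp only [this]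
      exact H.source τ
    · have : projIcc (0 : ℝ) 1 zero_le_one ((1 + 1) / 2) = (1 : unitInterval) := by
        norm_num
      simp only [this]
      exact H.target τ

theorem StrandReplacement.co_eq_of_single [Nonempty X] {M : Type*} [TopologicalSpace M]
    [SimplyConnectedSpace M] {β : M → X} {B : Set M} {σ σ' : Fin 1 → ℝ → M}
    {d d' : Fin 1 → Fin 1 → Set M} {K K' : Knot X} {a b : Fin 1 → ℝ}
    (h : StrandReplacement β B σ σ' d d' K K' a b) (hβ : Continuous β)
    (hinj : Function.Injective β)
    (hB : ∀ x ∈ Icc (-1 : ℝ) 1, σ 0 x ∈ B ∧ σ' 0 x ∈ B)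
    (hσ : ContinuousOn (σ 0) (Icc (-1) 1)) (hσ' : ContinuousOn (σ' 0) (Icc (-1) 1))
    (hi : InjOn (σ 0) (Icc (-1) 1)) (hi' : InjOn (σ' 0) (Icc (-1) 1))
    (h0 : σ' 0 (-1) = σ 0 (-1)) (h1 : σ' 0 1 = σ 0 1) : K.co = K'.co := by
  obtain ⟨ρ, hρ, hρ0, hρ1, hend⟩ := exists_strand_homotopy hσ hσ' h0 h1
  have hlt : ∀ i j : Fin 1, ¬ i < j := fun i j => by omega
  have hz : ∀ i : Fin 1, i = 0 := fun i => Subsingleton.elim i 0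
  -- A single embedded strand has no crossing with itself, and there is no pair `i < j`; the
  -- crossing parameter `c = 0` is a dummy.
  refine h.co_eq hβ hinj (fun i => hz i ▸ hB) (ρ := fun _ => ρ) (fun _ => hρ)
    (fun i => hz i ▸ hρ0) (fun i => hz i ▸ hρ1) (fun i => hz i ▸ hend) (c := fun _ _ _ => 0)
    (fun _ _ => continuous_const) (fun _ _ => rfl) (fun _ _ _ => by norm_num)
    (fun i j hij => absurd hij (hlt i j)) (fun i => hz i ▸ hi) (fun i => hz i ▸ hi')
    (fun i j hij => absurd hij (hlt i j)) (fun i j hij => absurd hij (hlt i j))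
    (fun i j hij => absurd hij (hlt i j))

theorem co_eq_of_moveFour [Nonempty X] {K K' : Knot X} (h : MoveFour K K') : K.co = K'.co := by
  obtain ⟨n, -, φ, hφ, i, j, hij, h⟩ := h
  obtain ⟨a, b, h⟩ := h.exists_strandReplacement
  refine h.co_eq_of_single (hφ.continuous.comp (Book.continuous_plane i j))
    (hφ.injective.comp (Book.plane_injective hij)) (fun x hx => ⟨⟨hx, ?_, ?_⟩, hx, ?_, ?_⟩)
    (by fun_prop) (by fun_prop) (fun x _ y _ e => (Prod.ext_iff.1 e).1)
    (fun x _ y _ e => (Prod.ext_iff.1 e).1) (by norm_num) (by norm_num)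
  · norm_num
  · norm_num
  · show -2 ≤ 2 * x ^ 2 - 1
    nlinarith [sq_nonneg x]
  · show 2 * x ^ 2 - 1 ≤ 2
    nlinarith [hx.1, hx.2]

/-- Both strands use the spine coordinate as parameter, hence are embedded, and they lie in a
contractible book. -/
theorem co_eq_of_moveSix [Nonempty X] {K K' : Knot X} (h : MoveSix K K') : K.co = K'.co := by
  obtain ⟨n, -, φ, hφ, i, j, k, hij, hik, hjk, h⟩ := h
  obtain ⟨a, b, h⟩ := h.exists_strandReplacement
  have hsnd : ∀ (l : Fin n) (r t : ℝ), (Book.pt l r t).1.2 = t := fun l r t => rfl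
  have hc : ∀ l : Fin n, Continuous fun p : ℝ × ℝ => Book.pt l p.1 p.2 := by
    intro l
    apply Book.continuous_of_val
    exact Continuous.prodMk ((continuous_single l).comp (by fun_prop)) continuous_snd
  have hc' : ∀ (l : Fin n) (f : ℝ → ℝ), Continuous f → Continuous fun x => Book.pt l (f x) x :=
    fun l f hf => (hc l).comp (hf.prodMk continuous_id)
  have hmem : ∀ (l : Fin n) (r t : ℝ), l = i ∨ l = j ∨ l = k → r ≤ 2 → t ∈ Icc (-1 : ℝ) 1 →
      Book.pt l r t ∈ {p : Book n | p.1.2 ∈ Icc (-1 : ℝ) 1 ∧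
        ∀ l, p.1.1 l ≤ 2 ∧ (l ≠ i → l ≠ j → l ≠ k → p.1.1 l = 0)} := by
    intro l r t hl hr ht
    refine ⟨ht, fun l' => ?_⟩
    by_cases h' : l' = l
    · subst h'
      refine ⟨?_, fun h1 h2 h3 => by tauto⟩
      simp [Book.pt, hr]
    · simp [Book.pt, h']
  -- All pages share the spine; this is what makes the pieces of the strands fit at the break
  -- points.
  have hzero : ∀ (l l' : Fin n) (r r' t : ℝ), r ≤ 0 → r' ≤ 0 →
      Book.pt l r t = Book.pt l' r' t := by
    intro l l' r r' t hr hr'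
    apply Subtype.ext
    simp [Book.pt, hr, hr']
  refine h.co_eq_of_single hφ.continuous hφ.injective (fun x hx => ⟨?_, ?_⟩)
    (Continuous.continuousOn ?_) (Continuous.continuousOn ?_)
    (fun x _ y _ e => ?_) (fun x _ y _ e => ?_) (by norm_num) (by norm_num)
  · split_ifs
    · exact hmem _ _ _ (by tauto) (by linarith [hx.1]) hx
    · exact hmem _ _ _ (by tauto) (by linarith [hx.2]) hx
  · split_ifs
    · exact hmem _ _ _ (by tauto) (by linarith [hx.1]) hx
    · exact hmem _ _ _ (by tauto) (by linarith [abs_nonneg x]) hx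
    · exact hmem _ _ _ (by tauto) (by linarith [hx.2]) hx
  · refine Continuous.if_le (hc' _ _ (by fun_prop)) (hc' _ _ (by fun_prop)) continuous_id
      continuous_const fun x hx => ?_
    exact hzero _ _ _ _ _ (by linarith) (by linarith)
  · refine Continuous.if_le (hc' _ _ (by fun_prop)) ?_ continuous_id continuous_const
      fun x hx => ?_
    · have : (fun x : ℝ => if x < 1 / 2 then Book.pt k (1 - 2 * |x|) x else Book.pt j (2 * x - 1) x)
          = fun x : ℝ => if 1 / 2 ≤ x then Book.pt j (2 * x - 1) x else
            Book.pt k (1 - 2 * |x|) x := by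
        funext x
        by_cases hx : x < 1 / 2
        · rw [if_pos hx, if_neg (not_le.2 hx)]
        · rw [if_neg hx, if_pos (not_lt.1 hx)]
      rw [this]
      refine Continuous.if_le (hc' _ _ (by fun_prop)) (hc' _ _ (by fun_prop)) continuous_const
        continuous_id fun x hx => ?_
      refine hzero _ _ _ _ _ (by linarith) ?_
      rw [← hx]
      norm_num
    · rw [if_pos (by linarith)]
      refine hzero _ _ _ _ _ (by linarith) ?_
      rw [hx]
      norm_num [abs_of_neg]
  · have := congrArg (fun p : Book n => p.1.2) e
    dsimp only at this
    split_ifs at this <;> simpa only [hsnd] using this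
  · have := congrArg (fun p : Book n => p.1.2) e
    dsimp only at this
    split_ifs at this <;> simpa only [hsnd] using this

/-- The disc is the image of a star-shaped set, so the two arcs are homotopic in it relative to
their ends. The homotopy may sweep across the singular point: only free homotopy classes are at
stake. -/
theorem co_eq_of_moveSeven [Nonempty X] {K K' : Knot X} (h : MoveSeven K K') : K.co = K'.co := by
  obtain ⟨x, -, n, G, e, ⟨he, -, -⟩, S, hS, -, D, D', rfl, -, a, b, hab, hba, -, -, ha, hb, hD,
    hi, hi', hout, hdots⟩ := h
  let C : Set (Fin n → ℝ) := {v | ∃ r ∈ Icc (0 : ℝ) 1, ∃ θ, v = r • (S θ).1}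
  have hC : StarConvex ℝ (0 : Fin n → ℝ) C := by
    rw [starConvex_zero_iff]
    rintro _ ⟨r, hr, θ, rfl⟩ τ h0 h1
    exact ⟨τ * r, ⟨mul_nonneg h0 hr.1, mul_le_one₀ h1 hr.1 hr.2⟩, θ, smul_smul _ _ _⟩
  have : ContractibleSpace C := hC.contractibleSpace
    ⟨0, 0, ⟨le_rfl, zero_le_one⟩, ((0 : ℝ) : UnitAddCircle), by simp⟩
  have hcone : ∀ v : C, (∀ u, 0 ≤ v.1 u) ∧ ∑ u, v.1 u ≤ 1 ∧
      ((∀ u, v.1 u = 0) ∨ ∃ w w', (w = w' ∨ G.Adj w w') ∧ ∀ u, v.1 u ≠ 0 → u = w ∨ u = w') := by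
    rintro ⟨_, r, hr, θ, rfl⟩
    exact Cone.smul_spec (S θ) hr
  let ι : C → Cone G := fun v => ⟨v.1, hcone v⟩
  have hι : IsEmbedding ι := by
    refine IsEmbedding.of_comp (g := Subtype.val) ?_ continuous_subtype_val
      IsEmbedding.subtypeVal
    exact continuous_induced_rng.2 continuous_subtype_val
  have hβ : IsEmbedding (e ∘ ι) := he.comp hι
  have hDC : ∀ y ∈ e '' {y | ∃ r ∈ Icc (0 : ℝ) 1, ∃ θ, y.1 = r • (S θ).1},
      ∃ v, (e ∘ ι) v = y := by
    rintro _ ⟨y, hy, rfl⟩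
    exact ⟨⟨y.1, hy⟩, rfl⟩
  have hDC' : ∀ v, (e ∘ ι) v ∈ e '' {y | ∃ r ∈ Icc (0 : ℝ) 1, ∃ θ, y.1 = r • (S θ).1} :=
    fun v => ⟨ι v, v.2, rfl⟩
  -- Midpoint and half-length turn `[a, b]` into the standard interval `[-1, 1]`.
  have harc : ∀ x ∈ Icc (-1 : ℝ) 1, (a + b) / 2 + (b - a) / 2 * x ∈ Icc a b := by
    intro x hx
    constructor <;> nlinarith [hx.1, hx.2]
  choose! σ hσ using fun x hx => hDC _ (hD _ (harc x hx)).1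
  choose! σ' hσ' using fun x hx => hDC _ (hD _ (harc x hx)).2
  have hinj : ∀ x y, (a + b) / 2 + (b - a) / 2 * x = (a + b) / 2 + (b - a) / 2 * y → x = y := by
    intro x y h
    have : (b - a) / 2 * (x - y) = 0 := by linarith
    rcases mul_eq_zero.1 this with h | h <;> linarith
  have hσi : InjOn σ (Icc (-1) 1) := by
    intro x hx y hy h
    apply hinj
    apply hi (harc x hx) (harc y hy)
    dsimp only
    rw [← hσ x hx, ← hσ y hy, h]
  have hσi' : InjOn σ' (Icc (-1) 1) := by
    intro x hx y hy h
    apply hinj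
    apply hi' (harc x hx) (harc y hy)
    dsimp only
    rw [← hσ' x hx, ← hσ' y hy, h]
  have hend : ∀ x, x = -1 ∨ x = 1 → σ' x = σ x := by
    intro x hx
    have hxI : x ∈ Icc (-1 : ℝ) 1 := by rcases hx with rfl | rfl <;> norm_num
    apply hβ.injective
    rw [hσ x hxI, hσ' x hxI]
    rcases hx with rfl | rfl
    · rw [show (a + b) / 2 + (b - a) / 2 * -1 = a by ring, ha]
    · rw [show (a + b) / 2 + (b - a) / 2 * 1 = b by ring, hb]
  -- The box is all of `C`, whose image is exactly the disc; no dotted areas are prescribed, as the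
  -- arcs are embedded.
  have hrep : StrandReplacement (e ∘ ι) univ (fun _ : Fin 1 => σ) (fun _ => σ') (fun _ _ => ∅)
      (fun _ _ => ∅) K K' (fun _ => (a + b) / 2) (fun _ => (b - a) / 2) := by
    refine ⟨?_, fun _ x hx => ⟨(hσ x hx).symm, (hσ' x hx).symm⟩, ?_,
      fun s t hst h _ => hdots s t hst h, ?_⟩
    · intro i j x hx y hy h
      refine ⟨Subsingleton.elim _ _, hinj x y ?_⟩
      have h1 := harc x hx
      have h2 := harc y hy
      exact (AddCircle.coe_eq_coe_iff_of_mem_Ico (p := (1 : ℝ)) (a := a)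
        ⟨h1.1, by linarith [h1.2]⟩ ⟨h2.1, by linarith [h2.2]⟩).1 h
    · intro u hu
      have hv := (AddCircle.equivIco 1 a u).2
      have hvu : (((AddCircle.equivIco 1 a u) : ℝ) : UnitAddCircle) = u := AddCircle.coe_equivIco
      set v : ℝ := (AddCircle.equivIco 1 a u : ℝ) with hv'
      have hbv : b < v := by
        by_contra! hcon
        refine hu ⟨0, (v - (a + b) / 2) / ((b - a) / 2), ?_, ?_⟩
        · have hpos : 0 < (b - a) / 2 := by linarith
          constructor
          · rw [le_div_iff₀ hpos]; linarith [hv.1]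
          · rw [div_le_iff₀ hpos]; linarith
        · rw [mul_div_cancel₀ _ (by linarith : (b - a) / 2 ≠ 0), add_sub_cancel]
          exact hvu
      rw [← hvu]
      obtain ⟨h1, h2⟩ := hout v ⟨hbv, hv.2⟩
      refine ⟨h1, ?_⟩
      rintro ⟨w, -, hw⟩
      exact h2 (hw ▸ hDC' w)
    · intro i j _ x hx y hy hne
      have hxy : x ≠ y := fun h => hne (by rw [h, Subsingleton.elim i j])
      exact ⟨fun h => absurd (hσi hx hy h) hxy, fun h => absurd (hσi' hx hy h) hxy⟩
  have hcont : ∀ (L : Knot X) (ξ : ℝ → C),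
      (∀ x ∈ Icc (-1 : ℝ) 1, (e ∘ ι) (ξ x) =
        L.curve (((a + b) / 2 + (b - a) / 2 * x : ℝ) : UnitAddCircle)) →
      ContinuousOn ξ (Icc (-1) 1) := by
    intro L ξ hξ
    rw [hβ.isInducing.continuousOn_iff]
    exact (L.curve.continuous.comp (continuous_arc _ _)).continuousOn.congr hξ
  exact hrep.co_eq_of_single hβ.continuous hβ.injective (fun _ _ => ⟨mem_univ _, mem_univ _⟩)
    (hcont K σ hσ) (hcont K' σ' hσ') hσi hσi' (hend _ (Or.inl rfl)) (hend _ (Or.inr rfl))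

/-! ### Moves with one crossing for each pair of strands -/

/-- The root in `(-1, 1)` of the equation `x = ε (1 - x²) / 2`, for `ε ∈ [-1, 1]`. -/
noncomputable def bend (ε : ℝ) : ℝ := ε / (1 + √(1 + ε ^ 2))

/-- The rationalised root of `ε x² + 2 x - ε = 0` stays continuous at `ε = 0`, where the quadratic
term disappears. -/
theorem continuous_bend : Continuous bend := by
  unfold bend
  refine Continuous.div continuous_id (by fun_prop) fun ε => ?_
  positivity

theorem bend_neg (ε : ℝ) : bend (-ε) = -bend ε := by
  unfold bend
  rw [neg_sq, neg_div]

theorem bend_mem {ε : ℝ} (hε : ε ∈ Icc (-1 : ℝ) 1) : bend ε ∈ Ioo (-1 : ℝ) 1 := by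
  have hs := Real.sqrt_nonneg (1 + ε ^ 2)
  have hs1 : 0 < √(1 + ε ^ 2) := Real.sqrt_pos.2 (by positivity)
  unfold bend
  constructor
  · rw [lt_div_iff₀ (by linarith)]; linarith [hε.1]
  · rw [div_lt_iff₀ (by linarith)]; linarith [hε.2]

theorem bend_eq (ε : ℝ) : bend ε = ε * ((1 - bend ε ^ 2) / 2) := by
  have hs := Real.sqrt_nonneg (1 + ε ^ 2)
  have hq : √(1 + ε ^ 2) ^ 2 = 1 + ε ^ 2 := Real.sq_sqrt (by positivity)
  unfold bend
  field_simp
  linear_combination (-ε) * hq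

/-- Subtracting the equation of the root `w` leaves the factor `1 + ε (x + w) / 2`, positive since
`|ε| ≤ 1` and `|x + w| < 2`. Uniqueness of the crossing and the order of the strands on either side
both follow. -/
theorem sub_parabola_eq {ε : ℝ} (hε : ε ∈ Icc (-1 : ℝ) 1) {x : ℝ} (hx : x ∈ Icc (-1 : ℝ) 1) :
    ∃ k, 0 < k ∧ x - ε * ((1 - x ^ 2) / 2) = k * (x - bend ε) := by
  have hw := bend_mem hε
  have he := bend_eq ε
  refine ⟨1 + ε * (x + bend ε) / 2, ?_, ?_⟩
  · have h1 : |ε * (x + bend ε)| < 2 := by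
      rw [abs_mul]
      have h2 : |ε| ≤ 1 := abs_le.2 hε
      have h3 : |x + bend ε| < 2 := abs_lt.2 ⟨by linarith [hx.1, hw.1], by linarith [hx.2, hw.2]⟩
      nlinarith [abs_nonneg ε, abs_nonneg (x + bend ε)]
    linarith [(abs_lt.1 h1).1]
  · linear_combination he

/-- The parameter of the crossing of two strands of the triangle. -/
noncomputable def triangleCrossing (ε : ℝ) : Fin 3 → Fin 3 → ℝ :=
  ![![0, bend ε, 0], ![bend ε, 0, -bend ε], ![0, -bend ε, 0]]

theorem triangleCrossing_comm (ε : ℝ) (i j : Fin 3) :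
    triangleCrossing ε i j = triangleCrossing ε j i := by
  fin_cases i <;> fin_cases j <;> rfl

theorem triangleCrossing_mem {ε : ℝ} (hε : ε ∈ Icc (-1 : ℝ) 1) (i j : Fin 3) :
    triangleCrossing ε i j ∈ Ioo (-1 : ℝ) 1 := by
  have hw := bend_mem hε
  have hw' : -bend ε ∈ Ioo (-1 : ℝ) 1 := ⟨by linarith [hw.2], by linarith [hw.1]⟩
  have h0 : (0 : ℝ) ∈ Ioo (-1 : ℝ) 1 := by norm_num
  fin_cases i <;> fin_cases j <;> assumption

theorem triangle_sub {ε : ℝ} (hε : ε ∈ Icc (-1 : ℝ) 1) {x : ℝ} (hx : x ∈ Icc (-1 : ℝ) 1)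
    {i j : Fin 3} (hij : i < j) :
    ∃ k, 0 < k ∧ triangle ε i x - triangle ε j x = k * (x - triangleCrossing ε i j) := by
  have h01 : ∃ k, 0 < k ∧ x - ε * ((1 - x ^ 2) / 2) = k * (x - bend ε) := sub_parabola_eq hε hx
  have h12 : ∃ k, 0 < k ∧ ε * ((1 - x ^ 2) / 2) - -x = k * (x - -bend ε) := by
    obtain ⟨k, hk, h⟩ := sub_parabola_eq (ε := -ε) ⟨by linarith [hε.2], by linarith [hε.1]⟩ hx
    rw [bend_neg] at h
    exact ⟨k, hk, by linarith⟩
  have h02 : ∃ k, 0 < k ∧ x - -x = k * (x - 0) := ⟨2, by norm_num, by ring⟩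
  fin_cases i <;> fin_cases j <;> first | exact h01 | exact h12 | exact h02 | exact absurd hij (by decide)

theorem continuous_triangle (i : Fin 3) : Continuous fun p : ℝ × ℝ => triangle p.1 i p.2 := by
  fin_cases i <;> simp [triangle] <;> fun_prop

theorem triangle_mem_Icc {ε : ℝ} (hε : ε ∈ Icc (-1 : ℝ) 1) {x : ℝ} (hx : x ∈ Icc (-1 : ℝ) 1)
    (i : Fin 3) : triangle ε i x ∈ Icc (-2 : ℝ) 2 := by
  have h0 : x ∈ Icc (-2 : ℝ) 2 := ⟨by linarith [hx.1], by linarith [hx.2]⟩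
  have h2 : -x ∈ Icc (-2 : ℝ) 2 := ⟨by linarith [hx.2], by linarith [hx.1]⟩
  have h1 : ε * ((1 - x ^ 2) / 2) ∈ Icc (-2 : ℝ) 2 := by
    have h3 : 0 ≤ 1 - x ^ 2 := by nlinarith [hx.1, hx.2]
    constructor <;> nlinarith [hε.1, hε.2, sq_nonneg x]
  fin_cases i <;> assumption

theorem sign_triangle {β : ℝ × ℝ → X} (hβ : Continuous β) {ε : ℝ} (hε : ε ∈ Icc (-1 : ℝ) 1)
    {K : Knot X} {a b : Fin 3 → ℝ} (hab : DisjointArcs a b)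
    (hon : ∀ i, ∀ x ∈ Icc (-1 : ℝ) 1,
      K.curve ((a i + b i * x : ℝ) : UnitAddCircle) = β (x, triangle ε i x))
    {i j : Fin 3} (hij : i < j) {fOver : Prop} [Decidable fOver]
    (hd : K.dots =ᶠ[𝓝 (β (triangleCrossing ε i j, triangle ε i (triangleCrossing ε i j)))]
      β '' graphDots (triangle ε i) (triangle ε j) fOver) :
    K.sign ((a i + b i * triangleCrossing ε i j : ℝ) : UnitAddCircle)
      ((a j + b j * triangleCrossing ε i j : ℝ) : UnitAddCircle) =
      (if fOver then -1 else 1) * (if 0 < b i * b j then 1 else -1) := by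
  have hc := triangleCrossing_mem hε i j
  have hcI : triangleCrossing ε i j ∈ Icc (-1 : ℝ) 1 := ⟨hc.1.le, hc.2.le⟩
  have hcont : ∀ i, Continuous (triangle ε i) := fun i =>
    (continuous_triangle i).comp (continuous_const.prodMk continuous_id)
  refine sign_graph hβ (hab.ne_zero i) (hab.ne_zero j) hc (hcont i) (hcont j) (hon i) (hon j) ?_
    (η := min (1 - triangleCrossing ε i j) (triangleCrossing ε i j + 1))
    (lt_min (by linarith [hc.2]) (by linarith [hc.1])) (fun x hx hx' => ?_) (fun x hx hx' => ?_)
    (fun h => hij.ne (hab _ _ _ hcI _ hcI h).1) hd (Eventually.of_forall fun q hq => hq)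
  · obtain ⟨k, -, h⟩ := triangle_sub hε hcI hij
    rw [sub_self, mul_zero] at h
    linarith
  · have := min_le_left (1 - triangleCrossing ε i j) (triangleCrossing ε i j + 1)
    obtain ⟨k, hk, h⟩ := triangle_sub hε (x := x) ⟨by linarith [hc.1], by linarith⟩ hij
    have := mul_pos hk (sub_pos.2 hx)
    linarith
  · have := min_le_right (1 - triangleCrossing ε i j) (triangleCrossing ε i j + 1)
    obtain ⟨k, hk, h⟩ := triangle_sub hε (x := x) ⟨by linarith, by linarith [hc.2]⟩ hij
    have := mul_neg_of_pos_of_neg hk (sub_neg.2 hx')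
    linarith

theorem interp_mem (τ : unitInterval) : 1 - 2 * (τ : ℝ) ∈ Icc (-1 : ℝ) 1 :=
  ⟨by linarith [τ.2.2], by linarith [τ.2.1]⟩

theorem interp_zero : 1 - 2 * ((0 : unitInterval) : ℝ) = 1 := by simp

theorem interp_one : 1 - 2 * ((1 : unitInterval) : ℝ) = -1 := by norm_num

/-- The bending parameter of the middle strand runs from `1` to `-1`. At `0` all three strands meet
in one point, which is harmless since each pair is followed separately. Heights and directions of a
pair do not change, so neither does its sign. -/
theorem co_eq_of_moveThree [Nonempty X] {K K' : Knot X} (h : MoveThree K K') : K.co = K'.co := by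
  classical
  obtain ⟨ψ, hψ, height, h⟩ := h
  obtain ⟨a, b, h⟩ := h.exists_strandReplacement
  have h1 : (1 : ℝ) ∈ Icc (-1 : ℝ) 1 := by norm_num
  have h1' : (-1 : ℝ) ∈ Icc (-1 : ℝ) 1 := by norm_num
  have hcross : ∀ ε ∈ Icc (-1 : ℝ) 1, ∀ i j : Fin 3, i < j → ∀ x ∈ Icc (-1 : ℝ) 1,
      ∀ y ∈ Icc (-1 : ℝ) 1, ((x, triangle ε i x) : ℝ × ℝ) = (y, triangle ε j y) →
      x = triangleCrossing ε i j ∧ y = triangleCrossing ε i j := by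
    intro ε hε i j hij x hx y _ e
    obtain ⟨rfl, e2⟩ := Prod.ext_iff.1 e
    obtain ⟨k, hk, hk'⟩ := triangle_sub hε hx hij
    rw [show triangle ε i x = triangle ε j x from e2, sub_self] at hk'
    have : x - triangleCrossing ε i j = 0 := by
      rcases mul_eq_zero.1 hk'.symm with h | h
      · exact absurd h hk.ne'
      · exact h
    exact ⟨by linarith, by linarith⟩
  have heq : ∀ ε ∈ Icc (-1 : ℝ) 1, ∀ i j : Fin 3, i < j →
      triangle ε i (triangleCrossing ε i j) = triangle ε j (triangleCrossing ε i j) := by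
    intro ε hε i j hij
    obtain ⟨k, -, hk'⟩ := triangle_sub hε (Ioo_subset_Icc_self (triangleCrossing_mem hε i j)) hij
    rw [sub_self, mul_zero] at hk'
    linarith
  refine h.co_eq hψ.continuous hψ.injective (fun i x hx => ⟨⟨hx, triangle_mem_Icc h1 hx i⟩,
    hx, triangle_mem_Icc h1' hx i⟩)
    (ρ := fun i p => (p.2, triangle (1 - 2 * (p.1 : ℝ)) i p.2)) (fun i => ?_)
    (fun i x _ => by simp only [interp_zero]) (fun i x _ => by simp only [interp_one])
    (fun i τ x hx => ?_)
    (c := fun i j τ => triangleCrossing (1 - 2 * (τ : ℝ)) i j) (fun i j => ?_)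
    (fun i j => funext fun τ => triangleCrossing_comm _ i j)
    (fun i j τ => Ioo_subset_Icc_self (triangleCrossing_mem (interp_mem τ) i j))
    (fun i j hij τ => Prod.ext rfl (heq _ (interp_mem τ) i j hij))
    (fun i x _ y _ e => (Prod.ext_iff.1 e).1) (fun i x _ y _ e => (Prod.ext_iff.1 e).1)
    (fun i j hij => by simp only [interp_zero]; exact hcross 1 h1 i j hij)
    (fun i j hij => by simp only [interp_one]; exact hcross (-1) h1' i j hij)
    (fun i j hij => ?_)
  · exact continuous_snd.prodMk ((continuous_triangle i).comp
      (by fun_prop : Continuous fun p : unitInterval × ℝ => ((1 - 2 * (p.1 : ℝ), p.2) : ℝ × ℝ)))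
  · have hx2 : x ^ 2 = 1 := by rcases hx with rfl | rfl <;> norm_num
    refine Prod.ext rfl ?_
    fin_cases i <;> simp [triangle, hx2]
  · have hb : Continuous fun τ : unitInterval => bend (1 - 2 * (τ : ℝ)) :=
      continuous_bend.comp (by fun_prop)
    fin_cases i <;> fin_cases j <;>
      first | exact continuous_const | exact hb | exact hb.neg
  · have hcI := Ioo_subset_Icc_self (triangleCrossing_mem h1 i j)
    have hcI' := Ioo_subset_Icc_self (triangleCrossing_mem h1' i j)
    have hne : ∀ c : ℝ, (i, c) ≠ (j, c) := fun c e => hij.ne (Prod.ext_iff.1 e).1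
    simp only [interp_zero, interp_one]
    rw [sign_triangle hψ.continuous h1 h.disjoint (fun i x hx => (h.on_arc i x hx).1) hij
        ((h.dots_on i j hij.le _ hcI _ hcI (hne _)).1 (Prod.ext rfl (heq 1 h1 i j hij))),
      sign_triangle hψ.continuous h1' h.disjoint (fun i x hx => (h.on_arc i x hx).2) hij
        ((h.dots_on i j hij.le _ hcI' _ hcI' (hne _)).2 (Prod.ext rfl (heq (-1) h1' i j hij)))]

theorem sign_cross {β : ℝ × ℝ → X} (hβ : Continuous β) {ε : ℝ} (hε : ε ∈ Icc (-1 : ℝ) 1)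
    {K : Knot X} {a b : Fin 2 → ℝ} (hab : DisjointArcs a b)
    (hon : ∀ i, ∀ y ∈ Icc (-1 : ℝ) 1,
      K.curve ((a i + b i * y : ℝ) : UnitAddCircle) = β (cross ε i y)) {δ : ℤ}
    (hd : K.dots =ᶠ[𝓝 (β (cross ε 0 (bend ε)))] β '' crossDots ε δ) (hδ : δ = 1 ∨ δ = -1) :
    K.sign ((a 0 + b 0 * bend ε : ℝ) : UnitAddCircle)
      ((a 1 + b 1 * bend ε : ℝ) : UnitAddCircle) =
      (if δ = 1 then -1 else 1) * (if 0 < b 0 * b 1 then 1 else -1) := by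
  have hc := bend_mem hε
  have hcI : bend ε ∈ Icc (-1 : ℝ) 1 := Ioo_subset_Icc_self hc
  have h0 := bend_eq ε
  -- The strands are graphs over the second coordinate, so the coordinates are exchanged. Dots to
  -- the left and right (`δ = 1`) become dots above and below both graphs, the case where `f` is
  -- over.
  refine sign_graph (β := β ∘ Prod.swap) (hβ.comp continuous_swap) (hab.ne_zero 0)
    (hab.ne_zero 1) hc (f := fun y => y - ε * ((1 - y ^ 2) / 2))
    (g := fun y => -(y - ε * ((1 - y ^ 2) / 2))) (by fun_prop) (by fun_prop) (hon 0) (hon 1)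
    (by linarith) (η := min (1 - bend ε) (bend ε + 1))
    (lt_min (by linarith [hc.2]) (by linarith [hc.1])) (fun x hx hx' => ?_) (fun x hx hx' => ?_)
    (fun h => absurd (hab _ _ _ hcI _ hcI h).1 (by decide)) (d := Prod.swap '' crossDots ε δ) ?_
    (Eventually.of_forall fun q hq => ?_)
  · have := min_le_left (1 - bend ε) (bend ε + 1)
    obtain ⟨k, hk, h⟩ := sub_parabola_eq hε (x := x) ⟨by linarith [hc.1], by linarith⟩
    have := mul_pos hk (sub_pos.2 hx)
    linarith
  · have := min_le_right (1 - bend ε) (bend ε + 1)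
    obtain ⟨k, hk, h⟩ := sub_parabola_eq hε (x := x) ⟨by linarith, by linarith [hc.2]⟩
    have := mul_neg_of_pos_of_neg hk (sub_neg.2 hx')
    linarith
  · rw [image_comp, ← image_comp Prod.swap, Prod.swap_swap_eq, image_id]
    exact hd
  · rw [image_swap_eq_preimage_swap]
    show 0 < (δ : ℝ) * (q.2 ^ 2 - (q.1 - ε * ((1 - q.1 ^ 2) / 2)) ^ 2)
    rcases hq with ⟨rfl, hq⟩ | ⟨hδ', hq⟩
    · push_cast
      linarith
    · rcases hδ with rfl | rfl
      · exact absurd rfl hδ'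
      · push_cast
        linarith

/-- The strands are deformed through `cross ε`, with `ε` from `1` to `-1`; at `ε = 0` the crossing
lies on the ridge, which is allowed for a mere homotopy. The formula for the sign does not involve
`ε`. -/
theorem co_eq_of_moveFive [Nonempty X] {K K' : Knot X} {δ : ℤ} (hδ : δ = 1 ∨ δ = -1)
    (h : MoveFive δ K K') : K.co = K'.co := by
  obtain ⟨n, -, φ, hφ, i₀, j₀, hij₀, h⟩ := h
  obtain ⟨a, b, h⟩ := h.exists_strandReplacement
  have hβ : Continuous (φ ∘ Book.plane i₀ j₀) := hφ.continuous.comp (Book.continuous_plane i₀ j₀)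
  have h1 : (1 : ℝ) ∈ Icc (-1 : ℝ) 1 := by norm_num
  have h1' : (-1 : ℝ) ∈ Icc (-1 : ℝ) 1 := by norm_num
  have hlt : ∀ i j : Fin 2, i < j → i = 0 ∧ j = 1 := by decide
  have hsnd : ∀ ε (i : Fin 2) y, (cross ε i y).2 = y := by
    intro ε i y
    fin_cases i <;> rfl
  have hcross : ∀ ε ∈ Icc (-1 : ℝ) 1, ∀ i j : Fin 2, i < j → ∀ x ∈ Icc (-1 : ℝ) 1,
      ∀ y ∈ Icc (-1 : ℝ) 1, cross ε i x = cross ε j y → x = bend ε ∧ y = bend ε := by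
    intro ε hε i j hij x hx y _ e
    obtain ⟨rfl, rfl⟩ := hlt i j hij
    have e2 := congrArg Prod.snd e
    rw [hsnd, hsnd] at e2
    subst e2
    have e1 : x - ε * ((1 - x ^ 2) / 2) = -(x - ε * ((1 - x ^ 2) / 2)) := congrArg Prod.fst e
    obtain ⟨k, hk, hk'⟩ := sub_parabola_eq hε hx
    have h0 : k * (x - bend ε) = 0 := by linarith
    rcases mul_eq_zero.1 h0 with h | h
    · exact absurd h hk.ne'
    · exact ⟨by linarith, by linarith⟩
  have heq : ∀ ε, cross ε 0 (bend ε) = cross ε 1 (bend ε) := by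
    intro ε
    have := bend_eq ε
    refine Prod.ext ?_ rfl
    show bend ε - ε * ((1 - bend ε ^ 2) / 2) = -(bend ε - ε * ((1 - bend ε ^ 2) / 2))
    linarith
  have hbox : ∀ ε ∈ Icc (-1 : ℝ) 1, ∀ i, ∀ y ∈ Icc (-1 : ℝ) 1, cross ε i y ∈ wideBox := by
    intro ε hε i y hy
    have h3 : 0 ≤ 1 - y ^ 2 := by nlinarith [hy.1, hy.2]
    have h4 : y - ε * ((1 - y ^ 2) / 2) ∈ Icc (-2 : ℝ) 2 := by
      constructor <;> nlinarith [hε.1, hε.2, hy.1, hy.2, sq_nonneg y]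
    refine ⟨?_, by rw [hsnd]; exact hy⟩
    fin_cases i
    · exact h4
    · exact ⟨neg_le_neg h4.2, (neg_le_neg h4.1).trans_eq (neg_neg 2)⟩
  have hinj : ∀ ε (i : Fin 2), InjOn (cross ε i) (Icc (-1) 1) := fun ε i x _ y _ e => by
    have := congrArg Prod.snd e
    rwa [hsnd, hsnd] at this
  refine h.co_eq hβ (hφ.injective.comp (Book.plane_injective hij₀))
    (fun i x hx => ⟨hbox 1 h1 i x hx, hbox (-1) h1' i x hx⟩)
    (ρ := fun i p => cross (1 - 2 * (p.1 : ℝ)) i p.2) (fun i => ?_)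
    (fun i x _ => by simp only [interp_zero]) (fun i x _ => by simp only [interp_one])
    (fun i τ x hx => ?_)
    (c := fun i j τ => bend (1 - 2 * (τ : ℝ))) (fun i j => continuous_bend.comp (by fun_prop))
    (fun i j => rfl) (fun i j τ => Ioo_subset_Icc_self (bend_mem (interp_mem τ)))
    (fun i j hij τ => ?_) (hinj 1) (hinj (-1))
    (fun i j hij => by simp only [interp_zero]; exact hcross 1 h1 i j hij)
    (fun i j hij => by simp only [interp_one]; exact hcross (-1) h1' i j hij)
    (fun i j hij => ?_)
  · have hu : Continuous fun p : unitInterval × ℝ =>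
        p.2 - (1 - 2 * (p.1 : ℝ)) * ((1 - p.2 ^ 2) / 2) := by fun_prop
    fin_cases i
    · exact hu.prodMk continuous_snd
    · exact hu.neg.prodMk continuous_snd
  · have hx2 : x ^ 2 = 1 := by rcases hx with rfl | rfl <;> norm_num
    fin_cases i <;> simp [cross, hx2]
  · obtain ⟨rfl, rfl⟩ := hlt i j hij
    exact heq _
  · obtain ⟨rfl, rfl⟩ := hlt i j hij
    have hcI := Ioo_subset_Icc_self (bend_mem h1)
    have hcI' := Ioo_subset_Icc_self (bend_mem h1')
    have hne : ∀ c : ℝ, ((0 : Fin 2), c) ≠ (1, c) := fun c e => hij.ne (Prod.ext_iff.1 e).1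
    simp only [interp_zero, interp_one]
    rw [sign_cross hβ h1 h.disjoint (fun i x hx => (h.on_arc i x hx).1)
        ((h.dots_on 0 1 hij.le _ hcI _ hcI (hne _)).1 (heq 1)) hδ,
      sign_cross hβ h1' h.disjoint (fun i x hx => (h.on_arc i x hx).2)
        ((h.dots_on 0 1 hij.le _ hcI' _ hcI' (hne _)).2 (heq (-1))) hδ]

/-! ### The first and the second Reidemeister move -/

/-- If `|b i| ≥ 1`, the parameters `0` and `1 / b i` both lie in `[-1, 1]` and give the same circle
point, one full turn apart. -/
theorem DisjointArcs.abs_lt_one {m : ℕ} {a b : Fin m → ℝ} (hab : DisjointArcs a b) (i : Fin m) :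
    |b i| < 1 := by
  by_contra! hcon
  have hb := hab.ne_zero i
  have h1 : |(b i)⁻¹| ≤ 1 := by
    rw [abs_inv]
    exact inv_le_one_of_one_le₀ hcon
  have h2 := (hab i i 0 (by norm_num) (b i)⁻¹ (abs_le.1 h1) (by
    rw [mul_inv_cancel₀ hb, mul_zero, add_zero, AddCircle.coe_add_period])).2
  exact inv_ne_zero hb h2.symm

/-- Invariance under addition of crossings with total contribution zero. -/
theorem StrandReplacement.co_eq_of_sum_eq_zero [Nonempty X] {M : Type*} [TopologicalSpace M]
    {β : M → X} {B : Set M} {m : ℕ} {σ σ' : Fin m → ℝ → M} {d d' : Fin m → Fin m → Set M}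
    {K K' : Knot X} {a b : Fin m → ℝ} (h : StrandReplacement β B σ σ' d d' K K' a b)
    (hβ : Continuous β) (hinj : Function.Injective β)
    (hB : ∀ i, ∀ x ∈ Icc (-1 : ℝ) 1, σ i x ∈ B ∧ σ' i x ∈ B)
    {ρ : Fin m → unitInterval × ℝ → M} (hρ : ∀ i, Continuous (ρ i))
    (hρ0 : ∀ i, ∀ x ∈ Icc (-1 : ℝ) 1, ρ i (0, x) = σ i x)
    (hρ1 : ∀ i, ∀ x ∈ Icc (-1 : ℝ) 1, ρ i (1, x) = σ' i x)
    (hend : ∀ i τ, ∀ x, x = -1 ∨ x = 1 → ρ i (τ, x) = σ i x)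
    (hσ : ∀ i j, ∀ x ∈ Icc (-1 : ℝ) 1, ∀ y ∈ Icc (-1 : ℝ) 1, σ i x = σ j y → i = j ∧ x = y)
    (hsum : ∑ᶠ p ∈ K'.doublePairsIn (arcSet a b), K'.crossTerm p = 0) : K.co = K'.co := by
  obtain ⟨F, hF, hoff, h0, h1, hon⟩ := h.exists_homotopy hβ hρ hρ0 hρ1 hend
  refine co_eq_of_doublePairsIn isClosed_arcSet hF hoff h0 h1 (h.mixed hB)
    (fun p hp hp1 _ => h.dots_off _ _ hp.1 hp.2 (h.off_arc _ hp1).2) ?_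
  have hempty : K.doublePairsIn (arcSet a b) = ∅ := by
    refine eq_empty_of_forall_notMem ?_
    rintro ⟨u, v⟩ ⟨⟨hne, hK⟩, ⟨i, x, hx, rfl⟩, j, y, hy, rfl⟩
    dsimp only at hne hK
    rw [(h.on_arc i x hx).1, (h.on_arc j y hy).1] at hK
    obtain ⟨rfl, rfl⟩ := hσ i j x hx y hy (hinj hK)
    exact hne rfl
  rw [hsum, hempty, finsum_mem_empty]

/-- The correction terms in the colinking class are designed for this cancellation. -/
theorem smoothVec_eq_zero [Nonempty X] {γ : C(UnitAddCircle, X)} {s t : UnitAddCircle}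
    (h1 : arcVec γ s t = Finsupp.single (FreeClass.trivial X) 1)
    (h2 : arcVec γ t s = loopVec γ) : smoothVec γ s t = 0 := by
  unfold smoothVec
  rw [h1, h2]
  abel

/-- The crossing of a strand which is homotopic to a strand with a cusp. -/
theorem smoothVec_kink_eq_zero [PathConnectedSpace X] [Nonempty X] {ψ : ℝ × ℝ → X}
    (hψ : Continuous ψ) {γ : C(UnitAddCircle, X)} {a b : Fin 1 → ℝ} (hab : DisjointArcs a b)
    (hon : ∀ x ∈ Icc (-1 : ℝ) 1, γ ((a 0 + b 0 * x : ℝ) : UnitAddCircle) = ψ (kink x)) :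
    smoothVec γ ((a 0 - |b 0| / 2 : ℝ) : UnitAddCircle)
      ((a 0 + |b 0| / 2 : ℝ) : UnitAddCircle) = 0 := by
  have hb1 := hab.abs_lt_one 0
  have hb0 : 0 < |b 0| := abs_pos.2 (hab.ne_zero 0)
  have hz : ∀ i : Fin 1, i = 0 := fun i => Subsingleton.elim i 0
  -- With `s = 1 - τ` the numerator `4 x³ - s² x` vanishes at `x = ± s / 2`, the double point; at `τ
  -- = 1` it has shrunk to a cusp. The denominator `4 - s²` keeps the ends of the strand fixed.
  let k : unitInterval × ℝ → ℝ × ℝ := fun p =>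
    ((4 * p.2 ^ 3 - (1 - (p.1 : ℝ)) ^ 2 * p.2) / (4 - (1 - (p.1 : ℝ)) ^ 2), p.2 ^ 2 - 1)
  have hden : ∀ τ : unitInterval, 0 < 4 - (1 - (τ : ℝ)) ^ 2 := fun τ => by
    nlinarith [τ.2.1, τ.2.2]
  have hk : Continuous k := by
    refine Continuous.prodMk (Continuous.div (by fun_prop) (by fun_prop) fun p => ?_) (by fun_prop)
    exact (hden p.1).ne'
  have hk0 : ∀ x, k (0, x) = kink x := by
    intro x
    simp only [k, kink, Icc.coe_zero]
    norm_num
  have hkend : ∀ τ x, x = -1 ∨ x = 1 → k (τ, x) = kink x := by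
    rintro τ x hx
    have := (hden τ).ne'
    rcases hx with rfl | rfl
    · refine Prod.ext ?_ rfl
      simp only [k, kink]
      rw [div_eq_div_iff this (by norm_num)]
      ring
    · refine Prod.ext ?_ rfl
      simp only [k, kink]
      rw [div_eq_div_iff this (by norm_num)]
      ring
  have hkc : ∀ τ : unitInterval,
      k (τ, -((1 - (τ : ℝ)) / 2)) = k (τ, (1 - (τ : ℝ)) / 2) := by
    intro τ
    refine Prod.ext ?_ ?_
    · simp only [k]
      congr 1
      ring
    · simp only [k]
      ring
  obtain ⟨F, hF, hoff, hFon⟩ := exists_glue hab γ (ρ := fun _ p => ψ (k p))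
    (fun _ => hψ.comp hk) (fun i τ x hx => by
      rw [hz i, hkend τ x hx, hon x (by rcases hx with rfl | rfl <;> norm_num)])
  have h0 : ∀ u, γ u = F (0, u) := by
    refine curve_ext_of_arcs (a := a) (b := b) (fun u hu => (hoff 0 u hu).symm) fun i x hx => ?_
    rw [hFon i 0 x hx, hk0, hz i, hon x hx]
  let γ' : C(UnitAddCircle, X) := ⟨fun u => F (1, u), by fun_prop⟩
  have hFR : Continuous fun p : unitInterval × ℝ => F (p.1, (p.2 : UnitAddCircle)) :=
    hF.comp (continuous_fst.prodMk ((AddCircle.continuous_mk' 1).comp continuous_snd))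
  have hmem : ∀ τ : unitInterval, (1 - (τ : ℝ)) / 2 ∈ Icc (-1 : ℝ) 1 ∧
      -((1 - (τ : ℝ)) / 2) ∈ Icc (-1 : ℝ) 1 := fun τ => by
    refine ⟨⟨?_, ?_⟩, ?_, ?_⟩ <;> linarith [τ.2.1, τ.2.2]
  have hst : ∀ τ : unitInterval,
      F (τ, ((a 0 - |b 0| * ((1 - (τ : ℝ)) / 2) : ℝ) : UnitAddCircle)) =
        F (τ, ((a 0 + |b 0| * ((1 - (τ : ℝ)) / 2) : ℝ) : UnitAddCircle)) := by
    intro τ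
    have e1 := hFon 0 τ _ (hmem τ).1
    have e2 := hFon 0 τ _ (hmem τ).2
    rw [mul_neg, ← sub_eq_add_neg, hkc] at e2
    rcases abs_choice (b 0) with h | h
    · rw [h, e1, e2]
    · rw [h, neg_mul, sub_neg_eq_add, ← sub_eq_add_neg, e1, e2]
  have hγ : γ ((a 0 - |b 0| / 2 : ℝ) : UnitAddCircle) =
      γ ((a 0 + |b 0| / 2 : ℝ) : UnitAddCircle) := by
    rw [h0, h0]
    have := hst 0
    simp only [Icc.coe_zero, sub_zero, mul_one_div] at this
    exact this
  have hper : ∀ x : ℝ, ((x + 1 : ℝ) : UnitAddCircle) = x := AddCircle.coe_add_period 1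
  apply smoothVec_eq_zero
  · rw [arcVec_coe γ (by linarith) (by linarith) hγ]
    unfold loopVec
    congr 1
    rw [mk_subloop_eq hFR (s := fun τ => a 0 - |b 0| * ((1 - (τ : ℝ)) / 2))
      (t := fun τ => a 0 + |b 0| * ((1 - (τ : ℝ)) / 2)) (by fun_prop) (by fun_prop) hst
      (fun x => h0 x) (γ' := γ') (fun x => rfl) (a' := a 0) (b' := a 0)
      (by simp [div_eq_mul_inv]) (by simp [div_eq_mul_inv]) (by simp) (by simp) hγ rfl]
    refine mk_eq_trivial_of_const (x := γ' (a 0 : UnitAddCircle)) fun u => ?_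
    obtain ⟨x, hx, rfl⟩ := exists_Ico_coe u
    rw [subloop_coe _ _ hx, sub_self, mul_zero, add_zero]
  · have hγ1 : γ ((a 0 + |b 0| / 2 : ℝ) : UnitAddCircle) =
        γ ((a 0 - |b 0| / 2 + 1 : ℝ) : UnitAddCircle) := by rw [hper, hγ]
    have hγ' : γ' (a 0 : UnitAddCircle) = γ' ((a 0 + 1 : ℝ) : UnitAddCircle) := by rw [hper]
    -- The other lobe grows to a full turn starting at the cusp, which is freely homotopic to the
    -- whole loop.
    rw [← hper (a 0 - |b 0| / 2), arcVec_coe γ (by linarith) (by linarith) hγ1]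
    unfold loopVec
    congr 1
    rw [mk_subloop_eq hFR (s := fun τ => a 0 + |b 0| * ((1 - (τ : ℝ)) / 2))
      (t := fun τ => a 0 - |b 0| * ((1 - (τ : ℝ)) / 2) + 1) (by fun_prop) (by fun_prop)
      (fun τ => by rw [hper]; exact (hst τ).symm)
      (fun x => h0 x) (γ' := γ') (fun x => rfl) (a' := a 0) (b' := a 0 + 1)
      (by simp [div_eq_mul_inv]) (by simp [div_eq_mul_inv]) (by simp) (by simp) hγ1 hγ',
      mk_subloop_full]
    exact (mk_eq_of_circle_family hF h0 fun u => rfl).symm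

theorem kink_eq {x y : ℝ} (h : kink x = kink y) :
    x = y ∨ (x = 1 / 2 ∧ y = -(1 / 2)) ∨ (x = -(1 / 2) ∧ y = 1 / 2) := by
  obtain ⟨h1, h2⟩ := Prod.ext_iff.1 h
  simp only [kink] at h1 h2
  have h3 : (x - y) * (x + y) = 0 := by linear_combination h2
  rcases mul_eq_zero.1 h3 with h | h
  · exact Or.inl (by linarith)
  · obtain rfl : y = -x := by linarith
    have h4 : x * ((2 * x - 1) * (2 * x + 1)) = 0 := by linear_combination (3 / 2) * h1
    rcases mul_eq_zero.1 h4 with rfl | h4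
    · exact Or.inl (by simp)
    · rcases mul_eq_zero.1 h4 with h4 | h4
      · exact Or.inr (Or.inl ⟨by linarith, by linarith⟩)
      · exact Or.inr (Or.inr ⟨by linarith, by linarith⟩)

/-- Linear interpolation is a sufficient homotopy for the old crossings; the new one contributes
zero by `smoothVec_kink_eq_zero`, whatever its sign. -/
theorem co_eq_of_moveOne [PathConnectedSpace X] [Nonempty X] {ε : ℤ} {K K' : Knot X}
    (h : MoveOne ε K K') : K.co = K'.co := by
  obtain ⟨ψ, hψ, h⟩ := h
  obtain ⟨a, b, h⟩ := h.exists_strandReplacement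
  have hz : ∀ i : Fin 1, i = 0 := fun i => Subsingleton.elim i 0
  refine h.co_eq_of_sum_eq_zero hψ.continuous hψ.injective (fun i x hx => ⟨⟨hx, ?_, ?_⟩,
    ⟨?_, ?_⟩, ?_, ?_⟩) (ρ := fun _ p => (1 - (p.1 : ℝ)) • (p.2, 0) + (p.1 : ℝ) • kink p.2)
    (fun i => by unfold kink; fun_prop) (fun i x _ => by simp) (fun i x _ => by simp)
    (fun i τ x hx => ?_) (fun i j x _ y _ e => ⟨Subsingleton.elim _ _, (Prod.ext_iff.1 e).1⟩) ?_
  · norm_num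
  · norm_num
  · show -1 ≤ (4 * x ^ 3 - x) / 3
    have h1 : 0 ≤ x + 1 := by linarith [hx.1]
    -- The identity behind this is `4 x³ - x + 3 = (x + 1) ((2 x - 1)² + 2)`.
    nlinarith [mul_nonneg h1 (sq_nonneg (2 * x - 1))]
  · show (4 * x ^ 3 - x) / 3 ≤ 1
    have h1 : 0 ≤ 1 - x := by linarith [hx.2]
    nlinarith [mul_nonneg h1 (sq_nonneg (2 * x + 1))]
  · show -2 ≤ x ^ 2 - 1
    nlinarith [sq_nonneg x]
  · show x ^ 2 - 1 ≤ 2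
    nlinarith [hx.1, hx.2]
  · have : kink x = (x, 0) := by
      rcases hx with rfl | rfl <;> simp only [kink] <;> norm_num
    rw [this, ← add_smul, sub_add_cancel, one_smul]
  · refine finsum_mem_eq_zero_of_forall_eq_zero ?_
    rintro ⟨u, v⟩ ⟨⟨hne, hK⟩, ⟨i, x, hx, rfl⟩, j, y, hy, rfl⟩
    obtain rfl := hz i
    obtain rfl := hz j
    dsimp only at hne hK
    rw [(h.on_arc 0 x hx).2, (h.on_arc 0 y hy).2] at hK
    have hs := smoothVec_kink_eq_zero hψ.continuous h.disjoint fun x hx => (h.on_arc 0 x hx).2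
    have hs' := hs
    rw [smoothVec_swap] at hs'
    have hcase := kink_eq (hψ.injective hK)
    unfold crossTerm
    dsimp only
    rcases hcase with rfl | ⟨rfl, rfl⟩ | ⟨rfl, rfl⟩
    · exact absurd rfl hne
    · rw [mul_neg, ← sub_eq_add_neg, mul_one_div]
      rcases abs_choice (b 0) with h | h
      · rw [h] at hs'
        rw [hs', smul_zero]
      · rw [h, neg_div, sub_neg_eq_add, ← sub_eq_add_neg] at hs
        rw [hs, smul_zero]
    · rw [mul_neg, ← sub_eq_add_neg, mul_one_div]
      rcases abs_choice (b 0) with h | h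
      · rw [h] at hs
        rw [hs, smul_zero]
      · rw [h, neg_div, sub_neg_eq_add, ← sub_eq_add_neg] at hs'
        rw [hs', smul_zero]

/-- The two crossings of a bigon have the same smoothings. -/
theorem smoothVec_bigon_eq [Nonempty X] {ψ : ℝ × ℝ → X} (hψ : Continuous ψ)
    {γ : C(UnitAddCircle, X)} {a b : Fin 2 → ℝ} (hab : DisjointArcs a b)
    (hon : ∀ i, ∀ x ∈ Icc (-1 : ℝ) 1, γ ((a i + b i * x : ℝ) : UnitAddCircle) =
      ψ (![fun x : ℝ => ((x, 0) : ℝ × ℝ), fun x => (x, 2 * x ^ 2 - 1)] i x))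
    {r : ℝ} (hr2 : 2 * r ^ 2 = 1) {i j : Fin 2} (hij : i ≠ j) :
    smoothVec γ ((a i + b i * r : ℝ) : UnitAddCircle) ((a j + b j * r : ℝ) : UnitAddCircle) =
      smoothVec γ ((a i + b i * (-r) : ℝ) : UnitAddCircle)
        ((a j + b j * (-r) : ℝ) : UnitAddCircle) := by
  -- The double point slides from one crossing of the bigon to the other.
  let w : unitInterval → ℝ := fun τ => (1 - 2 * (τ : ℝ)) * r
  have hw : Continuous w := by fun_prop
  have hw2 : ∀ τ, 2 * w τ ^ 2 ≤ 1 := by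
    intro τ
    have h1 : (1 - 2 * (τ : ℝ)) ^ 2 ≤ 1 := by nlinarith [τ.2.1, τ.2.2]
    have h2 : 2 * w τ ^ 2 = (1 - 2 * (τ : ℝ)) ^ 2 * (2 * r ^ 2) := by ring
    rw [h2, hr2, mul_one]
    exact h1
  have hwI : ∀ τ, w τ ∈ Icc (-1 : ℝ) 1 := fun τ => abs_le.1 (abs_le_of_sq_le_sq
    (by linarith [hw2 τ, sq_nonneg (w τ)]) zero_le_one)
  have hden : ∀ τ, 0 < 1 - w τ ^ 2 := fun τ => by linarith [hw2 τ]
  -- The parabola through `(± w, 0)` and `(± 1, 1)`. It equals the given one for `w = ± r` and is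
  -- tangent to the axis for `w = 0`, so the homotopy begins and ends at `γ` and carries one
  -- crossing to the other.
  let g : unitInterval × ℝ → ℝ := fun p => (p.2 ^ 2 - w p.1 ^ 2) / (1 - w p.1 ^ 2)
  have hg : Continuous g := Continuous.div (by fun_prop) (by fun_prop) fun p => (hden p.1).ne'
  have hgw : ∀ τ, 2 * w τ ^ 2 = 1 → ∀ x, g (τ, x) = 2 * x ^ 2 - 1 := by
    intro τ h x
    simp only [g]
    rw [div_eq_iff (hden τ).ne']
    linear_combination (x ^ 2 - 1) * h
  let ρ : Fin 2 → unitInterval × ℝ → ℝ × ℝ := ![fun p => (p.2, 0), fun p => (p.2, g p)]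
  have hρ : ∀ i, Continuous (ρ i) := by
    intro i
    fin_cases i
    · exact continuous_snd.prodMk continuous_const
    · exact continuous_snd.prodMk hg
  obtain ⟨F, hF, hoff, hFon⟩ := exists_glue hab γ (ρ := fun i p => ψ (ρ i p))
    (fun i => hψ.comp (hρ i)) (fun i τ x hx => by
      have hx2 : x ^ 2 = 1 := by rcases hx with rfl | rfl <;> norm_num
      have : g (τ, x) = 2 * x ^ 2 - 1 := by
        simp only [g, hx2]
        rw [div_self (hden τ).ne']
        norm_num
      rw [hon i x (by rcases hx with rfl | rfl <;> norm_num)]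
      fin_cases i
      · rfl
      · show ψ (x, g (τ, x)) = ψ (x, 2 * x ^ 2 - 1)
        rw [this])
  have hFγ : ∀ τ, 2 * w τ ^ 2 = 1 → ∀ u, γ u = F (τ, u) := by
    intro τ hτ
    refine curve_ext_of_arcs (a := a) (b := b) (fun u hu => (hoff τ u hu).symm) fun i x hx => ?_
    rw [hFon i τ x hx, hon i x hx]
    fin_cases i
    · rfl
    · show ψ (x, 2 * x ^ 2 - 1) = ψ (x, g (τ, x))
      rw [hgw τ hτ]
  have hw0 : w 0 = r := by simp [w]
  have hw1 : w 1 = -r := by simp only [w, Icc.coe_one]; ring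
  have hρw : ∀ i τ, ρ i (τ, w τ) = (w τ, 0) := by
    intro i τ
    fin_cases i
    · rfl
    · refine Prod.ext rfl ?_
      show g (τ, w τ) = 0
      simp [g]
  have := smoothVec_eq_of_family hF (s := fun τ => a i + b i * w τ) (t := fun τ => a j + b j * w τ)
    (by fun_prop) (by fun_prop)
    (fun τ h => hij (hab _ _ _ (hwI τ) _ (hwI τ) h).1)
    (fun τ => by rw [hFon i τ _ (hwI τ), hFon j τ _ (hwI τ), hρw, hρw])
    (hFγ 0 (by rw [hw0, hr2])) (hFγ 1 (by rw [hw1, neg_sq, hr2]))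
  rwa [hw0, hw1] at this

/-- The two new crossings have the same lobes by `smoothVec_bigon_eq`. The same strand is over at
both, but the order of the slopes is opposite, so the signs cancel. -/
theorem co_eq_of_moveTwo [Nonempty X] {K K' : Knot X} (h : MoveTwo K K') : K.co = K'.co := by
  classical
  obtain ⟨ψ, hψ, P, h⟩ := h
  obtain ⟨a, b, h⟩ := h.exists_strandReplacement
  let ρ : Fin 2 → unitInterval × ℝ → ℝ × ℝ :=
    ![fun p => (p.2, 0), fun p => (p.2, 1 + (p.1 : ℝ) * (2 * p.2 ^ 2 - 2))]
  refine h.co_eq_of_sum_eq_zero hψ.continuous hψ.injective (fun i x hx => ?_) (ρ := ρ)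
    (fun i => ?_) (fun i x _ => ?_) (fun i x _ => ?_) (fun i τ x hx => ?_)
    (fun i j x _ y _ e => ?_) ?_
  · have h0 : ((x, 0) : ℝ × ℝ) ∈ box := ⟨hx, by norm_num⟩
    have h1 : ((x, 1) : ℝ × ℝ) ∈ box := ⟨hx, by norm_num⟩
    have h2 : ((x, 2 * x ^ 2 - 1) : ℝ × ℝ) ∈ box := by
      refine ⟨hx, ?_, ?_⟩
      · show -2 ≤ 2 * x ^ 2 - 1
        nlinarith [sq_nonneg x]
      · show 2 * x ^ 2 - 1 ≤ 2
        nlinarith [hx.1, hx.2]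
    fin_cases i
    · exact ⟨h0, h0⟩
    · exact ⟨h1, h2⟩
  · fin_cases i
    · exact continuous_snd.prodMk continuous_const
    · exact continuous_snd.prodMk (by fun_prop)
  · fin_cases i <;> simp [ρ]
  · fin_cases i
    · rfl
    · refine Prod.ext rfl ?_
      show 1 + ((1 : unitInterval) : ℝ) * (2 * x ^ 2 - 2) = 2 * x ^ 2 - 1
      rw [Icc.coe_one]
      ring
  · have hx2 : x ^ 2 = 1 := by rcases hx with rfl | rfl <;> norm_num
    fin_cases i <;> simp [ρ, hx2]
  · fin_cases i <;> fin_cases j <;> simp at e ⊢ <;> exact e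
  · obtain ⟨r, hr0, hr2⟩ : ∃ r : ℝ, 0 < r ∧ 2 * r ^ 2 = 1 :=
      ⟨√(1 / 2), Real.sqrt_pos.2 (by norm_num), by
        rw [Real.sq_sqrt (by norm_num)]; norm_num⟩
    have hr1 : r < 1 := by nlinarith
    have hrI : r ∈ Icc (-1 : ℝ) 1 := ⟨by linarith, by linarith⟩
    have hrI' : -r ∈ Icc (-1 : ℝ) 1 := ⟨by linarith, by linarith⟩
    have hon1 : ∀ x ∈ Icc (-1 : ℝ) 1,
        K'.curve ((a 0 + b 0 * x : ℝ) : UnitAddCircle) = ψ (x, 0) :=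
      fun x hx => (h.on_arc 0 x hx).2
    have hon2 : ∀ x ∈ Icc (-1 : ℝ) 1,
        K'.curve ((a 1 + b 1 * x : ℝ) : UnitAddCircle) = ψ (x, 2 * x ^ 2 - 1) :=
      fun x hx => (h.on_arc 1 x hx).2
    have hcur : ∀ x ∈ Icc (-1 : ℝ) 1, 2 * x ^ 2 = 1 → ∀ i,
        K'.curve ((a i + b i * x : ℝ) : UnitAddCircle) = ψ (x, 0) := by
      intro x hx hx2 i
      fin_cases i
      · exact hon1 x hx
      · refine (hon2 x hx).trans ?_
        rw [hx2, sub_self]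
    have hne : ∀ x ∈ Icc (-1 : ℝ) 1, ∀ i j : Fin 2, i ≠ j →
        ((a i + b i * x : ℝ) : UnitAddCircle) ≠ ((a j + b j * x : ℝ) : UnitAddCircle) :=
      fun x hx i j hij e => hij (h.disjoint _ _ _ hx _ hx e).1
    have hsq' : 2 * (-r) ^ 2 = 1 := by rw [neg_sq, hr2]
    -- The steeper strand plays the role of `f` in `sign_graph`: at `r` the parabola, over if `P`;
    -- at `-r` the axis, over if `¬ P`.
    have hsign : K'.sign ((a 0 + b 0 * r : ℝ) : UnitAddCircle)
          ((a 1 + b 1 * r : ℝ) : UnitAddCircle) =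
        -K'.sign ((a 0 + b 0 * (-r) : ℝ) : UnitAddCircle)
          ((a 1 + b 1 * (-r) : ℝ) : UnitAddCircle) := by
      have hc : Continuous fun x : ℝ => 2 * x ^ 2 - 1 := by fun_prop
      have hd := (h.dots_on 0 1 (by decide) r hrI r hrI (by simp)).2
        (Prod.ext rfl (by show (0 : ℝ) = 2 * r ^ 2 - 1; linarith))
      have hd' := (h.dots_on 0 1 (by decide) (-r) hrI' (-r) hrI' (by simp)).2
        (Prod.ext rfl (by show (0 : ℝ) = 2 * (-r) ^ 2 - 1; linarith))
      rw [sign_swap (hne r hrI 0 1 (by decide)) (by rw [hcur r hrI hr2, hcur r hrI hr2]),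
        sign_graph hψ.continuous (h.disjoint.ne_zero 1) (h.disjoint.ne_zero 0)
          ⟨by linarith, hr1⟩ hc continuous_const hon2 hon1 (by linarith) hr0
          (fun x hx _ => by show (0 : ℝ) < 2 * x ^ 2 - 1; nlinarith)
          (fun x hx hx' => by show 2 * x ^ 2 - 1 < (0 : ℝ); nlinarith)
          (hne r hrI 1 0 (by decide)) (fOver := P)
          (by rw [hr2, sub_self]; exact hd) ?_,
        sign_graph hψ.continuous (h.disjoint.ne_zero 0) (h.disjoint.ne_zero 1)
          ⟨by linarith, by linarith⟩ continuous_const hc hon1 hon2 (by linarith) hr0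
          (fun x hx hx' => by show 2 * x ^ 2 - 1 < (0 : ℝ); nlinarith)
          (fun x hx hx' => by show (0 : ℝ) < 2 * x ^ 2 - 1; nlinarith)
          (hne (-r) hrI' 0 1 (by decide)) (fOver := ¬ P) hd' ?_, mul_comm (b 1)]
      · by_cases hP : P <;> by_cases hb : 0 < b 0 * b 1 <;> simp [hP, hb]
      · have : ∀ᶠ q : ℝ × ℝ in 𝓝 (-r, 0), q.1 < 0 :=
          (isOpen_lt continuous_fst continuous_const).mem_nhds (by simpa using hr0)
        filter_upwards [this] with q hq hq'
        exact Or.inr ⟨hq, hq'⟩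
      · have : ∀ᶠ q : ℝ × ℝ in 𝓝 (r, 2 * r ^ 2 - 1), 0 < q.1 :=
          (isOpen_lt continuous_const continuous_fst).mem_nhds hr0
        filter_upwards [this] with q hq hq'
        exact Or.inl ⟨hq, hq'⟩
    have hterm : ∀ i j : Fin 2, i ≠ j →
        K'.crossTerm (((a i + b i * r : ℝ) : UnitAddCircle), ((a j + b j * r : ℝ) : UnitAddCircle)) +
        K'.crossTerm (((a i + b i * (-r) : ℝ) : UnitAddCircle),
          ((a j + b j * (-r) : ℝ) : UnitAddCircle)) = 0 := by
      have h01 : K'.crossTerm (((a 0 + b 0 * r : ℝ) : UnitAddCircle),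
            ((a 1 + b 1 * r : ℝ) : UnitAddCircle)) +
          K'.crossTerm (((a 0 + b 0 * (-r) : ℝ) : UnitAddCircle),
            ((a 1 + b 1 * (-r) : ℝ) : UnitAddCircle)) = 0 := by
        unfold crossTerm
        dsimp only
        rw [hsign, smoothVec_bigon_eq hψ.continuous h.disjoint (fun i x hx => (h.on_arc i x hx).2)
          hr2 (by decide : (0 : Fin 2) ≠ 1), ← add_smul, neg_add_cancel, zero_smul]
      have hswap : ∀ x ∈ Icc (-1 : ℝ) 1, 2 * x ^ 2 = 1 →
          K'.crossTerm (((a 1 + b 1 * x : ℝ) : UnitAddCircle),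
            ((a 0 + b 0 * x : ℝ) : UnitAddCircle)) =
          K'.crossTerm (((a 0 + b 0 * x : ℝ) : UnitAddCircle),
            ((a 1 + b 1 * x : ℝ) : UnitAddCircle)) := by
        intro x hx hx2
        refine crossTerm_swap (p := (((a 0 + b 0 * x : ℝ) : UnitAddCircle),
          ((a 1 + b 1 * x : ℝ) : UnitAddCircle))) ⟨hne x hx 0 1 (by decide), ?_⟩
        rw [hcur x hx hx2, hcur x hx hx2]
      intro i j hij
      have hcase : (i = 0 ∧ j = 1) ∨ (i = 1 ∧ j = 0) := by
        revert i j
        decide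
      rcases hcase with ⟨rfl, rfl⟩ | ⟨rfl, rfl⟩
      · exact h01
      · rw [hswap r hrI hr2, hswap (-r) hrI' hsq', h01]
    let ξ : Bool → ℝ := fun s => if s then r else -r
    have hξ : ∀ s, ξ s ∈ Icc (-1 : ℝ) 1 ∧ 2 * ξ s ^ 2 = 1 := by
      rintro (_ | _)
      · exact ⟨hrI', hsq'⟩
      · exact ⟨hrI, hr2⟩
    have hξi : Function.Injective ξ := by
      rintro (_ | _) (_ | _) e
      · rfl
      · exact absurd e (by simp only [ξ]; norm_num; linarith)
      · exact absurd e (by simp only [ξ]; norm_num; linarith)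
      · rfl
    -- Four ordered double pairs, indexed by the strand of the first entry and by the crossing; `1 -
    -- i` is the other strand. Summing over the crossing first gives the cancelling pairs.
    let pt : Fin 2 × Bool → UnitAddCircle × UnitAddCircle := fun q =>
      (((a q.1 + b q.1 * ξ q.2 : ℝ) : UnitAddCircle),
        ((a (1 - q.1) + b (1 - q.1) * ξ q.2 : ℝ) : UnitAddCircle))
    have hpt : Function.Injective pt := by
      rintro ⟨i, s⟩ ⟨j, t⟩ e
      obtain ⟨h1, h2⟩ := h.disjoint _ _ _ (hξ s).1 _ (hξ t).1 (Prod.ext_iff.1 e).1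
      exact Prod.ext h1 (hξi h2)
    have h1i : ∀ i : Fin 2, i ≠ 1 - i := by decide
    have hset : K'.doublePairsIn (arcSet a b) = range pt := by
      ext ⟨u, v⟩
      constructor
      · rintro ⟨⟨hne', hK⟩, ⟨i, x, hx, rfl⟩, j, y, hy, rfl⟩
        dsimp only at hne' hK
        rw [(h.on_arc i x hx).2, (h.on_arc j y hy).2] at hK
        have e := hψ.injective hK
        have hxy : x = y ∧ (i ≠ j → 2 * x ^ 2 = 1) := by
          fin_cases i <;> fin_cases j <;> simp at e ⊢
          · exact e
          · exact ⟨e.1, by rw [e.1]; linarith [e.2]⟩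
          · exact ⟨e.1, by linarith [e.2]⟩
          · exact e.1
        obtain ⟨rfl, hx2⟩ := hxy
        have hij : i ≠ j := fun h => hne' (by rw [h])
        have hfin : ∀ i j : Fin 2, i ≠ j → j = 1 - i := by decide
        obtain rfl := hfin i j hij
        have hxr : (x - r) * (x + r) = 0 := by nlinarith [hx2 hij]
        rcases mul_eq_zero.1 hxr with hx' | hx'
        · obtain rfl : x = r := by linarith
          exact ⟨(i, true), rfl⟩
        · obtain rfl : x = -r := by linarith
          exact ⟨(i, false), rfl⟩
      · rintro ⟨⟨i, s⟩, e⟩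
        obtain ⟨rfl, rfl⟩ := Prod.ext_iff.1 e
        refine ⟨⟨hne _ (hξ s).1 _ _ (h1i i), ?_⟩, mem_arcSet (hξ s).1, mem_arcSet (hξ s).1⟩
        simp only [pt]
        rw [hcur _ (hξ s).1 (hξ s).2, hcur _ (hξ s).1 (hξ s).2]
    rw [hset, finsum_mem_range hpt, finsum_eq_sum_of_fintype, Fintype.sum_prod_type]
    refine Finset.sum_eq_zero fun i _ => ?_
    rw [Fintype.sum_bool]
    exact hterm i (1 - i) (h1i i)

/-! ### Invariance under isotopy -/

theorem co_eq_of_basicMove [PathConnectedSpace X] [Nonempty X] {K K' : Knot X}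
    (h : BasicMove K K') : K.co = K'.co := by
  cases h with
  | ambient h => exact co_eq_of_ambientIsotopic h
  | onePos h => exact co_eq_of_moveOne h
  | oneNeg h => exact co_eq_of_moveOne h
  | two h => exact co_eq_of_moveTwo h
  | three h => exact co_eq_of_moveThree h
  | four h => exact co_eq_of_moveFour h
  | fivePos h => exact co_eq_of_moveFive (Or.inl rfl) h
  | fiveNeg h => exact co_eq_of_moveFive (Or.inr rfl) h
  | six h => exact co_eq_of_moveSix h
  | seven h => exact co_eq_of_moveSeven h

theorem co_eq_of_isotopic [PathConnectedSpace X] [Nonempty X] {K K' : Knot X}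
    (h : K.Isotopic K') : K.co = K'.co := by
  induction h with
  | rel _ _ h => exact co_eq_of_basicMove h
  | refl _ => rfl
  | symm _ _ _ ih => exact ih.symm
  | trans _ _ _ _ _ ih₁ ih₂ => exact ih₁.trans ih₂

end Knot

end TwoComplex

theorem mainTheorem5 (X : Type*) [TopologicalSpace X] [ConnectedSpace X]
    (hX : TwoComplex.IsTwoComplex X) :
    (∀ K K' : TwoComplex.Knot X, K.Isotopic K' → K.co = K'.co) ∧
    (∀ K : TwoComplex.Knot X, K.mirror.co = -K.co) ∧
    (∀ K : TwoComplex.Knot X, K.reverse.co = TwoComplex.barTensor K.co) ∧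
    (∀ K : TwoComplex.Knot X, K.IsLocal → K.co = 0) := by
  have := hX.pathConnectedSpace
  exact ⟨fun _ _ h => TwoComplex.Knot.co_eq_of_isotopic h, TwoComplex.Knot.co_mirror,
    TwoComplex.Knot.co_reverse, fun _ h => TwoComplex.Knot.co_eq_zero_of_isLocal h⟩
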